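/- Let $\Omega\subset\mathbb{C}^d$ be a bounded domain (a non-empty, connected, bounded open set), let $\mu$ be Lebesgue measure on $\Omega$, let $H^\infty(\Omega)$ be the algebra of bounded holomorphic functions on $\Omega$, with the weak* topology that it inherits from $L^\infty(\Omega,\mu)=L^1(\Omega,\mu)^*$, and let $L^2_a(\Omega)$ be the Bergman space of holomorphic functions on $\Omega$ that lie in $L^2(\Omega,\mu)$. Let $\mathcal{A}$ be a weak*-closed subalgebra of $H^\infty(\Omega)$ that contains the constants. For $f\in L^2_a(\Omega)$ and the measure $\nu=|f|^2\mu$, let $\mathcal{A}^2(\nu)$ be the closure of $\mathcal{A}$ in $L^2(\Omega,\nu)$. For $z\in\Omega$ such that $\phi\mapsto\phi(z)$ $(\phi\in\mathcal{A})$ extends to a continuous linear functional on $\mathcal{A}^2(\nu)$, let $k^\nu_z\in\mathcal{A}^2(\nu)$ be the reproducing kernel at $z$, i.e. the unique element of $\mathcal{A}^2(\nu)$ with $\phi(z)=\langle\phi,k^\nu_z\rangle_{L^2(\nu)}$ for all $\phi\in\mathcal{A}$; for all other $z\in\Omega$ put $k^\nu_z=0$. Let $k^\nu(x,y)=\langle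 k^\nu_y,k^\nu_x\rangle_{L^2(\nu)}$. Let $z_1,\dots,z_n\in\Omega$ and $w_1,\dots,w_n\in\mathbb{C}$. Then there is a function $\phi\in\mathcal{A}$ with $\sup_{z\in\Omega}|\phi(z)|\le 1$ and $\phi(z_i)=w_i$ for $i=1,\dots,n$ if and only if the matrix \[ \bigl[(1-w_i\overline{w_j})\,k^\nu(z_i,z_j)\bigr]_{i,j=1}^n \] is positive semidefinite for every measure of the form $\nu=|f|^2\mu$ with $f\in L^2_a(\Omega)$. -/

import Mathlib

open MeasureTheory
open scoped ENNReal ComplexConjugate ComplexOrder Topology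

noncomputable section

namespace BergmanPick

/-- A function given on a set `Ω ⊆ ℂ^d` is holomorphic. Only the values on `Ω` matter; for open `Ω`
this is complex differentiability at every point of `Ω`. -/
def Holo {d : ℕ} (Ω : Set (Fin d → ℂ)) (φ : Ω → ℂ) : Prop :=
  ∃ F : (Fin d → ℂ) → ℂ, DifferentiableOn ℂ F Ω ∧ ∀ z : Ω, F z = φ z

/-- `H^∞(Ω)`: the unital algebra of bounded holomorphic functions on `Ω`. -/
def HInfty {d : ℕ} (Ω : Set (Fin d → ℂ)) : Subalgebra ℂ (Ω → ℂ) where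
  carrier := {φ | Holo Ω φ ∧ ∃ C : ℝ, ∀ z, ‖φ z‖ ≤ C}
  mul_mem' := by
    rintro φ ψ ⟨⟨F, hF, hFφ⟩, C, hC⟩ ⟨⟨G, hG, hGψ⟩, D, hD⟩
    refine ⟨⟨F * G, hF.mul hG, fun z => by simp [hFφ, hGψ]⟩, C * D, fun z => ?_⟩
    rw [Pi.mul_apply, norm_mul]
    exact mul_le_mul (hC z) (hD z) (norm_nonneg _) ((norm_nonneg _).trans (hC z))
  add_mem' := by
    rintro φ ψ ⟨⟨F, hF, hFφ⟩, C, hC⟩ ⟨⟨G, hG, hGψ⟩, D, hD⟩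
    exact ⟨⟨F + G, hF.add hG, fun z => by simp [hFφ, hGψ]⟩, C + D,
      fun z => (norm_add_le _ _).trans (add_le_add (hC z) (hD z))⟩
  algebraMap_mem' := fun c =>
    ⟨⟨fun _ => c, differentiableOn_const c, fun _ => rfl⟩, ‖c‖, fun _ => le_rfl⟩

/-- Lebesgue measure `μ` on the measurable set `Ω ⊆ ℂ^d`. -/
def leb {d : ℕ} (Ω : Set (Fin d → ℂ)) : Measure Ω :=
  Measure.comap Subtype.val volume

/-- The weak* topology of `H^∞(Ω) ⊆ L^∞(Ω) = L^1(Ω)*`: the coarsest topology for which all the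
functionals `φ ↦ ∫_Ω φ h dμ`, `h ∈ L^1(Ω, μ)`, are continuous (`μ` is Lebesgue measure on `Ω`). -/
@[reducible]
def weakStar {d : ℕ} (Ω : Set (Fin d → ℂ)) : TopologicalSpace (HInfty Ω) :=
  TopologicalSpace.induced
    (fun (φ : HInfty Ω) (h : Lp ℂ 1 (leb Ω)) => ∫ z, (φ : Ω → ℂ) z * h z ∂(leb Ω))
    Pi.topologicalSpace

/-- `f` belongs to the Bergman space `L²_a(Ω)`. -/
def MemBergman {d : ℕ} (Ω : Set (Fin d → ℂ)) (f : Ω → ℂ) : Prop :=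
  Holo Ω f ∧ MemLp f 2 (leb Ω)

/-- The measure `|f|² μ` on `Ω`, where `μ` is Lebesgue measure. -/
def sqMeasure {d : ℕ} {Ω : Set (Fin d → ℂ)} (f : Ω → ℂ) : Measure Ω :=
  (leb Ω).withDensity fun z => ‖f z‖ₑ ^ 2

/-- The classes in `L²(Ω, ν)` of the functions in `A`. -/
def classes {d : ℕ} {Ω : Set (Fin d → ℂ)} (A : Subalgebra ℂ (HInfty Ω)) (ν : Measure Ω) :
    Submodule ℂ (Lp ℂ 2 ν) where
  carrier := {g | ∃ φ ∈ A, ⇑g =ᵐ[ν] (φ : Ω → ℂ)}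
  zero_mem' := ⟨0, A.zero_mem, Lp.coeFn_zero ℂ 2 ν⟩
  add_mem' := by
    rintro g h ⟨φ, hφ, hg⟩ ⟨ψ, hψ, hh⟩
    exact ⟨φ + ψ, A.add_mem hφ hψ, (Lp.coeFn_add g h).trans (hg.add hh)⟩
  smul_mem' := by
    rintro c g ⟨φ, hφ, hg⟩
    exact ⟨c • φ, A.smul_mem hφ c, (Lp.coeFn_smul c g).trans (hg.const_smul c)⟩

/-- `A²(ν)`: the closure of `A` in `L²(Ω, ν)`. -/
def A2 {d : ℕ} {Ω : Set (Fin d → ℂ)} (A : Subalgebra ℂ (HInfty Ω)) (ν : Measure Ω) :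
    Submodule ℂ (Lp ℂ 2 ν) :=
  (classes A ν).topologicalClosure

/-- `k ∈ A²(ν)` reproduces the evaluation at `z`: `φ(z) = ⟨φ, k⟩` for all `φ ∈ A`. (Mathlib's inner
product is linear in the second variable.) There is at most one such `k`, since `A` is dense in
`A²(ν)`, and there is one exactly when evaluation at `z` extends to a continuous functional on
`A²(ν)`, that is, when `ν` is dominating for `z`. -/
def Reproduces {d : ℕ} {Ω : Set (Fin d → ℂ)} (A : Subalgebra ℂ (HInfty Ω)) (ν : Measure Ω)
    (z : Ω) (k : Lp ℂ 2 ν) : Prop :=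
  k ∈ A2 A ν ∧ ∀ φ ∈ A, ∀ g : Lp ℂ 2 ν, ⇑g =ᵐ[ν] (φ : Ω → ℂ) → inner ℂ k g = (φ : Ω → ℂ) z

open Classical in
/-- The kernel vector `k_z^ν ∈ A²(ν)`; it is `0` at the points `z` whose evaluation is not
continuous on `A²(ν)`. -/
def kernelAt {d : ℕ} {Ω : Set (Fin d → ℂ)} (A : Subalgebra ℂ (HInfty Ω)) (ν : Measure Ω)
    (z : Ω) : Lp ℂ 2 ν :=
  if h : ∃ k, Reproduces A ν z k then h.choose else 0

/-- The kernel function `k^ν(x, y) = ⟨k_y^ν, k_x^ν⟩`, in the convention where the inner product is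
linear in the first variable. -/
def kernel {d : ℕ} {Ω : Set (Fin d → ℂ)} (A : Subalgebra ℂ (HInfty Ω)) (ν : Measure Ω)
    (x y : Ω) : ℂ :=
  inner ℂ (kernelAt A ν x) (kernelAt A ν y)

end BergmanPick

end

/-!
Let `ev z` be evaluation at `z`, a bounded function on the unit ball of `A`. Since `A` is weak*
closed, `Λ ∘ ev` lies in `A` for every bounded functional `Λ`, so by Hahn–Banach it is enough to
show `|∑ cᵢ wᵢ| ≤ ‖∑ cᵢ ev zᵢ‖`.

A combination `y = ∑ cᵢ ev zᵢ` with `‖y‖ ≤ 1` can be written exactly as `φ ↦ ∫ φ f ḡ dμ` with `f`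
and `g` in the Bergman space, of norm at most `1 + ε`. By the maximum principle each `ev z` is a
limit of functionals `φ ↦ ∫ φ ∑ |aᵢ|² dμ` with the `aᵢ` concentrated near the boundary. Replacing
the `aᵢ` by a single randomly signed sum costs an error bounded by the variance of `ev` under
`∑ |aᵢ|² μ`, that is, by an increase of its second moment. As the second moment stays at most `1`,
averaging over many steps makes the error small. Vectors concentrated near the boundary are almost
disjoint from given ones, so such approximations can be superposed; this extends them from the
`ev z` to all `y`, and makes successive approximation converge to an exact factorization.

For `ν = |f|² μ` the functional `y` is `φ ↦ ⟨φ, g / f⟩` in `L²(ν)`. Positivity of the Pick matrix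
says that `k_z ↦ w̄ k_z` is a contraction on the span of the kernels at the `zᵢ`, whence
`|∑ cᵢ wᵢ| ≤ ‖f‖ ‖g‖`. Points whose evaluation is unbounded on `A²(ν)` drop out of the sum, and the
measure `μ` itself takes care of the linear relations between the evaluations.
-/

noncomputable section

namespace BergmanPick

open Metric Filter
open scoped BoundedContinuousFunction

section ComplexAnalysis

variable {E : Type*} [NormedAddCommGroup E] [NormedSpace ℂ E] {c : E} {R M : ℝ}

theorem norm_fderiv_le_of_norm_le {f : E → ℂ} (hR : 0 < R) (hd : DifferentiableOn ℂ f (ball c R))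
    (hM : ∀ x ∈ ball c R, ‖f x‖ ≤ M) : ‖fderiv ℂ f c‖ ≤ 2 * M / R :=
  Complex.norm_fderiv_le_div_of_mapsTo_ball hd (fun x hx => by
    rw [mem_closedBall_iff_norm]
    linarith [norm_sub_le (f x) (f c), hM x hx, hM c (mem_ball_self hR)]) hR

theorem norm_sub_sub_fderiv_le {f : E → ℂ} {z : E} (hR : 0 < R)
    (hd : DifferentiableOn ℂ f (ball c R)) (hM : ∀ x ∈ ball c R, ‖f x‖ ≤ M) (hz : z ∈ ball c R) :
    ‖f z - f c - fderiv ℂ f c (z - c)‖ ≤ 4 * M * (‖z - c‖ / R) ^ 2 := by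
  set g : E → ℂ := fun x => f x - fderiv ℂ f c (x - c) with hg
  have hgc : g c = f c := by simp [hg]
  have hsub : ∀ x, g x - f c = f x - f c - fderiv ℂ f c (x - c) := fun x => by
    simp only [hg]; ring
  have hbound : Set.MapsTo g (ball c R) (closedBall (g c) (4 * M)) := fun x hx => by
    have hlin : ‖fderiv ℂ f c (x - c)‖ ≤ 2 * M := by
      have hxR : ‖x - c‖ ≤ R := (mem_ball_iff_norm.1 hx).le
      calc ‖fderiv ℂ f c (x - c)‖ ≤ ‖fderiv ℂ f c‖ * ‖x - c‖ := (fderiv ℂ f c).le_opNorm _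
        _ ≤ 2 * M / R * R :=
          mul_le_mul (norm_fderiv_le_of_norm_le hR hd hM) hxR (norm_nonneg _)
            ((norm_nonneg _).trans (norm_fderiv_le_of_norm_le hR hd hM))
        _ = 2 * M := by field_simp
    rw [hgc, mem_closedBall_iff_norm, hsub]
    linarith [norm_sub_le (f x - f c) (fderiv ℂ f c (x - c)), norm_sub_le (f x) (f c), hM x hx,
      hM c (mem_ball_self hR)]
  have hgd : DifferentiableOn ℂ g (ball c R) := hd.sub (by fun_prop)
  have hlittle : (fun x => g x - g c) =o[𝓝 c] fun x => ‖x - c‖ ^ 1 := by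
    simp only [hgc, hsub, pow_one]
    exact (hd.differentiableAt (ball_mem_nhds c hR)).hasFDerivAt.isLittleO.norm_right
  have key := Complex.dist_le_mul_div_pow_of_mapsTo_ball_of_isLittleO hgd hbound hlittle hz
  rwa [hgc, dist_eq_norm, dist_eq_norm, hsub] at key

theorem differentiableAt_boundedContinuousFunction {ι : Type*} [TopologicalSpace ι]
    [DiscreteTopology ι] {Φ : E → ι →ᵇ ℂ} (hR : 0 < R)
    (hd : ∀ i, DifferentiableOn ℂ (fun x => Φ x i) (ball c R))
    (hM : ∀ i, ∀ x ∈ ball c R, ‖Φ x i‖ ≤ M) : DifferentiableAt ℂ Φ c := by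
  rcases isEmpty_or_nonempty ι with hι | ⟨⟨i₀⟩⟩
  · exact (differentiableAt_const 0).congr_of_eventuallyEq
      (Eventually.of_forall fun x => by ext i; exact isEmptyElim i)
  have hM0 : 0 ≤ M := (norm_nonneg _).trans (hM i₀ c (mem_ball_self hR))
  have hD : ∀ v i, ‖fderiv ℂ (fun x => Φ x i) c v‖ ≤ 2 * M / R * ‖v‖ := fun v i =>
    ContinuousLinearMap.le_of_opNorm_le _ (norm_fderiv_le_of_norm_le hR (hd i) (hM i)) v
  let D : E →L[ℂ] ι →ᵇ ℂ := LinearMap.mkContinuous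
    { toFun := fun v => BoundedContinuousFunction.ofNormedAddCommGroupDiscrete
        (fun i => fderiv ℂ (fun x => Φ x i) c v) _ (hD v)
      map_add' := fun v w => by ext i; simp
      map_smul' := fun a v => by ext i; simp } (2 * M / R)
    fun v => BoundedContinuousFunction.norm_ofNormedAddCommGroup_le _ (by positivity) (hD v)
  have hquad : (fun x => Φ x - Φ c - D (x - c)) =O[𝓝 c] fun x => ‖x - c‖ ^ 2 := by
    refine Asymptotics.IsBigO.of_bound (4 * M / R ^ 2) ?_
    filter_upwards [ball_mem_nhds c hR] with x hx
    rw [BoundedContinuousFunction.norm_le (by positivity)]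
    refine fun i => (norm_sub_sub_fderiv_le hR (hd i) (hM i) hx).trans_eq ?_
    rw [norm_pow, norm_norm, div_pow]
    ring
  have hsq : (fun x => ‖x - c‖ ^ 2) =o[𝓝 c] fun x => x - c := by
    have hid : Tendsto (fun x => x - c) (𝓝 c) (𝓝 0) := tendsto_sub_nhds_zero_iff.2 tendsto_id
    exact ((Asymptotics.isLittleO_norm_pow_id one_lt_two).comp_tendsto hid)
  exact ⟨D, hasFDerivAt_iff_isLittleO.2 (hquad.trans_isLittleO hsq)⟩

theorem uniformCauchySeqOn_fderiv {F : ℕ → E → ℂ} (hR : 0 < R)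
    (hd : ∀ n, DifferentiableOn ℂ (F n) (ball c R))
    (h : UniformCauchySeqOn F atTop (ball c R)) :
    UniformCauchySeqOn (fun n => fderiv ℂ (F n)) atTop (ball c (R / 2)) := by
  rw [Metric.uniformCauchySeqOn_iff] at h ⊢
  intro ε hε
  obtain ⟨N, hN⟩ := h (ε * R / 8) (by positivity)
  refine ⟨N, fun m hm n hn x hx => ?_⟩
  have hsub : ball x (R / 2) ⊆ ball c R :=
    ball_subset_ball' (by rw [mem_ball] at hx; linarith)
  have hx2 : ball x (R / 2) ∈ 𝓝 x := ball_mem_nhds x (by positivity)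
  have hdm := (hd m).mono hsub
  have hdn := (hd n).mono hsub
  have key := norm_fderiv_le_of_norm_le (M := ε * R / 8) (half_pos hR) (hdm.fun_sub hdn)
    fun y hy => by simpa only [dist_eq_norm] using (hN m hm n hn y (hsub hy)).le
  rw [fderiv_fun_sub (hdm.differentiableAt hx2) (hdn.differentiableAt hx2)] at key
  calc dist (fderiv ℂ (F m) x) (fderiv ℂ (F n) x)
      ≤ 2 * (ε * R / 8) / (R / 2) := (dist_eq_norm _ _).trans_le key
    _ = ε / 2 := by field_simp; norm_num
    _ < ε := half_lt_self hε

theorem differentiableAt_of_tendstoUniformlyOn_ball {F : ℕ → E → ℂ} {g : E → ℂ} (hR : 0 < R)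
    (hd : ∀ n, DifferentiableOn ℂ (F n) (ball c R))
    (h : TendstoUniformlyOn F g atTop (ball c R)) : DifferentiableAt ℂ g c := by
  have hcauchy := uniformCauchySeqOn_fderiv hR hd h.uniformCauchySeqOn
  choose! g' hg' using fun x hx => cauchySeq_tendsto_of_complete (hcauchy.cauchySeq (x := x) hx)
  have hsub : ball c (R / 2) ⊆ ball c R := ball_subset_ball (half_le_self hR.le)
  exact (hasFDerivAt_of_tendstoUniformlyOn isOpen_ball (hcauchy.tendstoUniformlyOn_of_tendsto hg')
    (fun n x hx => ((hd n).differentiableAt (isOpen_ball.mem_nhds (hsub hx))).hasFDerivAt)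
    (fun x hx => h.tendsto_at (hsub hx)) (mem_ball_self (half_pos hR))).differentiableAt

theorem circleAverage_comp_smul {f : E → ℂ} {z v : E} (hd : DifferentiableOn ℂ f (ball z R))
    (hv : v ∈ ball 0 R) : Real.circleAverage (fun t : ℂ => f (z + t • v)) 0 1 = f z := by
  have hmaps : Set.MapsTo (fun t : ℂ => z + t • v) (closedBall 0 1) (ball z R) := fun t ht => by
    rw [mem_closedBall_zero_iff] at ht
    rw [mem_ball_zero_iff] at hv
    rw [mem_ball_iff_norm, add_sub_cancel_left, norm_smul]
    exact (mul_le_of_le_one_left (norm_nonneg _) ht).trans_lt hv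
  have hcomp : DifferentiableOn ℂ (fun t : ℂ => f (z + t • v)) (closure (ball 0 |1|)) := by
    rw [abs_one]
    exact (hd.comp (by fun_prop) hmaps).mono closure_ball_subset_closedBall
  simpa using hcomp.diffContOnCl.circleAverage

theorem enorm_circleAverage_le {F : Type*} [NormedAddCommGroup F] [NormedSpace ℝ F]
    (f : ℂ → F) (c : ℂ) (r : ℝ) :
    ‖Real.circleAverage f c r‖ₑ ≤
      ⨍⁻ θ in Set.Ioc 0 (2 * Real.pi), ‖f (circleMap c r θ)‖ₑ ∂volume := by
  rw [Real.circleAverage_eq_intervalAverage, Set.uIoc_of_le Real.two_pi_pos.le]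
  exact enorm_integral_le_lintegral_enorm _

theorem measurePreserving_circle_smul {d : ℕ} (u : Circle) :
    MeasurePreserving (fun v : Fin d → ℂ => (u : ℂ) • v) volume volume :=
  volume_preserving_pi fun _ : Fin d => (rotation u).measurePreserving

theorem lintegral_setLAverage_circle_smul {d : ℕ} {h : (Fin d → ℂ) → ℝ≥0∞} (hh : Measurable h) :
    ∫⁻ v, ⨍⁻ θ in Set.Ioc 0 (2 * Real.pi), h ((Circle.exp θ : ℂ) • v) ∂volume = ∫⁻ v, h v := by
  have hrot : ∀ θ : ℝ, ∫⁻ v, h ((Circle.exp θ : ℂ) • v) = ∫⁻ v, h v := fun θ =>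
    (measurePreserving_circle_smul (Circle.exp θ)).lintegral_comp hh
  have hcont : Continuous fun p : (Fin d → ℂ) × ℝ => (Circle.exp p.2 : ℂ) • p.1 := by fun_prop
  simp only [laverage]
  rw [lintegral_lintegral_swap (f := fun v θ => h ((Circle.exp θ : ℂ) • v))
    (hh.comp hcont.measurable).aemeasurable]
  simp only [hrot]
  exact setLAverage_const (by simp [Real.pi_pos]) measure_Ioc_lt_top.ne _

theorem enorm_mul_volume_ball_le {d : ℕ} {f : (Fin d → ℂ) → ℂ} {z : Fin d → ℂ} {r : ℝ}
    (hd : DifferentiableOn ℂ f (ball z r)) :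
    ‖f z‖ₑ * volume (ball z r) ≤ ∫⁻ x in ball z r, ‖f x‖ₑ := by
  set h : (Fin d → ℂ) → ℝ≥0∞ := (ball 0 r).indicator fun v => ‖f (z + v)‖ₑ
  have htranslate : MeasurePreserving (fun v : Fin d → ℂ => z + v) (volume.restrict (ball 0 r))
      (volume.restrict (ball z r)) := by
    have := (measurePreserving_add_left volume z).restrict_preimage
      (measurableSet_ball (x := z) (ε := r))
    simpa [preimage_add_ball] using this
  have hh : Measurable h := by
    classical
    refine ContinuousOn.measurable_piecewise (g := fun _ => 0) ?_ continuousOn_const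
      measurableSet_ball
    refine (hd.continuousOn.comp (by fun_prop) fun v hv => ?_).enorm
    simpa [mem_ball_iff_norm] using hv
  have hpt : (ball (0 : Fin d → ℂ) r).indicator (fun _ => ‖f z‖ₑ) ≤ fun v =>
      ⨍⁻ θ in Set.Ioc 0 (2 * Real.pi), h ((Circle.exp θ : ℂ) • v) ∂volume := by
    refine Set.indicator_le fun v hv => ?_
    have hv' : ∀ θ : ℝ, (Circle.exp θ : ℂ) • v ∈ ball (0 : Fin d → ℂ) r := fun θ => by
      simpa [norm_smul] using hv
    rw [← circleAverage_comp_smul hd hv]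
    refine (enorm_circleAverage_le _ _ _).trans_eq (setLAverage_congr_fun measurableSet_Ioc ?_)
    intro θ _
    simp only [h, Set.indicator_of_mem (hv' θ)]
    simp [circleMap, Circle.coe_exp]
  calc ‖f z‖ₑ * volume (ball z r)
      = ∫⁻ v, (ball (0 : Fin d → ℂ) r).indicator (fun _ => ‖f z‖ₑ) v := by
        rw [lintegral_indicator_const measurableSet_ball, Measure.addHaar_ball_center]
    _ ≤ ∫⁻ v, ⨍⁻ θ in Set.Ioc 0 (2 * Real.pi), h ((Circle.exp θ : ℂ) • v) ∂volume :=
      lintegral_mono hpt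
    _ = ∫⁻ v in ball 0 r, ‖f (z + v)‖ₑ := by
        rw [lintegral_setLAverage_circle_smul hh, lintegral_indicator measurableSet_ball]
    _ = ∫⁻ x in ball z r, ‖f x‖ₑ :=
        htranslate.lintegral_comp_emb (measurableEmbedding_addLeft z) fun x => ‖f x‖ₑ

end ComplexAnalysis

section AbsPair

variable {X : Type*} [MeasurableSpace X] {μ : Measure X}

theorem norm_sq_eq_integral (u : Lp ℂ 2 μ) : ‖u‖ ^ 2 = ∫ x, ‖u x‖ ^ 2 ∂μ := by
  have h : inner ℂ u u = ((∫ x, ‖u x‖ ^ 2 ∂μ : ℝ) : ℂ) := by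
    rw [L2.inner_def, ← integral_complex_ofReal]
    simp only [inner_self_eq_norm_sq_to_K, Complex.coe_algebraMap, Complex.ofReal_pow]
  rw [← inner_self_eq_norm_sq (𝕜 := ℂ), h]
  exact Complex.ofReal_re _

theorem integrable_norm_sq (u : Lp ℂ 2 μ) : Integrable (fun x => ‖u x‖ ^ 2) μ :=
  (memLp_two_iff_integrable_sq_norm (Lp.aestronglyMeasurable u)).1 (Lp.memLp u)

/-- The pairing `∫ |u| |v| dμ`, which measures how far `u` and `v` are from having disjoint
supports. -/
def absPair (u v : Lp ℂ 2 μ) : ℝ := ∫ x, ‖u x‖ * ‖v x‖ ∂μ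

theorem integrable_norm_mul_norm (u v : Lp ℂ 2 μ) : Integrable (fun x => ‖u x‖ * ‖v x‖) μ :=
  (Lp.memLp u).norm.integrable_mul (Lp.memLp v).norm

theorem absPair_nonneg (u v : Lp ℂ 2 μ) : 0 ≤ absPair u v :=
  integral_nonneg fun _ => by positivity

theorem absPair_comm (u v : Lp ℂ 2 μ) : absPair u v = absPair v u := by
  simp only [absPair, mul_comm]

theorem absPair_le_norm_mul_norm (u v : Lp ℂ 2 μ) : absPair u v ≤ ‖u‖ * ‖v‖ := by
  have h := integral_mul_norm_le_Lp_mul_Lq (μ := μ) (f := u) (g := v) Real.HolderConjugate.two_two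
    (by simpa using Lp.memLp u) (by simpa using Lp.memLp v)
  simpa only [absPair, Real.rpow_two, ← Real.sqrt_eq_rpow, ← norm_sq_eq_integral,
    Real.sqrt_sq (norm_nonneg _)] using h

theorem absPair_add_left_le (u u' v : Lp ℂ 2 μ) :
    absPair (u + u') v ≤ absPair u v + absPair u' v := by
  simp only [absPair]
  rw [← integral_add (integrable_norm_mul_norm _ _) (integrable_norm_mul_norm _ _)]
  refine integral_mono_ae (integrable_norm_mul_norm _ _)
    ((integrable_norm_mul_norm _ _).add (integrable_norm_mul_norm _ _)) ?_
  filter_upwards [Lp.coeFn_add u u'] with x hx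
  rw [hx, Pi.add_apply, ← add_mul]
  gcongr
  exact norm_add_le _ _

theorem absPair_smul_left (c : ℂ) (u v : Lp ℂ 2 μ) : absPair (c • u) v = ‖c‖ * absPair u v := by
  rw [absPair, absPair, ← integral_const_mul]
  refine integral_congr_ae ?_
  filter_upwards [Lp.coeFn_smul c u] with x hx
  rw [hx, Pi.smul_apply, norm_smul, mul_assoc]

theorem norm_inner_le_absPair (u v : Lp ℂ 2 μ) : ‖inner ℂ u v‖ ≤ absPair u v := by
  rw [L2.inner_def]
  exact norm_integral_le_of_norm_le (integrable_norm_mul_norm u v)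
    (ae_of_all _ fun x => norm_inner_le_norm _ _)

variable {s t : ℂ}

theorem norm_le_one_of_sq_add_sq (hst : ‖s‖ ^ 2 + ‖t‖ ^ 2 = 1) : ‖s‖ ≤ 1 ∧ ‖t‖ ≤ 1 :=
  ⟨by nlinarith [norm_nonneg s], by nlinarith [norm_nonneg t]⟩

theorem norm_sq_combination_le (hst : ‖s‖ ^ 2 + ‖t‖ ^ 2 = 1) (u u' : Lp ℂ 2 μ) :
    ‖s • u + t • u'‖ ^ 2 ≤ ‖s‖ ^ 2 * ‖u‖ ^ 2 + ‖t‖ ^ 2 * ‖u'‖ ^ 2 + 2 * absPair u u' := by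
  have hcross : RCLike.re (inner ℂ (s • u) (t • u')) ≤ absPair u u' :=
    calc RCLike.re (inner ℂ (s • u) (t • u')) ≤ ‖inner ℂ (s • u) (t • u')‖ := RCLike.re_le_norm _
      _ = ‖s‖ * ‖t‖ * ‖inner ℂ u u'‖ := by
        rw [inner_smul_left, inner_smul_right, norm_mul, norm_mul, RCLike.norm_conj, mul_assoc]
      _ ≤ 1 * absPair u u' :=
        mul_le_mul (mul_le_one₀ (norm_le_one_of_sq_add_sq hst).1 (norm_nonneg _)
          (norm_le_one_of_sq_add_sq hst).2) (norm_inner_le_absPair u u') (norm_nonneg _) zero_le_one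
      _ = absPair u u' := one_mul _
  rw [@norm_add_sq ℂ, norm_smul, norm_smul, mul_pow, mul_pow]
  linarith

theorem absPair_combination_le (hst : ‖s‖ ^ 2 + ‖t‖ ^ 2 = 1) (u u' w : Lp ℂ 2 μ) :
    absPair (s • u + t • u') w ≤ absPair u w + absPair u' w := by
  refine (absPair_add_left_le _ _ _).trans (add_le_add ?_ ?_) <;> rw [absPair_smul_left]
  · exact mul_le_of_le_one_left (absPair_nonneg _ _) (norm_le_one_of_sq_add_sq hst).1
  · exact mul_le_of_le_one_left (absPair_nonneg _ _) (norm_le_one_of_sq_add_sq hst).2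

end AbsPair

section RankOne

/-- A strongly measurable family of vectors in the closed unit ball of `E`. In the application it
is the family of point evaluations, in a space containing the predual of the algebra. -/
structure ContractiveField (X E : Type*) [MeasurableSpace X] [NormedAddCommGroup E] where
  toFun : X → E
  stronglyMeasurable' : StronglyMeasurable toFun
  norm_le_one' : ∀ x, ‖toFun x‖ ≤ 1

namespace ContractiveField

variable {X E : Type*} [MeasurableSpace X] [NormedAddCommGroup E]

instance : CoeFun (ContractiveField X E) fun _ => X → E := ⟨toFun⟩

theorem stronglyMeasurable (e : ContractiveField X E) : StronglyMeasurable e :=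
  e.stronglyMeasurable'

theorem norm_le_one (e : ContractiveField X E) (x : X) : ‖e x‖ ≤ 1 := e.norm_le_one' x

end ContractiveField

variable {X E : Type*} [MeasurableSpace X] {μ : Measure X} [NormedAddCommGroup E]
  [NormedSpace ℂ E]

theorem integrable_mul_conj (u v : Lp ℂ 2 μ) : Integrable (fun x => u x * conj (v x)) μ :=
  (Lp.memLp u).integrable_mul (Lp.memLp v).star

theorem ContractiveField.integrable_smul (e : ContractiveField X E) {h : X → ℂ}
    (hh : Integrable h μ) : Integrable (fun x => h x • e x) μ :=
  hh.smul_bdd 1 e.stronglyMeasurable.aestronglyMeasurable (ae_of_all _ e.norm_le_one)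

theorem ContractiveField.norm_integral_smul_le (e : ContractiveField X E) (u v : Lp ℂ 2 μ) :
    ‖∫ x, (u x * conj (v x)) • e x ∂μ‖ ≤ absPair u v := by
  refine norm_integral_le_of_norm_le (integrable_norm_mul_norm u v) (ae_of_all _ fun x => ?_)
  rw [norm_smul, norm_mul, RCLike.norm_conj]
  exact mul_le_of_le_one_right (by positivity) (e.norm_le_one x)

/-- The sesquilinear map `(u, v) ↦ ∫ u v̄ e dμ`. When `e x` is evaluation at `x`, its value at
`(u, v)` is the functional `φ ↦ ∫ φ u v̄ dμ`, that is, the restriction of a rank one operator. -/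
def rankOne (e : ContractiveField X E) : Lp ℂ 2 μ →L[ℂ] Lp ℂ 2 μ →L⋆[ℂ] E :=
  LinearMap.mkContinuous₂
    (LinearMap.mk₂'ₛₗ (RingHom.id ℂ) (starRingEnd ℂ)
      (fun u v => ∫ x, (u x * conj (v x)) • e x ∂μ)
      (fun u u' v => by
        rw [← integral_add (e.integrable_smul (integrable_mul_conj _ _))
          (e.integrable_smul (integrable_mul_conj _ _))]
        refine integral_congr_ae ?_
        filter_upwards [Lp.coeFn_add u u'] with x hx
        rw [hx, Pi.add_apply, ← add_smul, ← add_mul])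
      (fun c u v => by
        rw [RingHom.id_apply, ← integral_smul]
        refine integral_congr_ae ?_
        filter_upwards [Lp.coeFn_smul c u] with x hx
        rw [hx, Pi.smul_apply, smul_smul, smul_eq_mul, mul_assoc])
      (fun u v v' => by
        rw [← integral_add (e.integrable_smul (integrable_mul_conj _ _))
          (e.integrable_smul (integrable_mul_conj _ _))]
        refine integral_congr_ae ?_
        filter_upwards [Lp.coeFn_add v v'] with x hx
        rw [hx, Pi.add_apply, map_add, ← add_smul, ← mul_add])
      (fun c u v => by
        rw [← integral_smul]
        refine integral_congr_ae ?_
        filter_upwards [Lp.coeFn_smul c v] with x hx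
        rw [hx, Pi.smul_apply, smul_smul, smul_eq_mul, map_mul, mul_left_comm]))
    1 fun u v => by
      rw [one_mul]
      exact (e.norm_integral_smul_le u v).trans (absPair_le_norm_mul_norm u v)

variable (e : ContractiveField X E)

theorem rankOne_apply (u v : Lp ℂ 2 μ) :
    rankOne e u v = ∫ x, (u x * conj (v x)) • e x ∂μ := rfl

theorem norm_rankOne_le_absPair (u v : Lp ℂ 2 μ) : ‖rankOne e u v‖ ≤ absPair u v :=
  e.norm_integral_smul_le u v

theorem continuous_rankOne : Continuous fun p : Lp ℂ 2 μ × Lp ℂ 2 μ => rankOne e p.1 p.2 := by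
  refine continuous_iff_continuousAt.2 fun ⟨u₀, v₀⟩ => tendsto_iff_norm_sub_tendsto_zero.2 ?_
  have hbound : Tendsto (fun p : Lp ℂ 2 μ × Lp ℂ 2 μ =>
      ‖p.1 - u₀‖ * ‖p.2‖ + ‖u₀‖ * ‖p.2 - v₀‖) (𝓝 (u₀, v₀)) (𝓝 0) :=
    Continuous.tendsto' (by fun_prop) _ _ (by simp)
  refine squeeze_zero (fun _ => norm_nonneg _) (fun p => ?_) hbound
  have hsub : rankOne e p.1 p.2 - rankOne e u₀ v₀ =
      rankOne e (p.1 - u₀) p.2 + rankOne e u₀ (p.2 - v₀) := by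
    rw [map_sub, map_sub, sub_apply, sub_add_sub_cancel]
  rw [hsub]
  exact (norm_add_le _ _).trans (add_le_add
    ((norm_rankOne_le_absPair e _ _).trans (absPair_le_norm_mul_norm _ _))
    ((norm_rankOne_le_absPair e _ _).trans (absPair_le_norm_mul_norm _ _)))

theorem clm_rankOne [CompleteSpace E] {F : Type*} [NormedAddCommGroup F] [NormedSpace ℂ F]
    [CompleteSpace F] (Λ : E →L[ℂ] F) (u v : Lp ℂ 2 μ) :
    Λ (rankOne e u v) = ∫ x, (u x * conj (v x)) • Λ (e x) ∂μ := by
  rw [rankOne_apply, ← Λ.integral_comp_comm (e.integrable_smul (integrable_mul_conj u v))]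
  simp only [map_smul]

theorem norm_rankOne_combination_sub_le {s t : ℂ} (hst : ‖s‖ ^ 2 + ‖t‖ ^ 2 = 1)
    (u u' v v' : Lp ℂ 2 μ) :
    ‖rankOne e (s • u + t • u') (s • v + t • v') -
      (‖s‖ ^ 2 • rankOne e u v + ‖t‖ ^ 2 • rankOne e u' v')‖ ≤ absPair u v' + absPair u' v := by
  obtain ⟨hs, ht⟩ := norm_le_one_of_sq_add_sq hst
  have hsq : ∀ (r : ℂ) (y : E), ‖r‖ ^ 2 • y = (r * conj r) • y := fun r y => by
    rw [Complex.mul_conj', ← Complex.ofReal_pow, Complex.coe_smul]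
  have hexp : rankOne e (s • u + t • u') (s • v + t • v') -
      (‖s‖ ^ 2 • rankOne e u v + ‖t‖ ^ 2 • rankOne e u' v') =
      (s * conj t) • rankOne e u v' + (t * conj s) • rankOne e u' v := by
    simp only [map_add, map_smul, map_smulₛₗ, add_apply, smul_apply, hsq, smul_add, smul_smul]
    simp only [mul_comm (conj _)]
    abel
  rw [hexp]
  refine (norm_add_le _ _).trans (add_le_add ?_ ?_) <;>
    rw [norm_smul, norm_mul, RCLike.norm_conj]
  · exact (mul_le_of_le_one_left (norm_nonneg _) (mul_le_one₀ hs (norm_nonneg _) ht)).trans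
      (norm_rankOne_le_absPair e u v')
  · exact (mul_le_of_le_one_left (norm_nonneg _) (mul_le_one₀ ht (norm_nonneg _) hs)).trans
      (norm_rankOne_le_absPair e u' v)

/-- The closed linear span of a field. For the field of point evaluations on an algebra, this is
the predual of the algebra. -/
def ContractiveField.closedSpan : Submodule ℂ E :=
  (Submodule.span ℂ (Set.range e)).topologicalClosure

theorem mem_closedSpan (x : X) : e x ∈ e.closedSpan :=
  Submodule.le_topologicalClosure _ (Submodule.subset_span ⟨x, rfl⟩)

theorem rankOne_mem_closedSpan [CompleteSpace E] (u v : Lp ℂ 2 μ) :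
    rankOne e u v ∈ e.closedSpan := by
  have hclosed : IsClosed (e.closedSpan : Set E) := Submodule.isClosed_topologicalClosure _
  have hzero : e.closedSpan.mkQL (rankOne e u v) = 0 := by
    rw [clm_rankOne]
    simp [(Submodule.Quotient.mk_eq_zero _).2 (mem_closedSpan e _)]
  exact (Submodule.Quotient.mk_eq_zero _).1 hzero

end RankOne

section SuccessiveApproximation

theorem exists_eq_of_approx_step {P G : Type*} [PseudoMetricSpace P] [CompleteSpace P]
    [MetricSpace G] {T : P → G} (hT : Continuous T) {S : Set P} (hS : IsClosed S) {y : G}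
    {δ : ℝ → ℝ} (hδ : Tendsto δ (𝓝 0) (𝓝 0)) {C : ℝ}
    (hstep : ∀ t > 0, ∀ p ∈ S, dist (T p) y ≤ δ t →
      ∃ q ∈ S, dist p q ≤ C * t ∧ dist (T q) y ≤ δ (t / 2))
    {t : ℝ} (ht : 0 < t) {p₀ : P} (hp₀ : p₀ ∈ S) (hy : dist (T p₀) y ≤ δ t) :
    ∃ p ∈ S, dist p₀ p ≤ 2 * C * t ∧ T p = y := by
  have hstep' : ∀ (n : ℕ) (p : P), p ∈ S ∧ dist (T p) y ≤ δ (t / 2 ^ n) →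
      ∃ q, (q ∈ S ∧ dist (T q) y ≤ δ (t / 2 ^ (n + 1))) ∧ dist p q ≤ 2 * C * t / 2 / 2 ^ n := by
    rintro n p ⟨hpS, hpy⟩
    obtain ⟨q, hqS, hpq, hqy⟩ := hstep _ (by positivity) p hpS hpy
    exact ⟨q, ⟨hqS, by rwa [pow_succ, ← div_div]⟩, hpq.trans_eq (by ring)⟩
  choose! next hnext hdist using hstep'
  let u : ℕ → P := fun n => Nat.rec p₀ next n
  have hu : ∀ n, u n ∈ S ∧ dist (T (u n)) y ≤ δ (t / 2 ^ n) := fun n => by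
    induction n with
    | zero => exact ⟨hp₀, by simpa [u] using hy⟩
    | succ n ih => exact hnext n _ ih
  have hcauchy : ∀ n, dist (u n) (u (n + 1)) ≤ 2 * C * t / 2 / 2 ^ n := fun n => hdist n _ (hu n)
  obtain ⟨p, hp⟩ := cauchySeq_tendsto_of_complete (cauchySeq_of_le_geometric_two hcauchy)
  have hδn : Tendsto (fun n : ℕ => δ (t / 2 ^ n)) atTop (𝓝 0) :=
    hδ.comp (tendsto_const_nhds.div_atTop (tendsto_pow_atTop_atTop_of_one_lt one_lt_two))
  exact ⟨p, hS.mem_of_tendsto hp (Eventually.of_forall fun n => (hu n).1),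
    dist_le_of_le_geometric_two_of_tendsto₀ hcauchy hp,
    tendsto_nhds_unique ((hT.tendsto p).comp hp)
      (tendsto_iff_dist_tendsto_zero.2
        (squeeze_zero (fun _ => dist_nonneg) (fun n => (hu n).2) hδn))⟩

end SuccessiveApproximation

section Factorization

variable {X E : Type*} [MeasurableSpace X] {μ : Measure X} [NormedAddCommGroup E]
  [NormedSpace ℂ E] (M : Submodule ℂ (Lp ℂ 2 μ)) (e : ContractiveField X E)

/-- The vectors `y` that are approximated by `rankOne e f g` with `f`, `g` in `M` of norm about one
and almost disjoint from any prescribed finite set. Almost disjointness is what makes the set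
convex, and what lets the approximation be iterated. -/
def ApproxFactor : Set E :=
  {y | ∀ (W : Finset (Lp ℂ 2 μ)) (ε : ℝ), 0 < ε → ∃ f ∈ M, ∃ g ∈ M,
    ‖f‖ ^ 2 ≤ 1 + ε ∧ ‖g‖ ^ 2 ≤ 1 + ε ∧ (∀ w ∈ W, absPair f w ≤ ε ∧ absPair g w ≤ ε) ∧
    ‖rankOne e f g - y‖ ≤ ε}

variable {M e}

theorem norm_ofReal_sqrt_sq {a : ℝ} (ha : 0 ≤ a) : ‖(√a : ℂ)‖ ^ 2 = a := by
  rw [Complex.norm_real, Real.norm_of_nonneg (Real.sqrt_nonneg a), Real.sq_sqrt ha]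

theorem norm_convexCombination_sub_le {V : Type*} [SeminormedAddCommGroup V] [NormedSpace ℝ V]
    {a b ε : ℝ} (ha : 0 ≤ a) (hb : 0 ≤ b) (hab : a + b = 1) {x x' y y' : V}
    (h : ‖x - y‖ ≤ ε) (h' : ‖x' - y'‖ ≤ ε) :
    ‖a • x + b • x' - (a • y + b • y')‖ ≤ ε := by
  have hmem := convex_closedBall (0 : V) ε (mem_closedBall_zero_iff.2 h)
    (mem_closedBall_zero_iff.2 h') ha hb hab
  rwa [smul_sub, smul_sub, sub_add_sub_comm, mem_closedBall_zero_iff] at hmem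

theorem norm_sq_convexCombination_le {a b ε η : ℝ} (ha : 0 ≤ a) (hb : 0 ≤ b) (hab : a + b = 1)
    {f f' : Lp ℂ 2 μ} (hf : ‖f‖ ^ 2 ≤ 1 + ε) (hf' : ‖f'‖ ^ 2 ≤ 1 + ε) (hff' : absPair f' f ≤ η) :
    ‖(√a : ℂ) • f + (√b : ℂ) • f'‖ ^ 2 ≤ 1 + ε + 2 * η := by
  have hsqrt : ‖(√a : ℂ)‖ ^ 2 + ‖(√b : ℂ)‖ ^ 2 = 1 := by
    rwa [norm_ofReal_sqrt_sq ha, norm_ofReal_sqrt_sq hb]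
  have h := norm_sq_combination_le hsqrt f f'
  rw [norm_ofReal_sqrt_sq ha, norm_ofReal_sqrt_sq hb, absPair_comm] at h
  nlinarith

theorem convex_approxFactor : Convex ℝ (ApproxFactor M e) := by
  classical
  intro y hy y' hy' a b ha hb hab W ε hε
  obtain ⟨f, hf, g, hg, hfn, hgn, hW, hfg⟩ := hy W (ε / 3) (by positivity)
  obtain ⟨f', hf', g', hg', hfn', hgn', hW', hfg'⟩ :=
    hy' (insert f (insert g W)) (ε / 3) (by positivity)
  obtain ⟨hff, hgf⟩ := hW' f (by simp)
  obtain ⟨hfg₁, hgg⟩ := hW' g (by simp)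
  have hsqrt : ‖(√a : ℂ)‖ ^ 2 + ‖(√b : ℂ)‖ ^ 2 = 1 := by
    rwa [norm_ofReal_sqrt_sq ha, norm_ofReal_sqrt_sq hb]
  refine ⟨(√a : ℂ) • f + (√b : ℂ) • f', add_mem (M.smul_mem _ hf) (M.smul_mem _ hf'),
    (√a : ℂ) • g + (√b : ℂ) • g', add_mem (M.smul_mem _ hg) (M.smul_mem _ hg'),
    (norm_sq_convexCombination_le ha hb hab hfn hfn' hff).trans (by linarith),
    (norm_sq_convexCombination_le ha hb hab hgn hgn' hgg).trans (by linarith), fun w hw => ?_, ?_⟩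
  · have hw' := hW' w (by simp [hw])
    exact ⟨(absPair_combination_le hsqrt f f' w).trans (by linarith [(hW w hw).1]),
      (absPair_combination_le hsqrt g g' w).trans (by linarith [(hW w hw).2])⟩
  · have hcross := norm_rankOne_combination_sub_le e hsqrt f f' g g'
    rw [norm_ofReal_sqrt_sq ha, norm_ofReal_sqrt_sq hb, absPair_comm f g'] at hcross
    have happrox := norm_convexCombination_sub_le ha hb hab hfg hfg'
    exact (norm_sub_le_norm_sub_add_norm_sub _ _ _).trans (by linarith)

theorem isClosed_approxFactor : IsClosed (ApproxFactor M e) := by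
  refine isClosed_of_closure_subset fun y hy W ε hε => ?_
  obtain ⟨y', hy', hyy'⟩ := Metric.mem_closure_iff.1 hy (ε / 2) (by positivity)
  obtain ⟨f, hf, g, hg, hfn, hgn, hW, hfg⟩ := hy' W (ε / 2) (by positivity)
  rw [dist_comm, dist_eq_norm] at hyy'
  exact ⟨f, hf, g, hg, by linarith, by linarith,
    fun w hw => ⟨by linarith [(hW w hw).1], by linarith [(hW w hw).2]⟩,
    (norm_sub_le_norm_sub_add_norm_sub _ y' _).trans (by linarith)⟩

theorem smul_mem_approxFactor {y : E} (hy : y ∈ ApproxFactor M e) {a : ℂ} (ha : ‖a‖ = 1) :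
    a • y ∈ ApproxFactor M e := by
  intro W ε hε
  obtain ⟨f, hf, g, hg, hfn, hgn, hW, hfg⟩ := hy W ε hε
  refine ⟨a • f, M.smul_mem _ hf, g, hg, by rwa [norm_smul, ha, one_mul], hgn, fun w hw => ?_, ?_⟩
  · rw [absPair_smul_left, ha, one_mul]
    exact hW w hw
  · rwa [map_smul, smul_apply, ← smul_sub, norm_smul, ha, one_mul]

theorem zero_mem_approxFactor : (0 : E) ∈ ApproxFactor M e := by
  intro W ε hε
  have hzero : ∀ w : Lp ℂ 2 μ, absPair 0 w ≤ ε := fun w =>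
    (absPair_le_norm_mul_norm 0 w).trans (by simpa using hε.le)
  have hone : ‖(0 : Lp ℂ 2 μ)‖ ^ 2 ≤ 1 + ε := by rw [norm_zero]; linarith
  exact ⟨0, M.zero_mem, 0, M.zero_mem, hone, hone, fun w _ => ⟨hzero w, hzero w⟩,
    by simpa using hε.le⟩

/-- The norm of a functional on the closed span of `e` is attained as a supremum over the values of
`e`; equivalently, the unit ball of the span is the closed absolutely convex hull of the values. -/
def ContractiveField.IsNorming (e : ContractiveField X E) : Prop :=
  ∀ (Λ : E →L[ℂ] ℂ) (s : ℝ), (∀ x, ‖Λ (e x)‖ ≤ s) → ∀ y ∈ e.closedSpan, ‖Λ y‖ ≤ s * ‖y‖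

theorem mem_approxFactor_of_norm_le_one (hnorm : e.IsNorming) (he : ∀ x, e x ∈ ApproxFactor M e)
    {y : E} (hy : y ∈ e.closedSpan) (hy₁ : ‖y‖ ≤ 1) : y ∈ ApproxFactor M e := by
  by_contra hne
  obtain ⟨Λ, s, hΛ, hs⟩ := RCLike.geometric_hahn_banach_closed_point (𝕜 := ℂ)
    convex_approxFactor isClosed_approxFactor hne
  have hs₀ : 0 < s := by simpa using hΛ 0 zero_mem_approxFactor
  have hΛe : ∀ x, ‖Λ (e x)‖ ≤ s := fun x => by
    obtain ⟨a, ha, haΛ⟩ := RCLike.exists_norm_eq_mul_self (Λ (e x))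
    have h := hΛ _ (smul_mem_approxFactor (he x) ha)
    rw [map_smul, smul_eq_mul, ← haΛ] at h
    exact (by simpa using h : ‖Λ (e x)‖ < s).le
  have hΛy : RCLike.re (Λ y) ≤ s :=
    calc RCLike.re (Λ y) ≤ ‖Λ y‖ := RCLike.re_le_norm _
      _ ≤ s * ‖y‖ := hnorm Λ s hΛe y hy
      _ ≤ s := mul_le_of_le_one_right hs₀.le hy₁
  exact hs.not_ge hΛy

theorem exists_norm_rankOne_add_smul_sub_le {y : E} {f g : Lp ℂ 2 μ} {t : ℝ} (ht : 0 < t)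
    (hy : (t ^ 2)⁻¹ • (y - rankOne e f g) ∈ ApproxFactor M e) :
    ∃ h ∈ M, ∃ k ∈ M, ‖h‖ ≤ 2 ∧ ‖k‖ ≤ 2 ∧
      ‖rankOne e (f + (t : ℂ) • h) (g + (t : ℂ) • k) - y‖ ≤ (t / 2) ^ 2 := by
  classical
  set ε : ℝ := min 1 (t ^ 2 / 4 / (t ^ 2 + 2 * t))
  have hε₀ : 0 < ε := lt_min one_pos (by positivity)
  have hε₁ : ε ≤ 1 := min_le_left _ _
  have hεt : (t ^ 2 + 2 * t) * ε ≤ t ^ 2 / 4 :=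
    (le_div_iff₀' (by positivity)).1 (min_le_right _ _)
  obtain ⟨h, hh, k, hk, hhn, hkn, hW, hhk⟩ := hy {f, g} ε hε₀
  have hhg : absPair h g ≤ ε := (hW g (by simp)).1
  have hfk : absPair f k ≤ ε := absPair_comm f k ▸ (hW f (by simp)).2
  refine ⟨h, hh, k, hk, by nlinarith [norm_nonneg h], by nlinarith [norm_nonneg k], ?_⟩
  have hexp : rankOne e (f + (t : ℂ) • h) (g + (t : ℂ) • k) - y =
      t ^ 2 • (rankOne e h k - (t ^ 2)⁻¹ • (y - rankOne e f g)) +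
        t • (rankOne e f k + rankOne e h g) := by
    rw [smul_sub, smul_inv_smul₀ (by positivity)]
    simp only [map_add, map_smul, map_smulₛₗ, add_apply, smul_apply, Complex.conj_ofReal]
    simp only [Complex.coe_smul, smul_add, smul_smul, pow_two]
    abel
  rw [hexp]
  calc _ ≤ ‖t ^ 2 • (rankOne e h k - (t ^ 2)⁻¹ • (y - rankOne e f g))‖ +
        ‖t • (rankOne e f k + rankOne e h g)‖ := norm_add_le _ _
    _ ≤ t ^ 2 * ε + t * (ε + ε) := by
      rw [norm_smul_of_nonneg (by positivity), norm_smul_of_nonneg ht.le]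
      gcongr
      exact (norm_add_le _ _).trans (add_le_add ((norm_rankOne_le_absPair e f k).trans hfk)
        ((norm_rankOne_le_absPair e h g).trans hhg))
    _ ≤ (t / 2) ^ 2 := by linarith

theorem exists_rankOne_step [CompleteSpace E] (hnorm : e.IsNorming)
    (he : ∀ x, e x ∈ ApproxFactor M e) {y : E} (hy : y ∈ e.closedSpan) {t : ℝ} (ht : 0 < t)
    {p : Lp ℂ 2 μ × Lp ℂ 2 μ} (hp : p ∈ M.prod M) (hpy : dist (rankOne e p.1 p.2) y ≤ t ^ 2) :
    ∃ q ∈ M.prod M, dist p q ≤ 2 * t ∧ dist (rankOne e q.1 q.2) y ≤ (t / 2) ^ 2 := by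
  have hmem : (t ^ 2)⁻¹ • (y - rankOne e p.1 p.2) ∈ ApproxFactor M e := by
    refine mem_approxFactor_of_norm_le_one hnorm he ?_ ?_
    · rw [← Complex.coe_smul]
      exact Submodule.smul_mem _ _ (sub_mem hy (rankOne_mem_closedSpan e _ _))
    · rw [norm_smul_of_nonneg (by positivity), ← dist_eq_norm, dist_comm]
      exact inv_mul_le_one_of_le₀ hpy (by positivity)
  obtain ⟨h, hh, k, hk, hhn, hkn, hq⟩ := exists_norm_rankOne_add_smul_sub_le ht hmem
  have hdist : ∀ u v : Lp ℂ 2 μ, ‖v‖ ≤ 2 → dist u (u + (t : ℂ) • v) ≤ 2 * t := fun u v hv => by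
    rw [dist_self_add_right, norm_smul, Complex.norm_real, Real.norm_of_nonneg ht.le, mul_comm]
    gcongr
  exact ⟨(p.1 + (t : ℂ) • h, p.2 + (t : ℂ) • k),
    ⟨M.add_mem hp.1 (M.smul_mem _ hh), M.add_mem hp.2 (M.smul_mem _ hk)⟩,
    max_le (hdist _ _ hhn) (hdist _ _ hkn), by rwa [dist_eq_norm]⟩

theorem exists_rankOne_eq [CompleteSpace E] (hM : IsClosed (M : Set (Lp ℂ 2 μ)))
    (hnorm : e.IsNorming) (he : ∀ x, e x ∈ ApproxFactor M e) {y : E} (hy : y ∈ e.closedSpan)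
    (hy₁ : ‖y‖ ≤ 1) {ε : ℝ} (hε : 0 < ε) :
    ∃ f ∈ M, ∃ g ∈ M, ‖f‖ ≤ 1 + ε ∧ ‖g‖ ≤ 1 + ε ∧ rankOne e f g = y := by
  set s : ℝ := ε / 5 with hs
  have hs₀ : 0 < s := by positivity
  obtain ⟨f₀, hf₀, g₀, hg₀, hfn, hgn, -, hfg⟩ :=
    mem_approxFactor_of_norm_le_one hnorm he hy hy₁ ∅ (s ^ 2) (by positivity)
  obtain ⟨⟨f, g⟩, ⟨hf, hg⟩, hdist, hfgy⟩ := exists_eq_of_approx_step (continuous_rankOne e)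
    (hM.prod hM) (Continuous.tendsto' (by fun_prop) 0 0 (by simp))
    (fun t ht p hp hpy => exists_rankOne_step hnorm he hy ht hp hpy) hs₀
    (p₀ := (f₀, g₀)) ⟨hf₀, hg₀⟩ (by rwa [dist_eq_norm])
  have hle : ∀ u₀ u : Lp ℂ 2 μ, ‖u₀‖ ^ 2 ≤ 1 + s ^ 2 → dist u₀ u ≤ 2 * 2 * s → ‖u‖ ≤ 1 + ε :=
    fun u₀ u hu₀ hu => by
      have h₀ : ‖u₀‖ ≤ 1 + s := by nlinarith [norm_nonneg u₀]
      rw [dist_comm, dist_eq_norm] at hu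
      linarith [norm_le_norm_add_norm_sub' u u₀]
  exact ⟨f, hf, g, hg, hle f₀ f hfn ((le_max_left _ _).trans hdist),
    hle g₀ g hgn ((le_max_right _ _).trans hdist), hfgy⟩

end Factorization

section Energy

theorem norm_convexCombination_add_sq_le {V : Type*} [SeminormedAddCommGroup V] [NormedSpace ℝ V]
    {a b R η : ℝ} (ha : 0 ≤ a) (hb : 0 ≤ b) (hab : a + b = 1) {x y c : V} (hx : ‖x‖ ≤ R)
    (hy : ‖y‖ ≤ R) (hc : ‖c‖ ≤ η) :
    ‖a • x + b • y + c‖ ^ 2 ≤ a * ‖x‖ ^ 2 + b * ‖y‖ ^ 2 + (2 * R * η + η ^ 2) := by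
  have hconv : ‖a • x + b • y‖ ^ 2 ≤ a * ‖x‖ ^ 2 + b * ‖y‖ ^ 2 :=
    (convexOn_univ_norm.pow (fun _ _ => norm_nonneg _) 2).2 trivial trivial ha hb hab
  have hR : ‖a • x + b • y‖ ≤ R := mem_closedBall_zero_iff.1 (convex_closedBall (0 : V) R
    (mem_closedBall_zero_iff.2 hx) (mem_closedBall_zero_iff.2 hy) ha hb hab)
  have hη : 0 ≤ η := (norm_nonneg c).trans hc
  calc ‖a • x + b • y + c‖ ^ 2 ≤ (‖a • x + b • y‖ + η) ^ 2 := by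
        gcongr
        exact (norm_add_le _ _).trans (by gcongr)
    _ = ‖a • x + b • y‖ ^ 2 + (2 * ‖a • x + b • y‖ * η + η ^ 2) := by ring
    _ ≤ _ := by gcongr

/-- A bounded function together with the square of its modulus. Averages of such pairs record the
first two moments of a random bounded function. -/
def momentPair {ι : Type*} [TopologicalSpace ι] (y : ι →ᵇ ℂ) : (ι →ᵇ ℂ) × (ι →ᵇ ℝ) :=
  (y, y.normComp ^ 2)

variable {X ι : Type*} [MeasurableSpace X] {μ : Measure X} [TopologicalSpace ι]
  (M : Submodule ℂ (Lp ℂ 2 μ)) (e : ContractiveField X (ι →ᵇ ℂ))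

theorem momentPair_snd_apply (y : ι →ᵇ ℂ) (i : ι) : (momentPair y).2 i = ‖y i‖ ^ 2 := rfl

theorem norm_momentPair_le {y : ι →ᵇ ℂ} (hy : ‖y‖ ≤ 1) : ‖momentPair y‖ ≤ 1 := by
  refine max_le hy ((BoundedContinuousFunction.norm_le zero_le_one).2 fun i => ?_)
  rw [momentPair_snd_apply, norm_pow, norm_norm]
  exact pow_le_one₀ (norm_nonneg _) ((y.norm_coe_le_norm i).trans hy)

/-- The closed convex hull of the moment pairs of a field: the pairs of the first two moments of
`e` under probability measures, up to closure. -/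
def momentHull : Set ((ι →ᵇ ℂ) × (ι →ᵇ ℝ)) :=
  closedConvexHull ℝ (Set.range fun x => momentPair (e x))

variable {e} in
theorem norm_le_one_of_mem_momentHull {p : (ι →ᵇ ℂ) × (ι →ᵇ ℝ)} (hp : p ∈ momentHull e) :
    ‖p‖ ≤ 1 :=
  mem_closedBall_zero_iff.1 (closedConvexHull_min
    (Set.range_subset_iff.2 fun x =>
      mem_closedBall_zero_iff.2 (norm_momentPair_le (e.norm_le_one x)))
    (convex_closedBall _ _) isClosed_closedBall hp)

/-- The pairs `(ℓ, q)` such that `ℓ` is approximated by `rankOne e f f`, with `f` in `M` of norm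
about one and almost disjoint from any prescribed finite set, where the squared error times `κ` is
controlled by the increase of the second moment from `q` to that of some random value of `e` with
mean close to `ℓ`. -/
def EnergyApprox (κ : ℝ) : Set ((ι →ᵇ ℂ) × (ι →ᵇ ℝ)) :=
  {y | ∀ (W : Finset (Lp ℂ 2 μ)) (ε : ℝ), 0 < ε → ∃ f ∈ M, ∃ p ∈ momentHull e,
    ‖f‖ ^ 2 ≤ 1 + ε ∧ (∀ w ∈ W, absPair f w ≤ ε) ∧ ‖p.1 - y.1‖ ≤ ε ∧
    ∀ i, κ * ‖rankOne e f f i - y.1 i‖ ^ 2 ≤ p.2 i - y.2 i + ε}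

variable {M e} {κ : ℝ}

theorem exists_pos_le_one_mul_le {C ε : ℝ} (hC : 0 < C) (hε : 0 < ε) :
    ∃ δ > 0, δ ≤ 1 ∧ C * δ ≤ ε :=
  ⟨min 1 (ε / C), lt_min one_pos (div_pos hε hC), min_le_left _ _,
    (le_div_iff₀' hC).1 (min_le_right _ _)⟩

theorem norm_rankOne_apply_sub_le {f : Lp ℂ 2 μ} {δ : ℝ} (hδ : δ ≤ 1) (hf : ‖f‖ ^ 2 ≤ 1 + δ)
    {p : (ι →ᵇ ℂ) × (ι →ᵇ ℝ)} (hp : p ∈ momentHull e) {y : ι →ᵇ ℂ} (hpy : ‖p.1 - y‖ ≤ δ) (i : ι) :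
    ‖rankOne e f f i - y i‖ ≤ 4 := by
  have hff : ‖rankOne e f f‖ ≤ 2 :=
    ((norm_rankOne_le_absPair e f f).trans (absPair_le_norm_mul_norm f f)).trans (by nlinarith)
  have hy : ‖y‖ ≤ 2 := by
    linarith [norm_le_norm_add_norm_sub p.1 y, (le_max_left ‖p.1‖ ‖p.2‖).trans
      (norm_le_one_of_mem_momentHull hp)]
  calc ‖rankOne e f f i - y i‖ ≤ ‖rankOne e f f - y‖ :=
        BoundedContinuousFunction.norm_coe_le_norm (rankOne e f f - y) i
    _ ≤ 4 := by linarith [norm_sub_le (rankOne e f f) y]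

theorem norm_rankOne_combination_apply_sub_sq_le {a b δ : ℝ} (ha : 0 ≤ a) (hb : 0 ≤ b)
    (hab : a + b = 1) (hδ : δ ≤ 1) {f f' : Lp ℂ 2 μ} (hff' : absPair f' f ≤ δ) {i : ι}
    {y z z' : ℂ} (hz : ‖rankOne e f f i - z‖ ≤ 4) (hz' : ‖rankOne e f' f' i - z'‖ ≤ 4)
    (hy : ‖a • z + b • z' - y‖ ≤ δ) :
    ‖rankOne e ((√a : ℂ) • f + (√b : ℂ) • f') ((√a : ℂ) • f + (√b : ℂ) • f') i - y‖ ^ 2 ≤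
      a * ‖rankOne e f f i - z‖ ^ 2 + b * ‖rankOne e f' f' i - z'‖ ^ 2 + 33 * δ := by
  set F : Lp ℂ 2 μ := (√a : ℂ) • f + (√b : ℂ) • f'
  have hcross : ‖(rankOne e F F - (a • rankOne e f f + b • rankOne e f' f')) i‖ ≤ 2 * δ := by
    have h := norm_rankOne_combination_sub_le e (s := (√a : ℂ)) (t := (√b : ℂ))
      (by rwa [norm_ofReal_sqrt_sq ha, norm_ofReal_sqrt_sq hb]) f f' f f'
    rw [norm_ofReal_sqrt_sq ha, norm_ofReal_sqrt_sq hb, absPair_comm f f'] at h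
    exact (BoundedContinuousFunction.norm_coe_le_norm _ i).trans (h.trans (by linarith))
  have hsplit : rankOne e F F i - y =
      a • (rankOne e f f i - z) + b • (rankOne e f' f' i - z') +
        ((rankOne e F F - (a • rankOne e f f + b • rankOne e f' f')) i +
          (a • z + b • z' - y)) := by
    rw [BoundedContinuousFunction.sub_apply, BoundedContinuousFunction.add_apply,
      BoundedContinuousFunction.smul_apply, BoundedContinuousFunction.smul_apply, smul_sub,
      smul_sub]
    abel
  have hδ₀ : 0 ≤ δ := (norm_nonneg _).trans hy
  have hbound := norm_convexCombination_add_sq_le ha hb hab hz hz'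
    ((norm_add_le _ _).trans (add_le_add hcross hy))
  rw [hsplit]
  exact hbound.trans (by nlinarith)

theorem convex_energyApprox (hκ : 0 ≤ κ) : Convex ℝ (EnergyApprox M e κ) := by
  classical
  intro y hy y' hy' a b ha hb hab W ε hε
  obtain ⟨δ, hδ₀, hδ₁, hδε⟩ := exists_pos_le_one_mul_le (C := 33 * κ + 3) (by positivity) hε
  have hκδ : 0 ≤ κ * δ := by positivity
  obtain ⟨f, hf, p, hp, hfn, hfW, hfp, hfq⟩ := hy W δ hδ₀
  obtain ⟨f', hf', p', hp', hfn', hfW', hfp', hfq'⟩ := hy' (insert f W) δ hδ₀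
  have hff' : absPair f' f ≤ δ := hfW' f (Finset.mem_insert_self _ _)
  refine ⟨(√a : ℂ) • f + (√b : ℂ) • f', add_mem (M.smul_mem _ hf) (M.smul_mem _ hf'),
    a • p + b • p', convex_closedConvexHull hp hp' ha hb hab,
    (norm_sq_convexCombination_le ha hb hab hfn hfn' hff').trans (by linarith), fun w hw => ?_,
    (norm_convexCombination_sub_le ha hb hab hfp hfp').trans (by linarith), fun i => ?_⟩
  · refine (absPair_combination_le ?_ f f' w).trans ?_
    · rwa [norm_ofReal_sqrt_sq ha, norm_ofReal_sqrt_sq hb]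
    · linarith [hfW w hw, hfW' w (Finset.mem_insert_of_mem hw)]
  · have herr := norm_rankOne_combination_apply_sub_sq_le (y := (a • y + b • y').1 i) ha hb hab hδ₁
      hff' (norm_rankOne_apply_sub_le hδ₁ hfn hp hfp i)
      (norm_rankOne_apply_sub_le hδ₁ hfn' hp' hfp' i) (by simpa using hδ₀.le)
    have hgain : (a • p + b • p').2 i - (a • y + b • y').2 i =
        a * (p.2 i - y.2 i) + b * (p'.2 i - y'.2 i) := by
      simp only [Prod.snd_add, Prod.smul_snd, BoundedContinuousFunction.add_apply,
        BoundedContinuousFunction.smul_apply, smul_eq_mul]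
      ring
    rw [hgain]
    nlinarith [mul_le_mul_of_nonneg_left herr hκ, mul_le_mul_of_nonneg_left (hfq i) ha,
      mul_le_mul_of_nonneg_left (hfq' i) hb]

theorem isClosed_energyApprox (hκ : 0 ≤ κ) : IsClosed (EnergyApprox M e κ) := by
  refine isClosed_of_closure_subset fun y hy W ε hε => ?_
  obtain ⟨δ, hδ₀, hδ₁, hδε⟩ := exists_pos_le_one_mul_le (C := 9 * κ + 2) (by positivity) hε
  have hκδ : 0 ≤ κ * δ := by positivity
  obtain ⟨y', hy', hyy'⟩ := Metric.mem_closure_iff.1 hy δ hδ₀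
  obtain ⟨f, hf, p, hp, hfn, hfW, hfp, hfq⟩ := hy' W δ hδ₀
  rw [dist_comm, dist_eq_norm] at hyy'
  have hfst : ‖y'.1 - y.1‖ ≤ δ := (le_max_left _ _).trans hyy'.le
  have hsnd : ‖y'.2 - y.2‖ ≤ δ := (le_max_right _ _).trans hyy'.le
  refine ⟨f, hf, p, hp, by linarith, fun w hw => by linarith [hfW w hw],
    (norm_sub_le_norm_sub_add_norm_sub _ y'.1 _).trans (by linarith), fun i => ?_⟩
  have herr : ‖rankOne e f f i - y.1 i‖ ^ 2 ≤ ‖rankOne e f f i - y'.1 i‖ ^ 2 + 9 * δ := by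
    have h := norm_convexCombination_add_sq_le (y := 0) zero_le_one le_rfl (add_zero 1)
      (norm_rankOne_apply_sub_le hδ₁ hfn hp hfp i) (by simp)
      ((BoundedContinuousFunction.norm_coe_le_norm _ i).trans hfst)
    rw [one_smul, zero_smul, add_zero, BoundedContinuousFunction.sub_apply, sub_add_sub_cancel] at h
    nlinarith
  have hdiff := (abs_le.1 ((BoundedContinuousFunction.norm_coe_le_norm _ i).trans hsnd)).1
  rw [BoundedContinuousFunction.sub_apply] at hdiff
  nlinarith [hfq i, mul_le_mul_of_nonneg_left herr hκ]

theorem momentHull_subset_energyApprox (hκ : 0 ≤ κ)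
    (h : ∀ x, momentPair (e x) ∈ EnergyApprox M e κ) : momentHull e ⊆ EnergyApprox M e κ :=
  closedConvexHull_min (Set.range_subset_iff.2 h) (convex_energyApprox hκ)
    (isClosed_energyApprox hκ)

/- Averaging an approximation of `e x` with one of its own mean value adds up the gains of energy,
while the weights `c / (κ + c)`, `κ / (κ + c)` balance the two squared errors. -/
theorem momentPair_mem_energyApprox_add {c : ℝ} (hc : 0 < c) (hκ : 0 ≤ κ)
    (hbase : ∀ x, momentPair (e x) ∈ EnergyApprox M e c)
    (h : ∀ x, momentPair (e x) ∈ EnergyApprox M e κ) (x : X) :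
    momentPair (e x) ∈ EnergyApprox M e (κ + c) := by
  classical
  intro W ε hε
  obtain ⟨δ, hδ₀, hδ₁, hδε⟩ := exists_pos_le_one_mul_le (C := 33 * (κ + c) + 3) (by positivity) hε
  have hκδ : 0 ≤ (κ + c) * δ := by positivity
  obtain ⟨f, hf, p, hp, hfn, hfW, hfp, hfq⟩ := hbase x W δ hδ₀
  obtain ⟨f', hf', p', hp', hfn', hfW', hfp', hfq'⟩ :=
    momentHull_subset_energyApprox hκ h hp (insert f W) δ hδ₀
  have hff' : absPair f' f ≤ δ := hfW' f (Finset.mem_insert_self _ _)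
  set a : ℝ := c / (κ + c)
  set b : ℝ := κ / (κ + c)
  have ha : 0 ≤ a := by positivity
  have hb : 0 ≤ b := by positivity
  have hca : (κ + c) * a = c := mul_div_cancel₀ _ (by positivity)
  have hcb : (κ + c) * b = κ := mul_div_cancel₀ _ (by positivity)
  have hab : a + b = 1 := by rw [← add_div, add_comm c, div_self (by positivity)]
  refine ⟨(√a : ℂ) • f + (√b : ℂ) • f', add_mem (M.smul_mem _ hf) (M.smul_mem _ hf'), p', hp',
    (norm_sq_convexCombination_le ha hb hab hfn hfn' hff').trans (by linarith), fun w hw => ?_,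
    (norm_sub_le_norm_sub_add_norm_sub _ p.1 _).trans (by linarith), fun i => ?_⟩
  · refine (absPair_combination_le ?_ f f' w).trans ?_
    · rwa [norm_ofReal_sqrt_sq ha, norm_ofReal_sqrt_sq hb]
    · linarith [hfW w hw, hfW' w (Finset.mem_insert_of_mem hw)]
  · have hmean : ‖a • (momentPair (e x)).1 i + b • p.1 i - (momentPair (e x)).1 i‖ ≤ δ := by
      have h := norm_convexCombination_sub_le ha hb hab
        (x := (momentPair (e x)).1 i) (y := (momentPair (e x)).1 i) (by simpa using hδ₀.le)
        ((BoundedContinuousFunction.norm_coe_le_norm _ i).trans hfp)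
      rwa [Convex.combo_self hab] at h
    have herr := norm_rankOne_combination_apply_sub_sq_le ha hb hab hδ₁ hff'
      (norm_rankOne_apply_sub_le hδ₁ hfn hp hfp i)
      (norm_rankOne_apply_sub_le hδ₁ hfn' hp' hfp' i) hmean
    have hscaled := mul_le_mul_of_nonneg_left herr (add_nonneg hκ hc.le)
    rw [mul_add, mul_add, ← mul_assoc, ← mul_assoc, hca, hcb] at hscaled
    linarith [hfq i, hfq' i]

theorem mem_approxFactor_of_energyApprox {c : ℝ} (hc : 0 < c)
    (hbase : ∀ x, momentPair (e x) ∈ EnergyApprox M e c) (x : X) : e x ∈ ApproxFactor M e := by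
  have hmul : ∀ (k : ℕ) (x : X), momentPair (e x) ∈ EnergyApprox M e ((k + 1) * c) := fun k => by
    induction k with
    | zero => simpa using hbase
    | succ k ih =>
      intro x
      have hsucc := momentPair_mem_energyApprox_add hc (by positivity) hbase ih x
      rwa [← add_one_mul, ← Nat.cast_succ] at hsucc
  intro W ε hε
  obtain ⟨k, hk⟩ := exists_nat_ge ((1 + ε) / (c * ε ^ 2))
  rw [div_le_iff₀ (by positivity)] at hk
  obtain ⟨f, hf, p, hp, hfn, hfW, -, hfq⟩ := hmul k x W ε hε
  refine ⟨f, hf, f, hf, hfn, hfn, fun w hw => ⟨hfW w hw, hfW w hw⟩, ?_⟩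
  refine (BoundedContinuousFunction.norm_le hε.le).2 fun i => ?_
  have hp₁ : p.2 i ≤ 1 := (le_abs_self _).trans ((p.2.norm_coe_le_norm i).trans
    ((le_max_right _ _).trans (norm_le_one_of_mem_momentHull hp)))
  have hsq : (k + 1) * c * ‖rankOne e f f i - e x i‖ ^ 2 ≤ (k + 1) * c * ε ^ 2 :=
    calc (k + 1) * c * ‖rankOne e f f i - e x i‖ ^ 2 ≤ p.2 i - ‖e x i‖ ^ 2 + ε := hfq i
      _ ≤ 1 + ε := by linarith [sq_nonneg ‖e x i‖]
      _ ≤ k * (c * ε ^ 2) := hk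
      _ ≤ (k + 1) * c * ε ^ 2 := by nlinarith [show 0 < c * ε ^ 2 by positivity]
  exact le_of_sq_le_sq (le_of_mul_le_mul_left hsq (by positivity)) hε.le

end Energy

section SignedSums

variable {ι : Type*} [DecidableEq ι]

/-- The signed sum `∑ i ∈ t, ± a i`, with minus signs on `s`. Averages over all `s ⊆ t` are
expectations over independent random signs. -/
def signedSum {V : Type*} [AddCommGroup V] (a : ι → V) (t s : Finset ι) : V :=
  ∑ i ∈ t, if i ∈ s then -a i else a i

theorem signedSum_insert_of_notMem {V : Type*} [AddCommGroup V] (a : ι → V) {t s : Finset ι} {j : ι}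
    (hjt : j ∉ t) (hjs : j ∉ s) : signedSum a (insert j t) s = signedSum a t s + a j := by
  rw [signedSum, Finset.sum_insert hjt, if_neg hjs, add_comm, signedSum]

theorem signedSum_insert_insert {V : Type*} [AddCommGroup V] (a : ι → V) {t s : Finset ι} {j : ι}
    (hjt : j ∉ t) : signedSum a (insert j t) (insert j s) = signedSum a t s - a j := by
  rw [signedSum, Finset.sum_insert hjt, if_pos (Finset.mem_insert_self _ _), neg_add_eq_sub,
    signedSum]
  congr 1
  refine Finset.sum_congr rfl fun i hi => ?_
  simp only [Finset.mem_insert, (ne_of_mem_of_not_mem hi hjt), false_or]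

variable {V : Type*} [NormedAddCommGroup V] [InnerProductSpace ℝ V]

theorem sum_norm_sq_signedSum (a : ι → V) (t : Finset ι) :
    ∑ s ∈ t.powerset, ‖signedSum a t s‖ ^ 2 = 2 ^ t.card * ∑ i ∈ t, ‖a i‖ ^ 2 := by
  induction t using Finset.induction_on with
  | empty => simp [signedSum]
  | insert j t hj ih =>
    have hpair : ∀ s ∈ t.powerset, ‖signedSum a (insert j t) s‖ ^ 2 +
        ‖signedSum a (insert j t) (insert j s)‖ ^ 2 =
        2 * (‖signedSum a t s‖ ^ 2 + ‖a j‖ ^ 2) := fun s hs => by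
      rw [signedSum_insert_of_notMem a hj fun h => hj (Finset.mem_powerset.1 hs h),
        signedSum_insert_insert a hj, parallelogram_law_with_norm ℝ]
    rw [Finset.sum_powerset_insert hj, ← Finset.sum_add_distrib, Finset.sum_congr rfl hpair,
      ← Finset.mul_sum, Finset.sum_add_distrib, ih, Finset.sum_const, Finset.card_powerset,
      Finset.card_insert_of_notMem hj, Finset.sum_insert hj, nsmul_eq_mul]
    push_cast
    ring

theorem norm_add_pow_four_add_norm_sub_pow_four_le (x y : V) :
    ‖x + y‖ ^ 4 + ‖x - y‖ ^ 4 ≤ 2 * ‖x‖ ^ 4 + 12 * ‖y‖ ^ 2 * ‖x‖ ^ 2 + 2 * ‖y‖ ^ 4 := by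
  have hadd : ‖x + y‖ ^ 4 = (‖x‖ ^ 2 + 2 * inner ℝ x y + ‖y‖ ^ 2) ^ 2 := by
    rw [← norm_add_sq_real]; ring
  have hsub : ‖x - y‖ ^ 4 = (‖x‖ ^ 2 - 2 * inner ℝ x y + ‖y‖ ^ 2) ^ 2 := by
    rw [← norm_sub_sq_real]; ring
  have hinner : inner ℝ x y ^ 2 ≤ (‖x‖ * ‖y‖) ^ 2 := sq_le_sq.2 <| by
    rw [abs_of_nonneg (mul_nonneg (norm_nonneg x) (norm_nonneg y))]
    exact abs_real_inner_le_norm x y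
  rw [hadd, hsub]
  linarith

theorem sum_norm_pow_four_signedSum_le (a : ι → V) (t : Finset ι) :
    ∑ s ∈ t.powerset, ‖signedSum a t s‖ ^ 4 ≤ 3 * 2 ^ t.card * (∑ i ∈ t, ‖a i‖ ^ 2) ^ 2 := by
  induction t using Finset.induction_on with
  | empty => simp [signedSum]
  | insert j t hj ih =>
    have hpair : ∀ s ∈ t.powerset, ‖signedSum a (insert j t) s‖ ^ 4 +
        ‖signedSum a (insert j t) (insert j s)‖ ^ 4 ≤
        2 * ‖signedSum a t s‖ ^ 4 + 12 * ‖a j‖ ^ 2 * ‖signedSum a t s‖ ^ 2 + 2 * ‖a j‖ ^ 4 :=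
      fun s hs => by
        rw [signedSum_insert_of_notMem a hj fun h => hj (Finset.mem_powerset.1 hs h),
          signedSum_insert_insert a hj]
        exact norm_add_pow_four_add_norm_sub_pow_four_le _ _
    rw [Finset.sum_powerset_insert hj, ← Finset.sum_add_distrib]
    refine (Finset.sum_le_sum hpair).trans ?_
    rw [Finset.sum_add_distrib, Finset.sum_add_distrib, ← Finset.mul_sum, ← Finset.mul_sum,
      sum_norm_sq_signedSum, Finset.sum_const, Finset.card_powerset,
      Finset.card_insert_of_notMem hj, Finset.sum_insert hj, nsmul_eq_mul]
    push_cast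
    have hpos : (0 : ℝ) ≤ 2 ^ t.card * ‖a j‖ ^ 4 := by positivity
    linear_combination 2 * ih + 4 * hpos

end SignedSums

section SquareDensity

variable {X ι : Type*} [MeasurableSpace X] {μ : Measure X}

/-- The density `∑ i ∈ t, |a i|²`. -/
def sqDensity (a : ι → Lp ℂ 2 μ) (t : Finset ι) (x : X) : ℝ := ∑ i ∈ t, ‖a i x‖ ^ 2

variable (a : ι → Lp ℂ 2 μ) (t : Finset ι)

theorem sqDensity_nonneg (x : X) : 0 ≤ sqDensity a t x :=
  Finset.sum_nonneg fun _ _ => by positivity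

theorem measurable_sqDensity : Measurable (sqDensity a t) :=
  Finset.measurable_fun_sum _ fun i _ => (Lp.stronglyMeasurable (a i)).norm.measurable.pow_const 2

theorem integrable_sqDensity : Integrable (sqDensity a t) μ :=
  integrable_finsetSum _ fun i _ => integrable_norm_sq (a i)

theorem setIntegral_sqDensity (K : Set X) :
    ∫ x in K, sqDensity a t x ∂μ = ∑ i ∈ t, ∫ x in K, ‖a i x‖ ^ 2 ∂μ :=
  integral_finsetSum _ fun i _ => (integrable_norm_sq (a i)).integrableOn

theorem integral_sqDensity : ∫ x, sqDensity a t x ∂μ = ∑ i ∈ t, ‖a i‖ ^ 2 := by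
  simpa only [setIntegral_univ, norm_sq_eq_integral] using setIntegral_sqDensity a t Set.univ

variable [DecidableEq ι]

theorem coeFn_signedSum (s : Finset ι) :
    ⇑(signedSum a t s) =ᵐ[μ] fun x => signedSum (fun i => a i x) t s := by
  have hneg : ∀ᵐ x ∂μ, ∀ i ∈ t, (-a i) x = -a i x :=
    (eventually_all_finset t).2 fun i _ => Lp.coeFn_neg (a i)
  filter_upwards [Lp.coeFn_finsetSum t fun i => if i ∈ s then -a i else a i, hneg] with x hx hx'
  rw [signedSum, signedSum, hx, Finset.sum_apply]
  refine Finset.sum_congr rfl fun i hi => ?_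
  split_ifs
  exacts [hx' i hi, rfl]

theorem ae_forall_coeFn_signedSum : ∀ᵐ x ∂μ, ∀ s ∈ t.powerset,
    signedSum a t s x = signedSum (fun i => a i x) t s :=
  (eventually_all_finset _).2 fun s _ => coeFn_signedSum a t s

theorem ae_sum_norm_sq_signedSum : ∀ᵐ x ∂μ,
    ∑ s ∈ t.powerset, ‖signedSum a t s x‖ ^ 2 = 2 ^ t.card * sqDensity a t x := by
  filter_upwards [ae_forall_coeFn_signedSum a t] with x hx
  rw [sqDensity, ← sum_norm_sq_signedSum]
  exact Finset.sum_congr rfl fun s hs => by rw [hx s hs]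

theorem ae_sum_norm_pow_four_signedSum_le : ∀ᵐ x ∂μ,
    ∑ s ∈ t.powerset, ‖signedSum a t s x‖ ^ 4 ≤ 3 * 2 ^ t.card * sqDensity a t x ^ 2 := by
  filter_upwards [ae_forall_coeFn_signedSum a t] with x hx
  rw [Finset.sum_congr rfl fun s hs => by rw [hx s hs]]
  exact sum_norm_pow_four_signedSum_le _ t

theorem ae_norm_sq_signedSum_le {s : Finset ι} (hs : s ∈ t.powerset) : ∀ᵐ x ∂μ,
    ‖signedSum a t s x‖ ^ 2 ≤ 2 ^ t.card * sqDensity a t x := by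
  filter_upwards [ae_sum_norm_sq_signedSum a t] with x hx
  rw [← hx]
  exact Finset.single_le_sum (f := fun s => ‖signedSum a t s x‖ ^ 2) (fun _ _ => by positivity) hs

theorem div_le_mul_of_le_mul_sq {p g C : ℝ} (hg : 0 ≤ g) (h : p ≤ C * g ^ 2) : p / g ≤ C * g := by
  rcases hg.eq_or_lt with rfl | hg
  · simp
  · rwa [div_le_iff₀ hg, mul_assoc, ← pow_two]

theorem integrable_signedSum_pow_four_div {s : Finset ι} (hs : s ∈ t.powerset) :
    Integrable (fun x => ‖signedSum a t s x‖ ^ 4 / sqDensity a t x) μ := by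
  refine ((integrable_sqDensity a t).const_mul ((2 ^ t.card) ^ 2)).mono' ?_ ?_
  · exact (((Lp.aestronglyMeasurable _).norm.pow 4).aemeasurable.div
      (measurable_sqDensity a t).aemeasurable).aestronglyMeasurable
  · filter_upwards [ae_norm_sq_signedSum_le a t hs] with x hx
    rw [Real.norm_of_nonneg (div_nonneg (by positivity) (sqDensity_nonneg a t x))]
    refine div_le_mul_of_le_mul_sq (sqDensity_nonneg a t x) ?_
    calc ‖signedSum a t s x‖ ^ 4 = (‖signedSum a t s x‖ ^ 2) ^ 2 := by ring
      _ ≤ (2 ^ t.card * sqDensity a t x) ^ 2 := by gcongr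
      _ = _ := mul_pow _ _ _

theorem sum_setIntegral_norm_sq_signedSum (K : Set X) :
    ∑ s ∈ t.powerset, ∫ x in K, ‖signedSum a t s x‖ ^ 2 ∂μ =
      2 ^ t.card * ∫ x in K, sqDensity a t x ∂μ := by
  rw [← integral_finsetSum _ fun s _ => (integrable_norm_sq _).integrableOn,
    integral_congr_ae (ae_restrict_of_ae (ae_sum_norm_sq_signedSum a t)), integral_const_mul]

theorem sum_integral_signedSum_pow_four_div_le :
    ∑ s ∈ t.powerset, ∫ x, ‖signedSum a t s x‖ ^ 4 / sqDensity a t x ∂μ ≤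
      3 * 2 ^ t.card * ∫ x, sqDensity a t x ∂μ := by
  have hint := fun s hs => integrable_signedSum_pow_four_div a t (s := s) hs
  rw [← integral_finsetSum _ hint, ← integral_const_mul]
  refine integral_mono_ae (integrable_finsetSum _ hint)
    ((integrable_sqDensity a t).const_mul _) ?_
  filter_upwards [ae_sum_norm_pow_four_signedSum_le a t] with x hx
  rw [← Finset.sum_div]
  exact div_le_mul_of_le_mul_sq (sqDensity_nonneg a t x) hx

/- The three bounds hold together for some choice of signs since the random variable
`‖F‖² - (∫ |F|⁴ / g) / 6 - (∫ x in K, |F|²) / (4 ε)` has mean at least `1 / 4`. -/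
theorem exists_signedSum_bounds {a : ι → Lp ℂ 2 μ} {t : Finset ι} (ha : ∑ i ∈ t, ‖a i‖ ^ 2 = 1)
    {K : Set X} {ε : ℝ} (hε : 0 < ε) (hK : ∑ i ∈ t, ∫ x in K, ‖a i x‖ ^ 2 ∂μ ≤ ε) :
    ∃ s ∈ t.powerset, 1 / 4 ≤ ‖signedSum a t s‖ ^ 2 ∧
      ∫ x, ‖signedSum a t s x‖ ^ 4 / sqDensity a t x ∂μ ≤ 6 * ‖signedSum a t s‖ ^ 2 ∧
      ∫ x in K, ‖signedSum a t s x‖ ^ 2 ∂μ ≤ 4 * ε * ‖signedSum a t s‖ ^ 2 := by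
  have htot : ∑ s ∈ t.powerset, ‖signedSum a t s‖ ^ 2 = 2 ^ t.card := by
    simpa only [setIntegral_univ, ← norm_sq_eq_integral, integral_sqDensity, ha, mul_one] using
      sum_setIntegral_norm_sq_signedSum a t Set.univ
  have hfour := sum_integral_signedSum_pow_four_div_le a t
  rw [integral_sqDensity, ha, mul_one] at hfour
  have hconc : ∑ s ∈ t.powerset, ∫ x in K, ‖signedSum a t s x‖ ^ 2 ∂μ ≤ 2 ^ t.card * ε := by
    rw [sum_setIntegral_norm_sq_signedSum, setIntegral_sqDensity]
    gcongr
  obtain ⟨s, hs, hmean⟩ : ∃ s ∈ t.powerset, 1 / 4 ≤ ‖signedSum a t s‖ ^ 2 -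
      (∫ x, ‖signedSum a t s x‖ ^ 4 / sqDensity a t x ∂μ) / 6 -
      (∫ x in K, ‖signedSum a t s x‖ ^ 2 ∂μ) / (4 * ε) := by
    refine Finset.exists_le_of_sum_le ⟨∅, Finset.empty_mem_powerset t⟩ ?_
    rw [Finset.sum_const, Finset.card_powerset, Finset.sum_sub_distrib, Finset.sum_sub_distrib,
      ← Finset.sum_div, ← Finset.sum_div, htot, nsmul_eq_mul, Nat.cast_pow, Nat.cast_ofNat]
    have hconc' : (∑ s ∈ t.powerset, ∫ x in K, ‖signedSum a t s x‖ ^ 2 ∂μ) / (4 * ε) ≤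
        2 ^ t.card / 4 := by
      rw [div_le_iff₀ (by positivity)]
      linarith
    linarith
  have hfour₀ : 0 ≤ ∫ x, ‖signedSum a t s x‖ ^ 4 / sqDensity a t x ∂μ :=
    integral_nonneg fun x => div_nonneg (by positivity) (sqDensity_nonneg a t x)
  have hconc₀ : 0 ≤ (∫ x in K, ‖signedSum a t s x‖ ^ 2 ∂μ) / (4 * ε) :=
    div_nonneg (integral_nonneg fun x => by positivity) (by positivity)
  exact ⟨s, hs, by linarith, by linarith, (div_le_iff₀' (by positivity)).1 (by linarith)⟩

theorem signedSum_mem {M : Submodule ℂ (Lp ℂ 2 μ)} (ha : ∀ i, a i ∈ M) (s : Finset ι) :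
    signedSum a t s ∈ M :=
  M.sum_mem fun i _ => by
    split_ifs
    exacts [neg_mem (ha i), ha i]

end SquareDensity

section EnergyBase

variable {X : Type*} [MeasurableSpace X] {μ : Measure X}

/-- The unit vectors of `M` that are almost concentrated on the complement of `K`. -/
def unitVectorsOff (M : Submodule ℂ (Lp ℂ 2 μ)) (K : Set X) (ε : ℝ) : Set (Lp ℂ 2 μ) :=
  {f | f ∈ M ∧ ‖f‖ = 1 ∧ ∫ x in K, ‖f x‖ ^ 2 ∂μ ≤ ε}

theorem ae_norm_sq_normalize (F : Lp ℂ 2 μ) :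
    ∀ᵐ x ∂μ, ‖((‖F‖ : ℂ)⁻¹ • F) x‖ ^ 2 = (‖F‖ ^ 2)⁻¹ * ‖F x‖ ^ 2 := by
  filter_upwards [Lp.coeFn_smul ((‖F‖ : ℂ)⁻¹) F] with x hx
  rw [hx, Pi.smul_apply, norm_smul, mul_pow, norm_inv, Complex.norm_real, norm_norm, inv_pow]

theorem exists_mem_unitVectorsOff {ι : Type*} {M : Submodule ℂ (Lp ℂ 2 μ)} {a : ι → Lp ℂ 2 μ}
    (haM : ∀ i, a i ∈ M) {t : Finset ι} (ha : ∑ i ∈ t, ‖a i‖ ^ 2 = 1) {K : Set X} {ε : ℝ}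
    (hε : 0 < ε) (hK : ∑ i ∈ t, ∫ x in K, ‖a i x‖ ^ 2 ∂μ ≤ ε) :
    ∃ f ∈ unitVectorsOff M K (4 * ε), (∀ᵐ x ∂μ, sqDensity a t x = 0 → f x = 0) ∧
      Integrable (fun x => (‖f x‖ ^ 2) ^ 2 / sqDensity a t x) μ ∧
      ∫ x, (‖f x‖ ^ 2) ^ 2 / sqDensity a t x ∂μ ≤ 24 := by
  classical
  obtain ⟨s, hs, hnorm, hfour, hconc⟩ := exists_signedSum_bounds ha hε hK
  set F := signedSum a t s
  set N : ℝ := ‖F‖ ^ 2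
  have hN : 0 < N := by linarith
  have hsq := ae_norm_sq_normalize F
  have hsq₂ : ∀ᵐ x ∂μ, (‖((‖F‖ : ℂ)⁻¹ • F) x‖ ^ 2) ^ 2 / sqDensity a t x =
      N⁻¹ ^ 2 * (‖F x‖ ^ 4 / sqDensity a t x) := by
    filter_upwards [hsq] with x hx
    rw [hx]
    ring
  refine ⟨(‖F‖ : ℂ)⁻¹ • F, ⟨M.smul_mem _ (signedSum_mem a t haM s), ?_, ?_⟩, ?_,
    ((integrable_signedSum_pow_four_div a t hs).const_mul _).congr
      (hsq₂.mono fun _ h => h.symm), ?_⟩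
  · rw [norm_smul, norm_inv, Complex.norm_real, norm_norm,
      inv_mul_cancel₀ (pow_ne_zero_iff two_ne_zero |>.1 hN.ne')]
  · rw [integral_congr_ae (ae_restrict_of_ae hsq), integral_const_mul, inv_mul_le_iff₀ hN]
    linarith
  · filter_upwards [hsq, ae_norm_sq_signedSum_le a t hs] with x hx hle hzero
    rw [hzero, mul_zero] at hle
    refine norm_eq_zero.1 (pow_eq_zero_iff two_ne_zero |>.1 ?_)
    rw [hx, le_antisymm hle (by positivity), mul_zero]
  · rw [integral_congr_ae hsq₂, integral_const_mul]
    calc N⁻¹ ^ 2 * ∫ x, ‖F x‖ ^ 4 / sqDensity a t x ∂μ ≤ N⁻¹ ^ 2 * (6 * N) := by gcongr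
      _ = 6 / N := by field_simp
      _ ≤ 24 := by rw [div_le_iff₀ hN]; linarith

theorem exists_isCompact_forall_setIntegral_compl_le [TopologicalSpace X] [SigmaCompactSpace X]
    [T2Space X] [OpensMeasurableSpace X] (W : Finset (Lp ℂ 2 μ)) {ε : ℝ} (hε : 0 < ε) :
    ∃ K : Set X, IsCompact K ∧ ∀ w ∈ W, ∫ x in Kᶜ, ‖w x‖ ^ 2 ∂μ ≤ ε := by
  have hsmall : ∀ w ∈ W, ∀ᶠ n in atTop, ∫ x in (compactCovering X n)ᶜ, ‖w x‖ ^ 2 ∂μ ≤ ε :=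
    fun w _ => by
      have hlim := tendsto_setIntegral_of_antitone (s := fun n => (compactCovering X n)ᶜ)
        (fun n => (isCompact_compactCovering X n).measurableSet.compl)
        (fun m n hmn => Set.compl_subset_compl.2 (compactCovering_subset X hmn))
        ⟨0, (integrable_norm_sq w).integrableOn⟩
      rw [← Set.compl_iUnion, iUnion_compactCovering, Set.compl_univ, setIntegral_empty] at hlim
      exact hlim.eventually (ge_mem_nhds hε)
  obtain ⟨n, hn⟩ := ((eventually_all_finset W).2 hsmall).exists
  exact ⟨compactCovering X n, isCompact_compactCovering X n, hn⟩

theorem setIntegral_norm_sq_le (u : Lp ℂ 2 μ) (K : Set X) : ∫ x in K, ‖u x‖ ^ 2 ∂μ ≤ ‖u‖ ^ 2 := by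
  rw [norm_sq_eq_integral]
  exact setIntegral_le_integral (integrable_norm_sq u) (ae_of_all _ fun _ => by positivity)

theorem setIntegral_norm_mul_norm_le {η : ℝ} (hη : 0 < η) {u v : Lp ℂ 2 μ} {K : Set X}
    (hu : ∫ x in K, ‖u x‖ ^ 2 ∂μ ≤ η ^ 2) :
    ∫ x in K, ‖u x‖ * ‖v x‖ ∂μ ≤ η * (1 + ‖v‖ ^ 2) := by
  have hu₂ := ((integrable_norm_sq u).const_mul η⁻¹).integrableOn (s := K)
  have hv₂ := ((integrable_norm_sq v).const_mul η).integrableOn (s := K)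
  have hamgm : ∀ p q : ℝ, p * q ≤ η⁻¹ * p ^ 2 + η * q ^ 2 := fun p q => by
    have hsq : η * (η⁻¹ * p - q) ^ 2 + η⁻¹ * p ^ 2 + η * q ^ 2 =
        2 * (η⁻¹ * p ^ 2 + η * q ^ 2 - p * q) := by field_simp; ring
    have hpos : 0 ≤ η * (η⁻¹ * p - q) ^ 2 + η⁻¹ * p ^ 2 + η * q ^ 2 := by positivity
    linarith
  calc ∫ x in K, ‖u x‖ * ‖v x‖ ∂μ ≤ ∫ x in K, (η⁻¹ * ‖u x‖ ^ 2 + η * ‖v x‖ ^ 2) ∂μ :=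
        integral_mono (integrable_norm_mul_norm u v).integrableOn (Integrable.fun_add hu₂ hv₂)
          fun x => hamgm _ _
    _ = η⁻¹ * ∫ x in K, ‖u x‖ ^ 2 ∂μ + η * ∫ x in K, ‖v x‖ ^ 2 ∂μ := by
        rw [integral_add hu₂ hv₂, integral_const_mul, integral_const_mul]
    _ ≤ η⁻¹ * η ^ 2 + η * ‖v‖ ^ 2 := by
        gcongr
        exact setIntegral_norm_sq_le v K
    _ = η * (1 + ‖v‖ ^ 2) := by field_simp

theorem absPair_le_of_setIntegral_le {f w : Lp ℂ 2 μ} {K : Set X} (hK : MeasurableSet K) {η : ℝ}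
    (hη : 0 < η) (hfK : ∫ x in K, ‖f x‖ ^ 2 ∂μ ≤ η ^ 2) (hwK : ∫ x in Kᶜ, ‖w x‖ ^ 2 ∂μ ≤ η ^ 2) :
    absPair f w ≤ η * (2 + ‖f‖ ^ 2 + ‖w‖ ^ 2) := by
  have hcompl := setIntegral_norm_mul_norm_le hη (v := f) hwK
  simp only [mul_comm ‖w _‖] at hcompl
  rw [absPair, ← integral_add_compl hK (integrable_norm_mul_norm f w)]
  linarith [setIntegral_norm_mul_norm_le hη (v := w) hfK]

theorem sq_integral_mul_le {p g c : X → ℝ} (hg : ∀ x, 0 ≤ g x)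
    (hgp : ∀ᵐ x ∂μ, g x = 0 → p x = 0) (hp : Integrable (fun x => p x ^ 2 / g x) μ)
    (hpc : Integrable (fun x => p x * c x) μ) (hgc : Integrable (fun x => g x * c x ^ 2) μ) :
    (∫ x, p x * c x ∂μ) ^ 2 ≤ (∫ x, p x ^ 2 / g x ∂μ) * ∫ x, g x * c x ^ 2 ∂μ := by
  have hquad : ∀ l : ℝ, 0 ≤ (∫ x, p x ^ 2 / g x ∂μ) * (l * l) + (-2 * ∫ x, p x * c x ∂μ) * l +
      ∫ x, g x * c x ^ 2 ∂μ := fun l => by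
    have hsq : 0 ≤
        ∫ x, ((l * l) * (p x ^ 2 / g x) + (-2 * l) * (p x * c x) + g x * c x ^ 2) ∂μ := by
      refine integral_nonneg_of_ae ?_
      filter_upwards [hgp] with x hx
      rcases (hg x).eq_or_lt with hzero | hpos
      · simp [← hzero, hx hzero.symm]
      · have : l * l * (p x ^ 2 / g x) + -2 * l * (p x * c x) + g x * c x ^ 2 =
            (l * p x - g x * c x) ^ 2 / g x := by
          field_simp
          ring
        rw [Pi.zero_apply, this]
        positivity
    rw [integral_add (Integrable.fun_add (hp.const_mul _) (hpc.const_mul _)) hgc,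
      integral_add (hp.const_mul _) (hpc.const_mul _), integral_const_mul,
      integral_const_mul] at hsq
    linarith
  have hdiscrim := discrim_le_zero hquad
  rw [discrim] at hdiscrim
  linarith

/-- The measure with density `∑ i ∈ t, |a i|²` with respect to `μ`. -/
def mixture {ι : Type*} (a : ι → Lp ℂ 2 μ) (t : Finset ι) : Measure X :=
  μ.withDensity fun x => ENNReal.ofReal (sqDensity a t x)

theorem isProbabilityMeasure_mixture {ι : Type*} {a : ι → Lp ℂ 2 μ} {t : Finset ι}
    (ha : ∑ i ∈ t, ‖a i‖ ^ 2 = 1) : IsProbabilityMeasure (mixture a t) :=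
  ⟨by rw [mixture, withDensity_apply _ MeasurableSet.univ, Measure.restrict_univ,
    ← ofReal_integral_eq_lintegral_ofReal (integrable_sqDensity a t)
      (ae_of_all _ (sqDensity_nonneg a t)), integral_sqDensity, ha, ENNReal.ofReal_one]⟩

theorem integral_mixture {ι E : Type*} [NormedAddCommGroup E] [NormedSpace ℝ E]
    (a : ι → Lp ℂ 2 μ) (t : Finset ι) (h : X → E) :
    ∫ x, h x ∂(mixture a t) = ∫ x, sqDensity a t x • h x ∂μ := by
  rw [mixture, integral_withDensity_eq_integral_toReal_smul
    (measurable_sqDensity a t).ennreal_ofReal (ae_of_all _ fun x => ENNReal.ofReal_lt_top)]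
  simp only [ENNReal.toReal_ofReal (sqDensity_nonneg a t _)]

theorem mul_conj_smul_eq {E : Type*} [NormedAddCommGroup E] [NormedSpace ℂ E] (w : ℂ) (y : E) :
    (w * conj w) • y = ‖w‖ ^ 2 • y := by
  rw [Complex.mul_conj', ← Complex.ofReal_pow, Complex.coe_smul]

theorem integral_mixture_eq_sum_rankOne {ι E : Type*} [NormedAddCommGroup E] [NormedSpace ℂ E]
    (e : ContractiveField X E) (a : ι → Lp ℂ 2 μ) (t : Finset ι) :
    ∫ x, e x ∂(mixture a t) = ∑ i ∈ t, rankOne e (a i) (a i) := by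
  simp only [integral_mixture, rankOne_apply, sqDensity, Finset.sum_smul]
  rw [← integral_finsetSum _ fun i _ => e.integrable_smul (integrable_mul_conj (a i) (a i))]
  simp only [mul_conj_smul_eq]

theorem re_clm_rankOne_self {E : Type*} [NormedAddCommGroup E] [NormedSpace ℂ E] [CompleteSpace E]
    (e : ContractiveField X E) (Λ : E →L[ℂ] ℂ) (f : Lp ℂ 2 μ) :
    (Λ (rankOne e f f)).re = ∫ x, (Λ (e x)).re * ‖f x‖ ^ 2 ∂μ := by
  have hint : Integrable (fun x => ‖f x‖ ^ 2 • Λ (e x)) μ := by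
    simp only [← mul_conj_smul_eq, ← map_smul]
    exact Λ.integrable_comp (e.integrable_smul (integrable_mul_conj f f))
  rw [clm_rankOne]
  simp only [mul_conj_smul_eq]
  rw [← RCLike.re_eq_complex_re, ← integral_re hint]
  simp only [RCLike.smul_re, mul_comm]

theorem mem_closure_convexHull_rankOne {E : Type*} [NormedAddCommGroup E] [NormedSpace ℂ E]
    [CompleteSpace E] (e : ContractiveField X E) {S : Set (Lp ℂ 2 μ)} {y : E}
    (h : ∀ Λ : E →L[ℂ] ℂ, ∃ f ∈ S, (Λ y).re ≤ ∫ x, (Λ (e x)).re * ‖f x‖ ^ 2 ∂μ) :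
    y ∈ closure (convexHull ℝ ((fun f => rankOne e f f) '' S)) := by
  by_contra hy
  obtain ⟨Λ, u, hΛ, hu⟩ := RCLike.geometric_hahn_banach_closed_point (𝕜 := ℂ)
    (convex_convexHull ℝ _).closure isClosed_closure hy
  obtain ⟨f, hf, hle⟩ := h Λ
  have hlt := hΛ _ (subset_closure (subset_convexHull ℝ _ ⟨f, hf, rfl⟩))
  rw [RCLike.re_eq_complex_re] at hlt hu
  rw [re_clm_rankOne_self] at hlt
  linarith

theorem integral_norm_sub_sq_le {V : Type*} [NormedAddCommGroup V] [InnerProductSpace ℝ V]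
    [CompleteSpace V] {ρ : Measure X} [IsProbabilityMeasure ρ] {h : X → V} (hh : MemLp h 2 ρ)
    {c : V} {δ : ℝ} (hc : ‖c‖ ≤ 1) (hmean : ‖∫ x, h x ∂ρ - c‖ ≤ δ) :
    ∫ x, ‖h x - c‖ ^ 2 ∂ρ ≤ ∫ x, ‖h x‖ ^ 2 ∂ρ - ‖c‖ ^ 2 + 2 * δ := by
  have hint : Integrable h ρ := hh.integrable one_le_two
  have hsq : Integrable (fun x => ‖h x‖ ^ 2) ρ := hh.integrable_norm_pow two_ne_zero
  have hinner : Integrable (fun x => 2 * inner ℝ (h x) c) ρ := (hint.inner_const c).const_mul 2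
  have hdiff : Integrable (fun x => ‖h x‖ ^ 2 - 2 * inner ℝ (h x) c) ρ := hsq.sub hinner
  have hcross : |inner ℝ (∫ x, h x ∂ρ - c) c| ≤ δ := (abs_real_inner_le_norm _ _).trans
    ((mul_le_of_le_one_right (norm_nonneg _) hc).trans hmean)
  have hexp : ∫ x, ‖h x - c‖ ^ 2 ∂ρ =
      ∫ x, ‖h x‖ ^ 2 ∂ρ - 2 * inner ℝ (∫ x, h x ∂ρ) c + ‖c‖ ^ 2 := by
    simp only [norm_sub_sq_real]
    rw [integral_add hdiff (integrable_const _), integral_sub hsq hinner,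
      integral_const_mul, integral_const, probReal_univ, one_smul]
    simp only [real_inner_comm c, integral_inner hint]
  rw [inner_sub_left, real_inner_self_eq_norm_sq] at hcross
  linarith [(abs_le.1 hcross).1]

variable {ι : Type*} [TopologicalSpace ι] (e : ContractiveField X (ι →ᵇ ℂ))

theorem continuous_momentPair : Continuous (momentPair : (ι →ᵇ ℂ) → (ι →ᵇ ℂ) × (ι →ᵇ ℝ)) :=
  continuous_id.prodMk ((BoundedContinuousFunction.continuous_comp _).pow 2)

theorem integrable_momentPair (ρ : Measure X) [IsFiniteMeasure ρ] :
    Integrable (fun x => momentPair (e x)) ρ :=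
  Integrable.of_bound
    (continuous_momentPair.comp_stronglyMeasurable e.stronglyMeasurable).aestronglyMeasurable 1
    (ae_of_all _ fun x => norm_momentPair_le (e.norm_le_one x))

theorem integral_momentPair_mem_momentHull (ρ : Measure X) [IsProbabilityMeasure ρ] :
    ∫ x, momentPair (e x) ∂ρ ∈ momentHull e :=
  convex_closedConvexHull.integral_mem isClosed_closedConvexHull
    (ae_of_all _ fun x => subset_closedConvexHull ⟨x, rfl⟩) (integrable_momentPair e ρ)

theorem integral_momentPair_fst (ρ : Measure X) [IsFiniteMeasure ρ] :
    (∫ x, momentPair (e x) ∂ρ).1 = ∫ x, e x ∂ρ :=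
  fst_integral (integrable_momentPair e ρ)

theorem integral_momentPair_fst_apply (ρ : Measure X) [IsFiniteMeasure ρ] (i : ι) :
    (∫ x, momentPair (e x) ∂ρ).1 i = ∫ x, e x i ∂ρ := by
  have hfst : Integrable (fun x => e x) ρ := (integrable_momentPair e ρ).fst
  rw [integral_momentPair_fst]
  exact ((BoundedContinuousFunction.evalCLM ℂ i).integral_comp_comm hfst).symm

theorem integral_momentPair_snd_apply (ρ : Measure X) [IsFiniteMeasure ρ] (i : ι) :
    (∫ x, momentPair (e x) ∂ρ).2 i = ∫ x, ‖e x i‖ ^ 2 ∂ρ := by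
  have hsnd : Integrable (fun x => (momentPair (e x)).2) ρ := (integrable_momentPair e ρ).snd
  rw [snd_integral (integrable_momentPair e ρ)]
  exact ((BoundedContinuousFunction.evalCLM ℝ i).integral_comp_comm hsnd).symm

/-- The scalar field `x ↦ e x i` obtained from a field of bounded functions. -/
def ContractiveField.eval (i : ι) : ContractiveField X ℂ where
  toFun x := e x i
  stronglyMeasurable' := (BoundedContinuousFunction.evalCLM ℂ i).continuous.comp_stronglyMeasurable
    e.stronglyMeasurable
  norm_le_one' x := ((e x).norm_coe_le_norm i).trans (e.norm_le_one x)

theorem rankOne_apply_apply (u v : Lp ℂ 2 μ) (i : ι) :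
    rankOne e u v i = ∫ x, (u x * conj (v x)) • e x i ∂μ :=
  clm_rankOne e (BoundedContinuousFunction.evalCLM ℂ i) u v

theorem norm_rankOne_apply_sub_le_integral {f : Lp ℂ 2 μ} (hf : ‖f‖ = 1) (i : ι) (c : ℂ) :
    ‖rankOne e f f i - c‖ ≤ ∫ x, ‖f x‖ ^ 2 * ‖e x i - c‖ ∂μ := by
  have hff := integrable_mul_conj f f
  have heval : Integrable (fun x => (f x * conj (f x)) • e x i) μ := (e.eval i).integrable_smul hff
  have hone : ∫ x, f x * conj (f x) ∂μ = 1 := by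
    simp only [Complex.mul_conj', ← Complex.ofReal_pow]
    rw [integral_complex_ofReal, ← norm_sq_eq_integral, hf, one_pow, Complex.ofReal_one]
  calc ‖rankOne e f f i - c‖ = ‖∫ x, (f x * conj (f x)) • (e x i - c) ∂μ‖ := by
        simp only [smul_sub]
        rw [integral_sub heval (hff.smul_const c), integral_smul_const, hone, one_smul,
          rankOne_apply_apply]
    _ ≤ ∫ x, ‖(f x * conj (f x)) • (e x i - c)‖ ∂μ := norm_integral_le_integral_norm _
    _ = ∫ x, ‖f x‖ ^ 2 * ‖e x i - c‖ ∂μ := by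
        simp only [norm_smul, norm_mul, RCLike.norm_conj, pow_two]

theorem norm_rankOne_apply_sub_sq_le {κ : Type*} {a : κ → Lp ℂ 2 μ} {t : Finset κ}
    {f : Lp ℂ 2 μ} (hf : ‖f‖ = 1) (haf : ∀ᵐ x ∂μ, sqDensity a t x = 0 → f x = 0)
    (hint : Integrable (fun x => (‖f x‖ ^ 2) ^ 2 / sqDensity a t x) μ) (i : ι) (c : ℂ) :
    ‖rankOne e f f i - c‖ ^ 2 ≤
      (∫ x, (‖f x‖ ^ 2) ^ 2 / sqDensity a t x ∂μ) * ∫ x, ‖e x i - c‖ ^ 2 ∂(mixture a t) := by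
  have hmeas : StronglyMeasurable fun x => ‖e x i - c‖ :=
    ((e.eval i).stronglyMeasurable.sub stronglyMeasurable_const).norm
  have hbound : ∀ x, ‖e x i - c‖ ≤ 1 + ‖c‖ := fun x =>
    (norm_sub_le _ _).trans (by gcongr; exact (e.eval i).norm_le_one x)
  have hpc : Integrable (fun x => ‖f x‖ ^ 2 * ‖e x i - c‖) μ :=
    (integrable_norm_sq f).mul_bdd hmeas.aestronglyMeasurable
      (ae_of_all _ fun x => (norm_norm _).trans_le (hbound x))
  have hgc : Integrable (fun x => sqDensity a t x * ‖e x i - c‖ ^ 2) μ :=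
    (integrable_sqDensity a t).mul_bdd (c := (1 + ‖c‖) ^ 2) (hmeas.pow 2).aestronglyMeasurable
      (ae_of_all _ fun x => by rw [norm_pow, norm_norm]; gcongr; exact hbound x)
  rw [integral_mixture]
  refine le_trans ?_ (sq_integral_mul_le (sqDensity_nonneg a t)
    (haf.mono fun x hx h => by rw [hx h, norm_zero, zero_pow two_ne_zero]) hint hpc hgc)
  gcongr
  exact norm_rankOne_apply_sub_le_integral e hf i c

theorem exists_family_of_mem_convexHull_rankOne {E : Type*} [NormedAddCommGroup E]
    [NormedSpace ℂ E] (e : ContractiveField X E) {M : Submodule ℂ (Lp ℂ 2 μ)} {K : Set X} {ε : ℝ}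
    {y : E} (hy : y ∈ convexHull ℝ ((fun f => rankOne e f f) '' unitVectorsOff M K ε)) :
    ∃ (κ : Type) (t : Finset κ) (a : κ → Lp ℂ 2 μ), (∀ i, a i ∈ M) ∧ ∑ i ∈ t, ‖a i‖ ^ 2 = 1 ∧
      ∑ i ∈ t, ∫ x in K, ‖a i x‖ ^ 2 ∂μ ≤ ε ∧ ∑ i ∈ t, rankOne e (a i) (a i) = y := by
  obtain ⟨κ, _, w, ys, hw, hw₁, hys, rfl⟩ := mem_convexHull_iff_exists_fintype.1 hy
  choose f hf hfy using hys
  have hnorm (i : κ) : ‖((√(w i) : ℝ) : ℂ)‖ ^ 2 = w i := norm_ofReal_sqrt_sq (hw i)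
  refine ⟨κ, Finset.univ, fun i => ((√(w i) : ℝ) : ℂ) • f i, fun i => M.smul_mem _ (hf i).1, ?_, ?_,
    ?_⟩
  · simp only [norm_smul, (hf _).2.1, mul_one, hnorm, hw₁]
  · have hmass (i : κ) : ∫ x in K, ‖(((√(w i) : ℝ) : ℂ) • f i) x‖ ^ 2 ∂μ ≤ w i * ε := by
      rw [integral_congr_ae (g := fun x => w i * ‖f i x‖ ^ 2), integral_const_mul]
      · exact mul_le_mul_of_nonneg_left (hf i).2.2 (hw i)
      · filter_upwards [ae_restrict_of_ae (Lp.coeFn_smul ((√(w i) : ℝ) : ℂ) (f i))] with x hx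
        rw [hx, Pi.smul_apply, norm_smul, mul_pow, hnorm]
    calc ∑ i, ∫ x in K, ‖(((√(w i) : ℝ) : ℂ) • f i) x‖ ^ 2 ∂μ ≤ ∑ i, w i * ε :=
          Finset.sum_le_sum fun i _ => hmass i
      _ = ε := by rw [← Finset.sum_mul, hw₁, one_mul]
  · refine Finset.sum_congr rfl fun i _ => ?_
    rw [map_smulₛₗ, map_smulₛₗ, smul_apply, smul_smul, RingHom.id_apply, Complex.conj_mul',
      ← Complex.ofReal_pow, hnorm, Complex.coe_smul, ← hfy]

variable {e}

/- For a randomly signed sum `f` of vectors `a i` the integral `∫ |f|⁴ / ∑ |a i|²` is bounded, so by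
Cauchy–Schwarz the squared error is at most a multiple of the variance of `e` under `∑ |a i|² μ`. -/
theorem momentPair_mem_energyApprox [TopologicalSpace X] [SigmaCompactSpace X]
    [T2Space X] [OpensMeasurableSpace X] {M : Submodule ℂ (Lp ℂ 2 μ)} {x : X}
    (h : ∀ K : Set X, IsCompact K → ∀ ε > 0,
      e x ∈ closure (convexHull ℝ ((fun f => rankOne e f f) '' unitVectorsOff M K ε))) :
    momentPair (e x) ∈ EnergyApprox M e (1 / 24) := by
  intro W ε hε
  obtain ⟨η, hη₀, -, hηε⟩ :=
    exists_pos_le_one_mul_le (C := 3 + ∑ w ∈ W, ‖w‖ ^ 2) (by positivity) hε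
  obtain ⟨K, hK, hKW⟩ := exists_isCompact_forall_setIntegral_compl_le W (pow_pos hη₀ 2)
  obtain ⟨y, hy, hyx⟩ := Metric.mem_closure_iff.1 (h K hK (η ^ 2 / 4) (by positivity)) (ε / 2)
    (half_pos hε)
  obtain ⟨κ, t, a, haM, ha, haK, rfl⟩ := exists_family_of_mem_convexHull_rankOne e hy
  have := isProbabilityMeasure_mixture ha
  obtain ⟨f, ⟨hfM, hf, hfK⟩, haf, hint, hle⟩ :=
    exists_mem_unitVectorsOff haM ha (by positivity) haK
  have hmean : ‖(∫ z, momentPair (e z) ∂(mixture a t)).1 - e x‖ ≤ ε / 2 := by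
    rw [integral_momentPair_fst, integral_mixture_eq_sum_rankOne, ← dist_eq_norm, dist_comm]
    exact hyx.le
  refine ⟨f, hfM, _, integral_momentPair_mem_momentHull e (mixture a t), by rw [hf]; linarith,
    fun w hw => ?_, hmean.trans (by linarith), fun i => ?_⟩
  · have hw' : ‖w‖ ^ 2 ≤ ∑ w ∈ W, ‖w‖ ^ 2 :=
      Finset.single_le_sum (f := fun w : Lp ℂ 2 μ => ‖w‖ ^ 2) (fun _ _ => by positivity) hw
    refine (absPair_le_of_setIntegral_le hK.measurableSet hη₀ (by linarith) (hKW w hw)).trans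
      (le_trans ?_ hηε)
    rw [hf, mul_comm]
    gcongr
    linarith
  · have hmean_i : ‖∫ z, e z i ∂(mixture a t) - e x i‖ ≤ ε / 2 := by
      rw [← integral_momentPair_fst_apply]
      exact (((∫ z, momentPair (e z) ∂(mixture a t)).1 - e x).norm_coe_le_norm i).trans hmean
    have hvar : ∫ z, ‖e z i - e x i‖ ^ 2 ∂(mixture a t) ≤
        ∫ z, ‖e z i‖ ^ 2 ∂(mixture a t) - ‖e x i‖ ^ 2 + 2 * (ε / 2) :=
      integral_norm_sub_sq_le
        (MemLp.of_bound (e.eval i).stronglyMeasurable.aestronglyMeasurable 1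
          (ae_of_all _ (e.eval i).norm_le_one)) ((e.eval i).norm_le_one x) hmean_i
    have hvar₀ : 0 ≤ ∫ z, ‖e z i - e x i‖ ^ 2 ∂(mixture a t) :=
      integral_nonneg fun _ => by positivity
    have hCS : ‖rankOne e f f i - (momentPair (e x)).1 i‖ ^ 2 ≤
        24 * ∫ z, ‖e z i - e x i‖ ^ 2 ∂(mixture a t) :=
      (norm_rankOne_apply_sub_sq_le e hf haf hint i (e x i)).trans
        (mul_le_mul_of_nonneg_right hle hvar₀)
    rw [integral_momentPair_snd_apply, momentPair_snd_apply]
    linarith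

end EnergyBase

variable {d : ℕ} {Ω : Set (Fin d → ℂ)}

section Holo

variable {φ ψ : Ω → ℂ}

theorem Holo.continuous (h : Holo Ω φ) : Continuous φ := by
  obtain ⟨F, hF, hFφ⟩ := h
  exact hF.continuousOn.domRestrict.congr hFφ

theorem Holo.add (h : Holo Ω φ) (h' : Holo Ω ψ) : Holo Ω (φ + ψ) := by
  obtain ⟨F, hF, hFφ⟩ := h
  obtain ⟨G, hG, hGψ⟩ := h'
  exact ⟨F + G, hF.add hG, fun z => congrArg₂ (· + ·) (hFφ z) (hGψ z)⟩

theorem Holo.const_smul (c : ℂ) (h : Holo Ω φ) : Holo Ω (c • φ) := by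
  obtain ⟨F, hF, hFφ⟩ := h
  exact ⟨c • F, hF.const_smul c, fun z => congrArg (c • ·) (hFφ z)⟩

theorem Holo.cexp (h : Holo Ω φ) : Holo Ω fun z => Complex.exp (φ z) := by
  obtain ⟨F, hF, hFφ⟩ := h
  exact ⟨fun z => Complex.exp (F z), hF.cexp, fun z => congrArg _ (hFφ z)⟩

theorem holo_const (c : ℂ) : Holo Ω fun _ => c :=
  ⟨fun _ => c, differentiableOn_const c, fun _ => rfl⟩

theorem holo_coord (i : Fin d) : Holo Ω fun z => (z : Fin d → ℂ) i :=
  ⟨fun z => z i, by fun_prop, fun _ => rfl⟩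

theorem Holo.re_eq_of_isMaxOn (hΩ : IsOpen Ω) (hc : IsConnected Ω) (hφ : Holo Ω φ) {x : Ω}
    (hx : ∀ x', (φ x').re ≤ (φ x).re) (y : Ω) : (φ y).re = (φ x).re := by
  obtain ⟨F, hF, hFφ⟩ := hφ
  have hmax : IsMaxOn (norm ∘ fun z => Complex.exp (F z)) Ω x := fun z hz => by
    simpa [Complex.norm_exp, ← hFφ] using hx ⟨z, hz⟩
  have heq := Complex.norm_eqOn_of_isPreconnected_of_isMaxOn hc.isPreconnected hΩ hF.cexp x.2
    hmax y.2
  simpa [Complex.norm_exp, hFφ] using heq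

end Holo

section LebesgueMeasure

theorem leb_apply (hΩ : IsOpen Ω) (s : Set Ω) : leb Ω s = volume (Subtype.val '' s) :=
  (MeasurableEmbedding.subtype_coe hΩ.measurableSet).comap_apply _ _

theorem isFiniteMeasure_leb (hΩ : IsOpen Ω) (hb : Bornology.IsBounded Ω) :
    IsFiniteMeasure (leb Ω) :=
  ⟨by
    rw [leb_apply hΩ, Set.image_univ, Subtype.range_coe]
    exact hb.measure_lt_top⟩

theorem isOpenPosMeasure_leb (hΩ : IsOpen Ω) : (leb Ω).IsOpenPosMeasure :=
  ⟨fun U hU hne => by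
    rw [leb_apply hΩ]
    exact ((hΩ.isOpenMap_subtype_val U hU).measure_pos volume (hne.image _)).ne'⟩

theorem setLIntegral_eq_leb (hΩ : IsOpen Ω) {s : Set (Fin d → ℂ)} (hs : MeasurableSet s)
    (hsub : s ⊆ Ω) (F : (Fin d → ℂ) → ℝ≥0∞) :
    ∫⁻ x in s, F x = ∫⁻ x in Subtype.val ⁻¹' s, F (x : Fin d → ℂ) ∂(leb Ω) := by
  have he := MeasurableEmbedding.subtype_coe hΩ.measurableSet
  have hmap : (leb Ω).map Subtype.val = volume.restrict Ω := by
    rw [leb, he.map_comap, Subtype.range_coe]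
  rw [← he.lintegral_map, ← he.restrict_map, hmap, Measure.restrict_restrict hs,
    Set.inter_eq_left.2 hsub]

end LebesgueMeasure

section BergmanSpace

/-- The Bergman space, as a subspace of `L²(Ω, μ)`: the classes of holomorphic functions. -/
def Berg (Ω : Set (Fin d → ℂ)) : Submodule ℂ (Lp ℂ 2 (leb Ω)) where
  carrier := {u | ∃ f, Holo Ω f ∧ ⇑u =ᵐ[leb Ω] f}
  zero_mem' := ⟨_, holo_const 0, Lp.coeFn_zero ℂ 2 _⟩
  add_mem' := by
    rintro u v ⟨f, hf, hu⟩ ⟨g, hg, hv⟩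
    exact ⟨f + g, hf.add hg, (Lp.coeFn_add u v).trans (hu.add hv)⟩
  smul_mem' := by
    rintro c u ⟨f, hf, hu⟩
    exact ⟨c • f, hf.const_smul c, (Lp.coeFn_smul c u).trans (hu.const_smul c)⟩

theorem memBergman_of_ae {u : Lp ℂ 2 (leb Ω)} {f : Ω → ℂ} (hf : Holo Ω f)
    (hu : ⇑u =ᵐ[leb Ω] f) : MemBergman Ω f :=
  ⟨hf, (memLp_congr_ae hu).1 (Lp.memLp u)⟩

theorem enorm_mul_volume_ball_le_eLpNorm_one (hΩ : IsOpen Ω) {F : (Fin d → ℂ) → ℂ}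
    (hF : DifferentiableOn ℂ F Ω) {z : Fin d → ℂ} {r : ℝ} (hr : ball z r ⊆ Ω) :
    ‖F z‖ₑ * volume (ball z r) ≤ eLpNorm (fun x : Ω => F x) 1 (leb Ω) := by
  refine (enorm_mul_volume_ball_le (hF.mono hr)).trans ?_
  rw [setLIntegral_eq_leb hΩ measurableSet_ball hr, eLpNorm_one_eq_lintegral_enorm]
  exact setLIntegral_le_lintegral _ _

theorem exists_norm_le_mul_norm (hΩ : IsOpen Ω) (hb : Bornology.IsBounded Ω) {z : Fin d → ℂ}
    (hz : z ∈ Ω) : ∃ r > 0, ball z r ⊆ Ω ∧ ∃ C : ℝ, 0 ≤ C ∧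
      ∀ (u : Lp ℂ 2 (leb Ω)) (F : (Fin d → ℂ) → ℂ), DifferentiableOn ℂ F Ω →
        (⇑u =ᵐ[leb Ω] fun x => F x) → ∀ x ∈ ball z r, ‖F x‖ ≤ C * ‖u‖ := by
  have := isFiniteMeasure_leb hΩ hb
  obtain ⟨r, hr, hrΩ⟩ := Metric.isOpen_iff.1 hΩ z hz
  refine ⟨r / 2, half_pos hr, (ball_subset_ball (half_le_self hr.le)).trans hrΩ, ?_⟩
  set V : ℝ≥0∞ := volume (ball z (r / 2)) with hV
  have hV₀ : V ≠ 0 := (measure_ball_pos _ _ (half_pos hr)).ne'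
  have hV₁ : V ≠ ∞ := measure_ball_lt_top.ne
  set M : ℝ≥0∞ := leb Ω Set.univ ^ (1 / (1 : ℝ≥0∞).toReal - 1 / (2 : ℝ≥0∞).toReal)
  have hM : M ≠ ∞ := ENNReal.rpow_ne_top_of_nonneg (by norm_num) (measure_ne_top _ _)
  refine ⟨(M / V).toReal, ENNReal.toReal_nonneg, fun u F hF hu x hx => ?_⟩
  have hsub : ball x (r / 2) ⊆ Ω :=
    (ball_subset_ball' (by rw [mem_ball] at hx; linarith)).trans hrΩ
  have hmul : ‖F x‖ₑ * V ≤ eLpNorm u 2 (leb Ω) * M := by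
    rw [hV, Measure.addHaar_ball_center, ← Measure.addHaar_ball_center volume x]
    refine (enorm_mul_volume_ball_le_eLpNorm_one hΩ hF hsub).trans ?_
    rw [← eLpNorm_congr_ae hu]
    exact eLpNorm_le_eLpNorm_mul_rpow_measure_univ (by norm_num) (Lp.aestronglyMeasurable u)
  have hle : ‖F x‖ₑ ≤ M / V * eLpNorm u 2 (leb Ω) := by
    rwa [ENNReal.mul_div_right_comm.symm, mul_comm M, ENNReal.le_div_iff_mul_le (.inl hV₀)
      (.inl hV₁)]
  have hreal := ENNReal.toReal_mono (ENNReal.mul_ne_top (ENNReal.div_ne_top hM hV₀)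
    (Lp.eLpNorm_ne_top u)) hle
  rwa [ENNReal.toReal_mul, toReal_enorm, ← Lp.norm_def] at hreal

theorem exists_uniformCauchySeqOn_ball (hΩ : IsOpen Ω) (hb : Bornology.IsBounded Ω)
    {u : ℕ → Lp ℂ 2 (leb Ω)} (hu : CauchySeq u) {F : ℕ → (Fin d → ℂ) → ℂ}
    (hF : ∀ n, DifferentiableOn ℂ (F n) Ω) (huF : ∀ n, ⇑(u n) =ᵐ[leb Ω] fun x => F n x)
    {z : Fin d → ℂ} (hz : z ∈ Ω) :
    ∃ r > 0, ball z r ⊆ Ω ∧ UniformCauchySeqOn F atTop (ball z r) := by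
  obtain ⟨r, hr, hrΩ, C, hC, hbd⟩ := exists_norm_le_mul_norm hΩ hb hz
  refine ⟨r, hr, hrΩ, Metric.uniformCauchySeqOn_iff.2 fun ε hε => ?_⟩
  obtain ⟨N, hN⟩ := Metric.cauchySeq_iff.1 hu (ε / (C + 1)) (by positivity)
  refine ⟨N, fun m hm n hn x hx => ?_⟩
  calc dist (F m x) (F n x) = ‖(F m - F n) x‖ := dist_eq_norm _ _
    _ ≤ C * ‖u m - u n‖ := hbd _ _ ((hF m).sub (hF n))
        ((Lp.coeFn_sub _ _).trans ((huF m).sub (huF n))) x hx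
    _ ≤ (C + 1) * dist (u m) (u n) := by
        rw [dist_eq_norm]
        gcongr
        linarith
    _ < (C + 1) * (ε / (C + 1)) := by
        gcongr
        exact hN m hm n hn
    _ = ε := mul_div_cancel₀ ε (by positivity)

theorem isClosed_berg (hΩ : IsOpen Ω) (hb : Bornology.IsBounded Ω) :
    IsClosed (Berg Ω : Set (Lp ℂ 2 (leb Ω))) := by
  refine IsSeqClosed.isClosed fun u v hu huv => ?_
  choose f hf huf using hu
  choose F hF hFf using hf
  have huF (n : ℕ) : ⇑(u n) =ᵐ[leb Ω] fun x => F n x :=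
    (huf n).trans (ae_of_all _ fun x => (hFf n x).symm)
  have hloc := fun z (hz : z ∈ Ω) => exists_uniformCauchySeqOn_ball hΩ hb huv.cauchySeq hF huF hz
  have hlim : ∀ z ∈ Ω, ∃ y, Tendsto (fun n => F n z) atTop (𝓝 y) := fun z hz => by
    obtain ⟨r, hr, -, hcauchy⟩ := hloc z hz
    exact cauchySeq_tendsto_of_complete (hcauchy.cauchySeq (mem_ball_self hr))
  choose! G hG using hlim
  have hGd : DifferentiableOn ℂ G Ω := fun z hz => by
    obtain ⟨r, hr, hrΩ, hcauchy⟩ := hloc z hz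
    exact (differentiableAt_of_tendstoUniformlyOn_ball hr (fun n => (hF n).mono hrΩ)
      (hcauchy.tendstoUniformlyOn_of_tendsto fun x hx => hG x (hrΩ hx))).differentiableWithinAt
  refine ⟨fun z => G z, ⟨G, hGd, fun _ => rfl⟩, ?_⟩
  obtain ⟨ns, hns, hae⟩ := (tendstoInMeasure_of_tendsto_Lp huv).exists_seq_tendsto_ae
  filter_upwards [hae, ae_all_iff.2 huF] with z hz hzF
  exact tendsto_nhds_unique hz
    (((hG z z.2).comp hns.tendsto_atTop).congr fun n => (hzF (ns n)).symm)

end BergmanSpace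

section Concentration

theorem exists_setIntegral_exp_le {X : Type*} [TopologicalSpace X] [MeasurableSpace X]
    [BorelSpace X] {μ : Measure X} [IsFiniteMeasure μ] [μ.IsOpenPosMeasure] {u : X → ℝ}
    (hu : Continuous u) {M : ℝ} (hM : ∀ x, u x ≤ M) {a : ℝ} {x₀ : X} (hx₀ : a < u x₀)
    {ε : ℝ} (hε : 0 < ε) :
    ∃ n : ℕ, ∫ x in {x | u x ≤ a}, Real.exp (n * u x) ∂μ ≤ ε * ∫ x, Real.exp (n * u x) ∂μ := by
  obtain ⟨b, hab, hb⟩ := exists_between hx₀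
  set U : Set X := {x | b < u x}
  have hU : IsOpen U := isOpen_lt continuous_const hu
  have hUpos : 0 < μ.real U :=
    ENNReal.toReal_pos (hU.measure_pos _ ⟨x₀, hb⟩).ne' (measure_ne_top _ _)
  have hint (n : ℕ) : Integrable (fun x => Real.exp (n * u x)) μ :=
    Integrable.of_bound (by fun_prop) (Real.exp (n * M)) (ae_of_all _ fun x => by
      rw [Real.norm_of_nonneg (Real.exp_pos _).le]
      gcongr
      exact hM x)
  have hupper (n : ℕ) : ∫ x in {x | u x ≤ a}, Real.exp (n * u x) ∂μ ≤
      Real.exp (n * a) * μ.real Set.univ := by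
    have hle := setIntegral_mono_on (hint n).integrableOn
      (integrable_const (Real.exp (n * a))).integrableOn
      (measurableSet_le hu.measurable measurable_const) fun x (hx : u x ≤ a) => by gcongr
    rw [setIntegral_const, smul_eq_mul, mul_comm] at hle
    refine hle.trans ?_
    gcongr
    · exact measure_ne_top _ _
    · exact Set.subset_univ _
  have hlower (n : ℕ) : Real.exp (n * b) * μ.real U ≤ ∫ x, Real.exp (n * u x) ∂μ := by
    have hle := setIntegral_mono_on (integrable_const (Real.exp (n * b))).integrableOn
      (hint n).integrableOn hU.measurableSet fun x (hx : b < u x) => by gcongr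
    rw [setIntegral_const, smul_eq_mul, mul_comm] at hle
    exact hle.trans (setIntegral_le_integral (hint n) (ae_of_all _ fun x => (Real.exp_pos _).le))
  have hlim : Tendsto (fun n : ℕ => Real.exp (n * (a - b)) * μ.real Set.univ) atTop (𝓝 0) := by
    simpa using (Real.tendsto_exp_atBot.comp
      (tendsto_natCast_atTop_atTop.atTop_mul_const_of_neg (sub_neg.2 hab))).mul_const
        (μ.real Set.univ)
  obtain ⟨n, hn⟩ := (hlim.eventually (ge_mem_nhds (mul_pos hε hUpos))).exists
  refine ⟨n, (hupper n).trans ?_⟩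
  calc Real.exp (n * a) * μ.real Set.univ
      = Real.exp (n * (a - b)) * μ.real Set.univ * Real.exp (n * b) := by
        rw [mul_right_comm, ← Real.exp_add]
        ring_nf
    _ ≤ ε * μ.real U * Real.exp (n * b) := by gcongr
    _ = ε * (Real.exp (n * b) * μ.real U) := by ring
    _ ≤ ε * ∫ x, Real.exp (n * u x) ∂μ := by
        gcongr
        exact hlower n

theorem le_integral_mul_norm_sq {X : Type*} [MeasurableSpace X] {μ : Measure X} {u : X → ℝ}
    (hu : Measurable u) {M : ℝ} (hM : ∀ x, |u x| ≤ M) {f : Lp ℂ 2 μ} (hf : ‖f‖ = 1) {a η : ℝ}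
    (hη : ∫ x in {x | u x ≤ a}, ‖f x‖ ^ 2 ∂μ ≤ η) (ha : 0 ≤ M + |a|) :
    a - (M + |a|) * η ≤ ∫ x, u x * ‖f x‖ ^ 2 ∂μ := by
  set S : Set X := {x | u x ≤ a}
  have hS : MeasurableSet S := measurableSet_le hu measurable_const
  have hsq := integrable_norm_sq f
  have hpt (x : X) : a * ‖f x‖ ^ 2 - (M + |a|) * S.indicator (fun x => ‖f x‖ ^ 2) x ≤
      u x * ‖f x‖ ^ 2 := by
    by_cases hx : x ∈ S
    · rw [Set.indicator_of_mem hx, ← sub_mul]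
      gcongr
      linarith [(abs_le.1 (hM x)).1, le_abs_self a]
    · rw [Set.indicator_of_notMem hx, mul_zero, sub_zero]
      gcongr
      exact (not_le.1 hx).le
  have hind := hsq.indicator hS
  have hle := integral_mono ((hsq.const_mul a).sub (hind.const_mul (M + |a|)))
    (hsq.bdd_mul hu.aestronglyMeasurable (ae_of_all _ hM)) hpt
  rw [integral_sub' (hsq.const_mul a) (hind.const_mul _), integral_const_mul, integral_const_mul,
    integral_indicator hS, ← norm_sq_eq_integral, hf, one_pow, mul_one] at hle
  exact le_trans (by gcongr) hle

theorem exists_berg_setIntegral_re_le (hΩ : IsOpen Ω) (hb : Bornology.IsBounded Ω) {φ : Ω → ℂ}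
    (hφ : Holo Ω φ) {M : ℝ} (hM : ∀ x, ‖φ x‖ ≤ M) {a : ℝ} {x₀ : Ω} (hx₀ : a < (φ x₀).re) {ε : ℝ}
    (hε : 0 < ε) :
    ∃ f ∈ Berg Ω, ‖f‖ = 1 ∧ ∫ x in {x | (φ x).re ≤ a}, ‖f x‖ ^ 2 ∂(leb Ω) ≤ ε := by
  have := isFiniteMeasure_leb hΩ hb
  have := isOpenPosMeasure_leb hΩ
  have : NeZero (leb Ω) :=
    ⟨fun h => (isOpen_univ.measure_pos (leb Ω) ⟨x₀, trivial⟩).ne' (by simp [h])⟩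
  have hu : Continuous fun x => 2 * (φ x).re :=
    continuous_const.mul (Complex.continuous_re.comp hφ.continuous)
  have hφM (x : Ω) : (φ x).re ≤ M := (Complex.re_le_norm _).trans (hM x)
  obtain ⟨n, hn⟩ := exists_setIntegral_exp_le (μ := leb Ω) hu (M := 2 * M) (a := 2 * a) (x₀ := x₀)
    (fun x => by linarith [hφM x]) (by linarith) hε
  set E : Ω → ℂ := fun x => Complex.exp (((n : ℂ) • φ) x) with hE
  have hEh : Holo Ω E := (hφ.const_smul _).cexp
  have hEre (x : Ω) : ‖E x‖ = Real.exp (n * (φ x).re) := by simp [hE, Complex.norm_exp]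
  have hEsq (x : Ω) : ‖E x‖ ^ 2 = Real.exp (n * (2 * (φ x).re)) := by
    rw [hEre, ← Real.exp_nat_mul]
    ring_nf
  have hEL : MemLp E 2 (leb Ω) :=
    MemLp.of_bound hEh.continuous.aestronglyMeasurable (Real.exp (n * M)) (ae_of_all _ fun x => by
      rw [hEre]
      gcongr
      exact hφM x)
  set e : Lp ℂ 2 (leb Ω) := hEL.toLp E
  have heE : ⇑e =ᵐ[leb Ω] E := hEL.coeFn_toLp
  have hnorm : ‖e‖ ^ 2 = ∫ x, Real.exp (n * (2 * (φ x).re)) ∂(leb Ω) := by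
    rw [norm_sq_eq_integral]
    exact integral_congr_ae (heE.mono fun x hx => by simp only [hx, hEsq])
  have hpos : 0 < ‖e‖ ^ 2 := by
    rw [hnorm]
    exact integral_exp_pos ((hEL.integrable_norm_pow two_ne_zero).congr (ae_of_all _ hEsq))
  have he : ‖e‖ ≠ 0 := fun h => by simp [h] at hpos
  refine ⟨(‖e‖ : ℂ)⁻¹ • e, Submodule.smul_mem _ _ ⟨E, hEh, heE⟩, ?_, ?_⟩
  · rw [norm_smul, norm_inv, Complex.norm_real, norm_norm, inv_mul_cancel₀ he]
  · have hsq : ∀ᵐ x ∂(leb Ω), ‖((‖e‖ : ℂ)⁻¹ • e) x‖ ^ 2 =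
        (‖e‖ ^ 2)⁻¹ * Real.exp (n * (2 * (φ x).re)) := by
      filter_upwards [heE, Lp.coeFn_smul ((‖e‖ : ℂ)⁻¹) e] with x hx hx'
      rw [hx', Pi.smul_apply, norm_smul, hx, mul_pow, hEsq, norm_inv, Complex.norm_real,
        norm_norm, inv_pow]
    rw [integral_congr_ae (ae_restrict_of_ae hsq), integral_const_mul, inv_mul_le_iff₀ hpos, hnorm,
      mul_comm _ ε]
    simpa using hn

theorem exists_mem_unitVectorsOff_of_not_attained (hΩ : IsOpen Ω) (hb : Bornology.IsBounded Ω)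
    {φ : Ω → ℂ} (hφ : Holo Ω φ) {M : ℝ} (hM : ∀ x, ‖φ x‖ ≤ M)
    (hna : ∀ x, ∃ x', (φ x).re < (φ x').re) {K : Set Ω} (hK : IsCompact K) (z : Ω) {ε : ℝ}
    (hε : 0 < ε) :
    ∃ f ∈ unitVectorsOff (Berg Ω) K ε, (φ z).re ≤ ∫ x, (φ x).re * ‖f x‖ ^ 2 ∂(leb Ω) := by
  have hu : Continuous fun x => (φ x).re := Complex.continuous_re.comp hφ.continuous
  have huM (x : Ω) : |(φ x).re| ≤ M := (Complex.abs_re_le_norm _).trans (hM x)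
  obtain ⟨k₀, -, hk₀⟩ :=
    (hK.insert z).exists_isMaxOn ⟨z, Set.mem_insert _ _⟩ hu.continuousOn
  obtain ⟨x₀, hx₀⟩ := hna k₀
  obtain ⟨a, ha, hax₀⟩ := exists_between hx₀
  have hza : (φ z).re < a := (hk₀ (Set.mem_insert _ _)).trans_lt ha
  have hKa : K ⊆ {x | (φ x).re ≤ a} := fun k hk => (hk₀ (Set.mem_insert_of_mem _ hk)).trans ha.le
  have hMa : 0 ≤ M + |a| := add_nonneg ((norm_nonneg _).trans (hM z)) (abs_nonneg a)
  set η : ℝ := min ε ((a - (φ z).re) / (M + |a| + 1))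
  have hη : 0 < η := lt_min hε (div_pos (sub_pos.2 hza) (by positivity))
  have hηa : (M + |a|) * η ≤ a - (φ z).re :=
    calc (M + |a|) * η ≤ (M + |a| + 1) * ((a - (φ z).re) / (M + |a| + 1)) :=
          mul_le_mul (lt_add_one _).le (min_le_right _ _) hη.le (by positivity)
      _ = a - (φ z).re := mul_div_cancel₀ _ (by positivity)
  obtain ⟨f, hf, hf₁, hfa⟩ := exists_berg_setIntegral_re_le hΩ hb hφ hM hax₀ hη
  refine ⟨f, ⟨hf, hf₁, ?_⟩, le_trans (by linarith)
    (le_integral_mul_norm_sq hu.measurable huM hf₁ hfa hMa)⟩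
  exact (setIntegral_mono_set (integrable_norm_sq f).integrableOn
    (ae_of_all _ fun _ => by positivity) hKa.eventuallyLE).trans (hfa.trans (min_le_left _ _))

/- If `Re φ` is constant, the inequality is an equality for every unit vector, so it is enough to
concentrate with a coordinate function in place of `φ`. -/
theorem exists_mem_unitVectorsOff_berg [Nonempty (Fin d)] (hΩ : IsOpen Ω) (hc : IsConnected Ω)
    (hb : Bornology.IsBounded Ω) {φ : Ω → ℂ} (hφ : Holo Ω φ) {M : ℝ} (hM : ∀ x, ‖φ x‖ ≤ M)
    {K : Set Ω} (hK : IsCompact K) (z : Ω) {ε : ℝ} (hε : 0 < ε) :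
    ∃ f ∈ unitVectorsOff (Berg Ω) K ε, (φ z).re ≤ ∫ x, (φ x).re * ‖f x‖ ^ 2 ∂(leb Ω) := by
  by_cases hna : ∀ x, ∃ x', (φ x).re < (φ x').re
  · exact exists_mem_unitVectorsOff_of_not_attained hΩ hb hφ hM hna hK z hε
  push Not at hna
  obtain ⟨x₀, hx₀⟩ := hna
  obtain ⟨i⟩ := ‹Nonempty (Fin d)›
  obtain ⟨C, hC⟩ := hb.exists_norm_le
  have hcoord (x : Ω) : ∃ x' : Ω, ((x : Fin d → ℂ) i).re < ((x' : Fin d → ℂ) i).re := by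
    obtain ⟨r, hr, hrΩ⟩ := Metric.isOpen_iff.1 hΩ x x.2
    have hmem : (x : Fin d → ℂ) + Pi.single i ((r / 2 : ℝ) : ℂ) ∈ ball (x : Fin d → ℂ) r := by
      rw [mem_ball_iff_norm, add_sub_cancel_left, Pi.norm_single, Complex.norm_real,
        Real.norm_of_nonneg (half_pos hr).le]
      exact half_lt_self hr
    exact ⟨⟨_, hrΩ hmem⟩, by simpa using hr⟩
  obtain ⟨f, hf, -⟩ := exists_mem_unitVectorsOff_of_not_attained hΩ hb (holo_coord i)
    (fun x => (norm_le_pi_norm _ i).trans (hC x x.2)) hcoord hK z hε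
  refine ⟨f, hf, ?_⟩
  simp only [hφ.re_eq_of_isMaxOn hΩ hc hx₀]
  rw [integral_const_mul, ← norm_sq_eq_integral, hf.2.1, one_pow, mul_one]

end Concentration

section Evaluation

/-- The closed unit ball of `A` for the supremum norm, used as a discrete index set: `A` and its
predual are studied through bounded functions on it. -/
structure UnitBall (A : Subalgebra ℂ (HInfty Ω)) where
  fn : HInfty Ω
  mem : fn ∈ A
  norm_le_one : ∀ x, ‖(fn : Ω → ℂ) x‖ ≤ 1

variable (A : Subalgebra ℂ (HInfty Ω))

instance : TopologicalSpace (UnitBall A) := ⊥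

instance : DiscreteTopology (UnitBall A) := ⟨rfl⟩

/-- Evaluation at a point of `Ω`, as a function on the unit ball of `A`. -/
def ev (z : Ω) : UnitBall A →ᵇ ℂ :=
  BoundedContinuousFunction.ofNormedAddCommGroupDiscrete (fun ψ => (ψ.fn : Ω → ℂ) z) 1
    fun ψ => ψ.norm_le_one z

theorem norm_ev_le_one (z : Ω) : ‖ev A z‖ ≤ 1 :=
  (BoundedContinuousFunction.norm_le zero_le_one).2 fun ψ => ψ.norm_le_one z

theorem norm_clm_ev_le (Λ : (UnitBall A →ᵇ ℂ) →L[ℂ] ℂ) (z : Ω) : ‖Λ (ev A z)‖ ≤ ‖Λ‖ :=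
  Λ.unit_le_opNorm _ (norm_ev_le_one A z)

theorem extend_ev_apply {x : Fin d → ℂ} (hx : x ∈ Ω) :
    Function.extend Subtype.val (ev A) 0 x = ev A ⟨x, hx⟩ :=
  Subtype.val_injective.extend_apply (ev A) 0 ⟨x, hx⟩

theorem differentiableOn_extend_ev (hΩ : IsOpen Ω) :
    DifferentiableOn ℂ (Function.extend Subtype.val (ev A) 0) Ω := by
  intro z hz
  obtain ⟨r, hr, hrΩ⟩ := Metric.isOpen_iff.1 hΩ z hz
  refine (differentiableAt_boundedContinuousFunction (M := 1) hr (fun ψ => ?_)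
    fun ψ x hx => ?_).differentiableWithinAt
  · obtain ⟨F, hF, hFψ⟩ := ψ.fn.2.1
    refine (hF.mono hrΩ).congr fun x hx => ?_
    rw [extend_ev_apply A (hrΩ hx)]
    exact (hFψ ⟨x, hrΩ hx⟩).symm
  · rw [extend_ev_apply A (hrΩ hx)]
    exact ψ.norm_le_one _

theorem holo_clm_ev (hΩ : IsOpen Ω) (Λ : (UnitBall A →ᵇ ℂ) →L[ℂ] ℂ) :
    Holo Ω fun z => Λ (ev A z) :=
  ⟨_, Λ.differentiable.comp_differentiableOn (differentiableOn_extend_ev A hΩ),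
    fun z => congrArg Λ (extend_ev_apply A z.2)⟩

theorem continuous_ev (hΩ : IsOpen Ω) : Continuous (ev A) :=
  (differentiableOn_extend_ev A hΩ).continuousOn.domRestrict.congr fun z => extend_ev_apply A z.2

/-- The point evaluations on the unit ball of `A`, as a contractive field on `Ω`. -/
def evField (hΩ : IsOpen Ω) : ContractiveField Ω (UnitBall A →ᵇ ℂ) where
  toFun := ev A
  stronglyMeasurable' := (continuous_ev A hΩ).stronglyMeasurable
  norm_le_one' := norm_ev_le_one A

end Evaluation

section WeakStarDuality

theorem exists_forall_eq_zero_of_notMem_of_isClosed {V W : Type*} [AddCommGroup V] [Module ℂ V]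
    [AddCommGroup W] [Module ℂ W] (B : V →ₗ[ℂ] W →ₗ[ℂ] ℂ) {S : Submodule ℂ (WeakBilin B)}
    (hS : IsClosed (S : Set (WeakBilin B))) {x : WeakBilin B} (hx : x ∉ S) :
    ∃ y, (∀ s ∈ S, B s y = 0) ∧ B x y ≠ 0 := by
  obtain ⟨Λ, u, hΛ, hu⟩ := RCLike.geometric_hahn_banach_closed_point (𝕜 := ℂ)
    (S.restrictScalars ℝ).convex hS hx
  obtain ⟨y, rfl⟩ := LinearMap.dualEmbedding_surjective B Λ
  have hu₀ : 0 < u := by simpa using hΛ 0 S.zero_mem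
  refine ⟨y, fun s hs => ?_, fun hxy => ?_⟩
  · by_contra hne
    have h := hΛ _ (S.smul_mem ((u : ℂ) / B s y) hs)
    rw [map_smul, smul_eq_mul] at h
    change RCLike.re ((u : ℂ) / B s y * B s y) < u at h
    rw [div_mul_cancel₀ _ hne] at h
    simp at h
  · change u < RCLike.re (B x y) at hu
    rw [hxy, map_zero] at hu
    exact hu.not_gt hu₀

theorem integrable_mul_of_holo {h : Ω → ℂ} {μ : Measure Ω} (φ : HInfty Ω) (hh : Integrable h μ) :
    Integrable (fun z => (φ : Ω → ℂ) z * h z) μ := by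
  obtain ⟨hφ, C, hC⟩ := φ.2
  exact hh.bdd_mul hφ.continuous.aestronglyMeasurable (ae_of_all _ hC)

/-- The duality pairing `⟨φ, h⟩ = ∫ φ h dμ` between `H^∞(Ω)` and `L¹(Ω, μ)`; its weak topology on
`H^∞(Ω)` is `weakStar Ω`. -/
def pairing (Ω : Set (Fin d → ℂ)) : HInfty Ω →ₗ[ℂ] Lp ℂ 1 (leb Ω) →ₗ[ℂ] ℂ :=
  LinearMap.mk₂ ℂ (fun φ h => ∫ z, (φ : Ω → ℂ) z * h z ∂(leb Ω))
    (fun φ ψ h => by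
      rw [← integral_add (integrable_mul_of_holo φ (L1.integrable_coeFn h))
        (integrable_mul_of_holo ψ (L1.integrable_coeFn h))]
      exact integral_congr_ae (ae_of_all _ fun z => add_mul _ _ _))
    (fun c φ h => by
      rw [← integral_smul]
      exact integral_congr_ae (ae_of_all _ fun z => mul_assoc _ _ _))
    (fun φ h k => by
      rw [← integral_add (integrable_mul_of_holo φ (L1.integrable_coeFn h))
        (integrable_mul_of_holo φ (L1.integrable_coeFn k))]
      refine integral_congr_ae ?_
      filter_upwards [Lp.coeFn_add h k] with z hz
      rw [hz, Pi.add_apply, mul_add])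
    (fun c φ h => by
      rw [← integral_smul]
      refine integral_congr_ae ?_
      filter_upwards [Lp.coeFn_smul c h] with z hz
      rw [hz, Pi.smul_apply, mul_smul_comm])

theorem pairing_apply (φ : HInfty Ω) (h : Lp ℂ 1 (leb Ω)) :
    pairing Ω φ h = ∫ z, (φ : Ω → ℂ) z * h z ∂(leb Ω) := rfl

variable {A : Subalgebra ℂ (HInfty Ω)}

/- If `φ = Λ ∘ ev` were not in `A`, some `h ∈ L¹` would annihilate `A` but not `φ`. Then
`∫ h • ev = 0`, since its value at `ψ` in the unit ball is `∫ ψ h`, and applying `Λ` gives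
`∫ φ h = 0`. -/
theorem exists_mem_forall_eq_clm_ev (hΩ : IsOpen Ω)
    (hA : IsClosed[weakStar Ω] (A : Set (HInfty Ω))) (Λ : (UnitBall A →ᵇ ℂ) →L[ℂ] ℂ) :
    ∃ φ ∈ A, ∀ z, (φ : Ω → ℂ) z = Λ (ev A z) := by
  set φ : HInfty Ω := ⟨fun z => Λ (ev A z), holo_clm_ev A hΩ Λ, ‖Λ‖, norm_clm_ev_le A Λ⟩
  refine ⟨φ, ?_, fun z => rfl⟩
  by_contra hφ
  obtain ⟨h, hh, hφh⟩ := exists_forall_eq_zero_of_notMem_of_isClosed (pairing Ω)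
    (S := Subalgebra.toSubmodule A) hA hφ
  have hint : Integrable (fun z => h z • ev A z) (leb Ω) :=
    (evField A hΩ).integrable_smul (L1.integrable_coeFn h)
  have hcomp (Γ : (UnitBall A →ᵇ ℂ) →L[ℂ] ℂ) :
      Γ (∫ z, h z • ev A z ∂(leb Ω)) = ∫ z, Γ (ev A z) * h z ∂(leb Ω) := by
    rw [← Γ.integral_comp_comm hint]
    simp only [map_smul, smul_eq_mul, mul_comm]
  have hzero : ∫ z, h z • ev A z ∂(leb Ω) = 0 := by
    ext ψ
    exact (hcomp (BoundedContinuousFunction.evalCLM ℂ ψ)).trans (hh ψ.fn ψ.mem)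
  apply hφh
  rw [pairing_apply, ← map_zero Λ, ← hzero, hcomp]

end WeakStarDuality

section BergmanFactorization

variable {A : Subalgebra ℂ (HInfty Ω)}

theorem exists_unitBall_eq_mul {φ : HInfty Ω} (hφ : φ ∈ A) {s : ℝ}
    (hs : ∀ z, ‖(φ : Ω → ℂ) z‖ ≤ s) :
    ∃ ψ : UnitBall A, ∀ z, (φ : Ω → ℂ) z = s * (ψ.fn : Ω → ℂ) z := by
  have hnorm (z : Ω) : ‖((s : ℂ)⁻¹ • φ : HInfty Ω).1 z‖ = ‖(φ : Ω → ℂ) z‖ / |s| := by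
    rw [Subalgebra.coe_smul, Pi.smul_apply, norm_smul, norm_inv, Complex.norm_real,
      Real.norm_eq_abs, inv_mul_eq_div]
  refine ⟨⟨(s : ℂ)⁻¹ • φ, A.smul_mem hφ _, fun z => ?_⟩, fun z => ?_⟩
  · rw [hnorm]
    exact div_le_one_of_le₀ ((hs z).trans (le_abs_self s)) (abs_nonneg s)
  · rcases eq_or_ne s 0 with rfl | hs₀
    · simpa using hs z
    · exact (mul_inv_cancel_left₀ (Complex.ofReal_ne_zero.2 hs₀) _).symm

theorem isNorming_evField (hΩ : IsOpen Ω) (hne : Ω.Nonempty)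
    (hA : IsClosed[weakStar Ω] (A : Set (HInfty Ω))) : (evField A hΩ).IsNorming := by
  intro Λ s hs y hy
  obtain ⟨φ, hφ, hφΛ⟩ := exists_mem_forall_eq_clm_ev hΩ hA Λ
  obtain ⟨ψ, hψ⟩ := exists_unitBall_eq_mul hφ fun z => (hφΛ z).symm ▸ hs z
  have heq : Λ y = (s : ℂ) • BoundedContinuousFunction.evalCLM ℂ ψ y := by
    refine ContinuousLinearMap.eqOn_closure_span (g := (s : ℂ) • _) ?_ hy
    rintro _ ⟨z, rfl⟩
    exact (hφΛ z).symm.trans (hψ z)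
  obtain ⟨x, hx⟩ := hne
  have hs₀ : 0 ≤ s := (norm_nonneg _).trans (hs ⟨x, hx⟩)
  rw [heq, norm_smul, Complex.norm_real, Real.norm_of_nonneg hs₀]
  exact mul_le_mul_of_nonneg_left (y.norm_coe_le_norm ψ) hs₀

theorem ev_mem_approxFactor [Nonempty (Fin d)] (hΩ : IsOpen Ω) (hc : IsConnected Ω)
    (hb : Bornology.IsBounded Ω) (z : Ω) :
    ev A z ∈ ApproxFactor (Berg Ω) (evField A hΩ) := by
  have : LocallyCompactSpace Ω := hΩ.locallyCompactSpace
  refine mem_approxFactor_of_energyApprox (e := evField A hΩ) (by norm_num : (0 : ℝ) < 1 / 24)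
    (fun x => momentPair_mem_energyApprox fun K hK ε hε =>
      mem_closure_convexHull_rankOne _ fun Λ => ?_) z
  exact exists_mem_unitVectorsOff_berg hΩ hc hb (holo_clm_ev A hΩ Λ) (norm_clm_ev_le A Λ) hK x hε

theorem exists_eq_smul_ev_of_mem_span [IsEmpty (Fin d)] (p : Ω) {y : UnitBall A →ᵇ ℂ}
    (hy : y ∈ Submodule.span ℂ (Set.range (ev A))) : ∃ c : ℂ, c • ev A p = y := by
  refine Submodule.mem_span_singleton.1 (Submodule.span_mono ?_ hy)
  rintro _ ⟨z, rfl⟩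
  exact congrArg (ev A) (Subsingleton.elim z p)

theorem exists_berg_norm_eq_one (hΩ : IsOpen Ω) (hb : Bornology.IsBounded Ω) (hne : Ω.Nonempty) :
    ∃ u ∈ Berg Ω, ‖u‖ = 1 := by
  have := isFiniteMeasure_leb hΩ hb
  have := isOpenPosMeasure_leb hΩ
  have := hne.to_subtype
  have hone : Lp.const 2 (leb Ω) (1 : ℂ) ∈ Berg Ω := ⟨_, holo_const 1, Lp.coeFn_const 2 (leb Ω) 1⟩
  have hnorm : ‖Lp.const 2 (leb Ω) (1 : ℂ)‖ ≠ 0 := by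
    rw [Lp.norm_const 2 _ _ two_ne_zero, norm_one, one_mul]
    exact (Real.rpow_pos_of_pos measureReal_univ_pos _).ne'
  refine ⟨(‖Lp.const 2 (leb Ω) (1 : ℂ)‖ : ℂ)⁻¹ • Lp.const 2 (leb Ω) 1,
    Submodule.smul_mem _ _ hone, ?_⟩
  rw [norm_smul, norm_inv, Complex.norm_real, norm_norm, inv_mul_cancel₀ hnorm]

theorem rankOne_self_eq_of_isEmpty [IsEmpty (Fin d)] (hΩ : IsOpen Ω) (p : Ω)
    (u : Lp ℂ 2 (leb Ω)) : rankOne (evField A hΩ) u u = (‖u‖ ^ 2) • ev A p := by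
  have hev (x : Ω) : evField A hΩ x = ev A p := congrArg (ev A) (Subsingleton.elim x p)
  simp only [rankOne_apply, hev, mul_conj_smul_eq]
  rw [integral_smul_const, norm_sq_eq_integral]

/- In dimension zero `Ω` is a point, so `y` is a multiple of its evaluation, and the value of `y` at
the function `1` bounds the coefficient. -/
theorem exists_rankOne_eq_of_isEmpty [IsEmpty (Fin d)] (hΩ : IsOpen Ω)
    (hb : Bornology.IsBounded Ω) (p : Ω) {y : UnitBall A →ᵇ ℂ}
    (hy : y ∈ Submodule.span ℂ (Set.range (ev A))) (hy₁ : ‖y‖ ≤ 1) :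
    ∃ f ∈ Berg Ω, ∃ g ∈ Berg Ω, ‖f‖ ≤ 1 ∧ ‖g‖ ≤ 1 ∧ rankOne (evField A hΩ) f g = y := by
  obtain ⟨c, rfl⟩ := exists_eq_smul_ev_of_mem_span p hy
  obtain ⟨u, hu, hu₁⟩ := exists_berg_norm_eq_one hΩ hb ⟨p, p.2⟩
  have hc : ‖c‖ ≤ 1 := by
    let one : UnitBall A := ⟨1, A.one_mem, fun _ => (norm_one (α := ℂ)).le⟩
    have hone : (c • ev A p) one = c := mul_one c
    exact hone ▸ ((c • ev A p).norm_coe_le_norm one).trans hy₁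
  refine ⟨c • u, Submodule.smul_mem _ _ hu, u, hu, ?_, hu₁.le, ?_⟩
  · rwa [norm_smul, hu₁, mul_one]
  · rw [map_smul, smul_apply, rankOne_self_eq_of_isEmpty hΩ p, hu₁, one_pow, one_smul]

theorem exists_berg_rankOne_eq (hΩ : IsOpen Ω) (hc : IsConnected Ω) (hb : Bornology.IsBounded Ω)
    (hA : IsClosed[weakStar Ω] (A : Set (HInfty Ω))) {y : UnitBall A →ᵇ ℂ}
    (hy : y ∈ Submodule.span ℂ (Set.range (ev A))) (hy₁ : ‖y‖ ≤ 1) {ε : ℝ} (hε : 0 < ε) :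
    ∃ f ∈ Berg Ω, ∃ g ∈ Berg Ω, ‖f‖ ≤ 1 + ε ∧ ‖g‖ ≤ 1 + ε ∧
      rankOne (evField A hΩ) f g = y := by
  rcases isEmpty_or_nonempty (Fin d) with _ | _
  · obtain ⟨p, hp⟩ := hc.nonempty
    obtain ⟨f, hf, g, hg, hfn, hgn, hfg⟩ := exists_rankOne_eq_of_isEmpty hΩ hb ⟨p, hp⟩ hy hy₁
    exact ⟨f, hf, g, hg, hfn.trans (by linarith), hgn.trans (by linarith), hfg⟩
  · exact exists_rankOne_eq (isClosed_berg hΩ hb) (isNorming_evField hΩ hc.nonempty hA)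
      (ev_mem_approxFactor hΩ hc hb) (Submodule.le_topologicalClosure _ hy) hy₁ hε

end BergmanFactorization

section LinearAlgebra

theorem exists_clm_comp_eq {V E : Type*} [AddCommGroup V] [Module ℂ V] [NormedAddCommGroup E]
    [NormedSpace ℂ E] (T : V →ₗ[ℂ] E) (ℓ : V →ₗ[ℂ] ℂ) {C : ℝ} (hC : 0 ≤ C)
    (h : ∀ v, ‖ℓ v‖ ≤ C * ‖T v‖) : ∃ Λ : E →L[ℂ] ℂ, ‖Λ‖ ≤ C ∧ ∀ v, Λ (T v) = ℓ v := by
  obtain ⟨σ, hσ⟩ :=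
    T.rangeRestrict.exists_rightInverse_of_surjective (LinearMap.range_rangeRestrict T)
  have hTσ (u : LinearMap.range T) : T (σ u) = u := congrArg Subtype.val (LinearMap.congr_fun hσ u)
  have hbound (u : LinearMap.range T) : ‖(ℓ.comp σ) u‖ ≤ C * ‖u‖ := by
    simpa only [hTσ, LinearMap.comp_apply, Submodule.coe_norm] using h (σ u)
  obtain ⟨Λ, hΛ, hΛ_norm⟩ := exists_extension_norm_eq (LinearMap.range T)
    ((ℓ.comp σ).mkContinuous C hbound)
  refine ⟨Λ, hΛ_norm.le.trans (LinearMap.mkContinuous_norm_le _ hC _), fun v => ?_⟩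
  have hker : ℓ (σ ⟨T v, v, rfl⟩ - v) = 0 := by
    simpa only [map_sub T, hTσ, sub_self, norm_zero, mul_zero, norm_le_zero_iff] using
      h (σ ⟨T v, v, rfl⟩ - v)
  exact (hΛ ⟨T v, v, rfl⟩).trans (sub_eq_zero.1 ((map_sub ℓ _ _).symm.trans hker))

variable {ι H : Type*} [Fintype ι] [NormedAddCommGroup H] [InnerProductSpace ℂ H]

theorem ofReal_norm_sq_sum_smul (k : ι → H) (x : ι → ℂ) :
    ((‖∑ j, x j • k j‖ ^ 2 : ℝ) : ℂ) = ∑ i, ∑ j, conj (x i) * (x j * inner ℂ (k i) (k j)) := by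
  rw [Complex.ofReal_pow]
  refine (inner_self_eq_norm_sq_to_K (𝕜 := ℂ) (∑ j, x j • k j)).symm.trans ?_
  simp only [sum_inner, inner_sum, inner_smul_left, inner_smul_right, Finset.mul_sum]
  rw [Finset.sum_comm]
  exact Finset.sum_congr rfl fun i _ => Finset.sum_congr rfl fun j _ => by ring

theorem posSemidef_gram_sub_iff (w : ι → ℂ) (k : ι → H) :
    (Matrix.of fun i j => (1 - w i * conj (w j)) * inner ℂ (k i) (k j)).PosSemidef ↔
      ∀ x : ι → ℂ, ‖∑ j, (x j * conj (w j)) • k j‖ ≤ ‖∑ j, x j • k j‖ := by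
  set M := Matrix.of fun i j => (1 - w i * conj (w j)) * inner ℂ (k i) (k j) with hM
  have hherm : M.IsHermitian := by
    ext i j
    simp [hM, mul_comm]
  have hquad (x : ι → ℂ) : star x ⬝ᵥ (M.mulVec x) =
      ((‖∑ j, x j • k j‖ ^ 2 - ‖∑ j, (x j * conj (w j)) • k j‖ ^ 2 : ℝ) : ℂ) := by
    rw [Complex.ofReal_sub, ofReal_norm_sq_sum_smul, ofReal_norm_sq_sum_smul,
      ← Finset.sum_sub_distrib]
    refine Finset.sum_congr rfl fun i _ => ?_
    rw [Matrix.mulVec, dotProduct, Finset.mul_sum, ← Finset.sum_sub_distrib]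
    refine Finset.sum_congr rfl fun j _ => ?_
    simp only [hM, Matrix.of_apply, Pi.star_apply, RCLike.star_def, map_mul, Complex.conj_conj]
    ring
  simp only [Matrix.posSemidef_iff_dotProduct_mulVec, hherm, true_and, hquad,
    Complex.zero_le_real, sub_nonneg]
  exact forall_congr' fun x => sq_le_sq₀ (norm_nonneg _) (norm_nonneg _)

end LinearAlgebra

section ReproducingKernel

variable {A : Subalgebra ℂ (HInfty Ω)} {ν : Measure Ω} {z : Ω}

theorem kernelAt_mem_A2 (z : Ω) : kernelAt A ν z ∈ A2 A ν := by
  unfold kernelAt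
  split_ifs with h
  · exact h.choose_spec.1
  · exact zero_mem _

theorem kernelAt_eq_zero (h : ¬∃ k, Reproduces A ν z k) : kernelAt A ν z = 0 := by
  unfold kernelAt
  rw [dif_neg h]

theorem memLp_HInfty (ν : Measure Ω) [IsFiniteMeasure ν] (φ : HInfty Ω) :
    MemLp (φ : Ω → ℂ) 2 ν := by
  obtain ⟨hφ, C, hC⟩ := φ.2
  exact MemLp.of_bound hφ.continuous.aestronglyMeasurable C (ae_of_all _ hC)

/-- The class of a bounded holomorphic function in `L²(ν)`. -/
def toL2 (ν : Measure Ω) [IsFiniteMeasure ν] : HInfty Ω →ₗ[ℂ] Lp ℂ 2 ν where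
  toFun φ := (memLp_HInfty ν φ).toLp _
  map_add' _ _ := rfl
  map_smul' _ _ := rfl

variable (ν) [IsFiniteMeasure ν]

theorem coeFn_toL2 (φ : HInfty Ω) : ⇑(toL2 ν φ) =ᵐ[ν] (φ : Ω → ℂ) :=
  (memLp_HInfty ν φ).coeFn_toLp

theorem norm_toL2_mul_le (χ φ : HInfty Ω) {C : ℝ} (hC : ∀ x, ‖(χ : Ω → ℂ) x‖ ≤ C) :
    ‖toL2 ν (χ * φ)‖ ≤ C * ‖toL2 ν φ‖ := by
  refine Lp.norm_le_mul_norm_of_ae_le_mul ?_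
  filter_upwards [coeFn_toL2 ν (χ * φ), coeFn_toL2 ν φ] with x hχφ hφ
  rw [hχφ, hφ, Subalgebra.coe_mul, Pi.mul_apply, norm_mul]
  exact mul_le_mul_of_nonneg_right (hC x) (norm_nonneg _)

theorem toL2_mem_A2 {φ : HInfty Ω} (hφ : φ ∈ A) : toL2 ν φ ∈ A2 A ν :=
  Submodule.le_topologicalClosure _ ⟨φ, hφ, coeFn_toL2 ν φ⟩

theorem eq_toL2 {g : Lp ℂ 2 ν} {φ : HInfty Ω} (h : ⇑g =ᵐ[ν] (φ : Ω → ℂ)) : g = toL2 ν φ :=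
  Lp.ext (h.trans (coeFn_toL2 ν φ).symm)

variable {ν}

theorem reproduces_iff {k : Lp ℂ 2 ν} :
    Reproduces A ν z k ↔
      k ∈ A2 A ν ∧ ∀ φ ∈ A, inner ℂ k (toL2 ν φ) = (φ : Ω → ℂ) z := by
  refine and_congr_right fun _ => ⟨fun h φ hφ => h φ hφ _ (coeFn_toL2 ν φ), fun h φ hφ g hg => ?_⟩
  rw [eq_toL2 ν hg, h φ hφ]

theorem inner_kernelAt_toL2 (h : ∃ k, Reproduces A ν z k) {φ : HInfty Ω} (hφ : φ ∈ A) :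
    inner ℂ (kernelAt A ν z) (toL2 ν φ) = (φ : Ω → ℂ) z := by
  unfold kernelAt
  rw [dif_pos h]
  exact (reproduces_iff.1 h.choose_spec).2 φ hφ

theorem inner_kernelAt_toL2_mul (z : Ω) {φ ψ : HInfty Ω} (hφ : φ ∈ A) (hψ : ψ ∈ A) :
    inner ℂ (kernelAt A ν z) (toL2 ν (φ * ψ)) =
      (φ : Ω → ℂ) z * inner ℂ (kernelAt A ν z) (toL2 ν ψ) := by
  by_cases h : ∃ k, Reproduces A ν z k
  · rw [inner_kernelAt_toL2 h hψ, inner_kernelAt_toL2 h (A.mul_mem hφ hψ)]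
    rfl
  · rw [kernelAt_eq_zero h, inner_zero_left, inner_zero_left, mul_zero]

theorem norm_le_of_forall_norm_inner_toL2_le {v : Lp ℂ 2 ν} (hv : v ∈ A2 A ν) {C : ℝ}
    (hC : 0 ≤ C) (h : ∀ φ ∈ A, ‖inner ℂ v (toL2 ν φ)‖ ≤ C * ‖toL2 ν φ‖) : ‖v‖ ≤ C := by
  have hclosed : IsClosed {g : Lp ℂ 2 ν | ‖inner ℂ v g‖ ≤ C * ‖g‖} :=
    isClosed_le (by fun_prop) (by fun_prop)
  have hsub : (classes A ν : Set (Lp ℂ 2 ν)) ⊆ {g : Lp ℂ 2 ν | ‖inner ℂ v g‖ ≤ C * ‖g‖} := by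
    rintro g ⟨φ, hφ, hg⟩
    rw [eq_toL2 ν hg]
    exact h φ hφ
  have hself : ‖v‖ * ‖v‖ ≤ C * ‖v‖ := by
    simpa only [Set.mem_ofPred_eq, ← inner_self_re_eq_norm, inner_self_eq_norm_mul_norm] using
      closure_minimal hsub hclosed hv
  rcases (norm_nonneg v).eq_or_lt with hv₀ | hv₀
  · exact hv₀ ▸ hC
  · exact le_of_mul_le_mul_right hself hv₀

theorem eq_zero_of_forall_inner_toL2 {v : Lp ℂ 2 ν} (hv : v ∈ A2 A ν)
    (h : ∀ φ ∈ A, inner ℂ v (toL2 ν φ) = 0) : v = 0 :=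
  norm_le_zero_iff.1 <| norm_le_of_forall_norm_inner_toL2_le hv le_rfl fun φ hφ => by
    rw [h φ hφ, norm_zero, zero_mul]

end ReproducingKernel

section L2Bounded

variable {A : Subalgebra ℂ (HInfty Ω)} {ν : Measure Ω} [IsFiniteMeasure ν] {ℓ : HInfty Ω → ℂ}

/-- Boundedness of a functional on `A` with respect to the norm of `L²(ν)`, that is, of one that
extends continuously to `A²(ν)`. -/
def L2Bounded (A : Subalgebra ℂ (HInfty Ω)) (ν : Measure Ω) [IsFiniteMeasure ν]
    (ℓ : HInfty Ω → ℂ) : Prop :=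
  ∃ C : ℝ, 0 ≤ C ∧ ∀ φ ∈ A, ‖ℓ φ‖ ≤ C * ‖toL2 ν φ‖

theorem l2Bounded_inner (G : Lp ℂ 2 ν) : L2Bounded A ν fun φ => inner ℂ G (toL2 ν φ) :=
  ⟨‖G‖, norm_nonneg G, fun _ _ => norm_inner_le_norm _ _⟩

theorem L2Bounded.congr (h : L2Bounded A ν ℓ) {ℓ' : HInfty Ω → ℂ} (heq : ∀ φ ∈ A, ℓ φ = ℓ' φ) :
    L2Bounded A ν ℓ' :=
  let ⟨C, hC, hbound⟩ := h
  ⟨C, hC, fun φ hφ => heq φ hφ ▸ hbound φ hφ⟩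

theorem L2Bounded.const_mul (h : L2Bounded A ν ℓ) (c : ℂ) : L2Bounded A ν fun φ => c * ℓ φ := by
  obtain ⟨C, hC, hbound⟩ := h
  refine ⟨‖c‖ * C, by positivity, fun φ hφ => ?_⟩
  rw [norm_mul, mul_assoc]
  exact mul_le_mul_of_nonneg_left (hbound φ hφ) (norm_nonneg c)

theorem L2Bounded.comp_mul (h : L2Bounded A ν ℓ) {χ : HInfty Ω} (hχ : χ ∈ A) :
    L2Bounded A ν fun φ => ℓ (χ * φ) := by
  obtain ⟨C, hC, hbound⟩ := h
  obtain ⟨D, hD⟩ := χ.2.2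
  refine ⟨C * |D|, by positivity, fun φ hφ => (hbound _ (A.mul_mem hχ hφ)).trans ?_⟩
  rw [mul_assoc]
  exact mul_le_mul_of_nonneg_left
    (norm_toL2_mul_le ν χ φ fun x => (hD x).trans (le_abs_self D)) hC

theorem L2Bounded.exists_reproduces {z : Ω} (h : L2Bounded A ν fun φ => (φ : Ω → ℂ) z) :
    ∃ k, Reproduces A ν z k := by
  obtain ⟨C, hC, hbound⟩ := h
  let evalAt : Subalgebra.toSubmodule A →ₗ[ℂ] ℂ :=
    { toFun := fun φ => ((φ : HInfty Ω) : Ω → ℂ) z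
      map_add' := fun _ _ => rfl
      map_smul' := fun _ _ => rfl }
  obtain ⟨Λ, -, hΛ⟩ := exists_clm_comp_eq (V := Subalgebra.toSubmodule A)
    ((toL2 ν).comp (Subalgebra.toSubmodule A).subtype) evalAt hC fun φ => hbound φ φ.2
  have : CompleteSpace (A2 A ν) := (Submodule.isClosed_topologicalClosure _).completeSpace_coe
  set k := (InnerProductSpace.toDual ℂ (Lp ℂ 2 ν)).symm Λ with hk
  refine ⟨(A2 A ν).starProjection k, reproduces_iff.2 ⟨Submodule.starProjection_apply_mem _ _,
    fun φ hφ => ?_⟩⟩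
  rw [Submodule.inner_starProjection_left_eq_right,
    Submodule.starProjection_eq_self_iff.2 (toL2_mem_A2 ν hφ), hk,
    InnerProductSpace.toDual_symm_apply]
  exact hΛ ⟨φ, hφ⟩

variable {ι : Type*} {z : ι → Ω} {T : Finset ι} {a : ι → ℂ}

theorem sum_eq_zero_of_forall_apply_eq (hT : ∀ i ∈ T, ¬∃ k, Reproduces A ν (z i) k)
    (h : L2Bounded A ν fun φ => ∑ i ∈ T, a i * (φ : Ω → ℂ) (z i))
    (heq : ∀ χ ∈ A, ∀ i ∈ T, ∀ l ∈ T, (χ : Ω → ℂ) (z i) = (χ : Ω → ℂ) (z l)) :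
    ∑ i ∈ T, a i = 0 := by
  rcases T.eq_empty_or_nonempty with rfl | ⟨l, hl⟩
  · exact Finset.sum_empty
  by_contra hne
  refine hT l hl ((h.const_mul (∑ i ∈ T, a i)⁻¹).congr fun φ hφ => ?_).exists_reproduces
  have hfactor : ∑ i ∈ T, a i * (φ : Ω → ℂ) (z i) = (∑ i ∈ T, a i) * (φ : Ω → ℂ) (z l) := by
    rw [Finset.sum_mul]
    exact Finset.sum_congr rfl fun i hi => by rw [heq φ hφ i hi l hl]
  rw [hfactor, inv_mul_cancel_left₀ hne]

theorem L2Bounded.sum_erase [DecidableEq ι]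
    (h : L2Bounded A ν fun φ => ∑ i ∈ T, a i * (φ : Ω → ℂ) (z i)) {χ : HInfty Ω} (hχ : χ ∈ A)
    (m : ι) : L2Bounded A ν fun φ => ∑ i ∈ T.erase m,
      a i * ((χ : Ω → ℂ) (z i) - (χ : Ω → ℂ) (z m)) * (φ : Ω → ℂ) (z i) := by
  have hχm : χ - algebraMap ℂ (HInfty Ω) ((χ : Ω → ℂ) (z m)) ∈ A :=
    A.sub_mem hχ (A.algebraMap_mem _)
  refine (h.comp_mul hχm).congr fun φ _ => ?_
  rw [Finset.sum_erase _ (by rw [sub_self, mul_zero, zero_mul])]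
  exact Finset.sum_congr rfl fun i _ => (mul_assoc _ _ _).symm

/- If some `χ ∈ A` separates two of the points, say `z i` and `z l`, then multiplication by
`χ - χ (z i)` and by `χ - χ (z l)` removes one point from the sum each time. -/
theorem sum_eq_zero_of_l2Bounded (hT : ∀ i ∈ T, ¬∃ k, Reproduces A ν (z i) k)
    (h : L2Bounded A ν fun φ => ∑ i ∈ T, a i * (φ : Ω → ℂ) (z i)) : ∑ i ∈ T, a i = 0 := by
  classical
  induction T using Finset.strongInduction generalizing a with
  | H T ih =>
    by_cases hsep : ∀ χ ∈ A, ∀ i ∈ T, ∀ l ∈ T, (χ : Ω → ℂ) (z i) = (χ : Ω → ℂ) (z l)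
    · exact sum_eq_zero_of_forall_apply_eq hT h hsep
    push Not at hsep
    obtain ⟨χ, hχ, i, hi, l, hl, hne⟩ := hsep
    have hvanish (m : ι) (hm : m ∈ T) :
        ∑ j ∈ T, a j * ((χ : Ω → ℂ) (z j) - (χ : Ω → ℂ) (z m)) = 0 := by
      rw [← Finset.sum_erase T (a := m) (by rw [sub_self, mul_zero])]
      exact ih _ (Finset.erase_ssubset hm) (fun j hj => hT j (Finset.mem_of_mem_erase hj))
        (h.sum_erase hχ m)
    have hmul : (∑ j ∈ T, a j) * ((χ : Ω → ℂ) (z i) - (χ : Ω → ℂ) (z l)) = 0 := by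
      rw [← sub_eq_zero.2 ((hvanish l hl).trans (hvanish i hi).symm), Finset.sum_mul,
        ← Finset.sum_sub_distrib]
      exact Finset.sum_congr rfl fun j _ => by ring
    exact (mul_eq_zero.1 hmul).resolve_right (sub_ne_zero.2 hne)

theorem sum_mul_eq_zero_of_l2Bounded (hT : ∀ i ∈ T, ¬∃ k, Reproduces A ν (z i) k)
    (h : L2Bounded A ν fun φ => ∑ i ∈ T, a i * (φ : Ω → ℂ) (z i)) {φ : HInfty Ω} (hφ : φ ∈ A) :
    ∑ i ∈ T, a i * (φ : Ω → ℂ) (z i) = 0 :=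
  sum_eq_zero_of_l2Bounded hT <| (h.comp_mul hφ).congr fun _ _ =>
    Finset.sum_congr rfl fun _ _ => (mul_assoc _ _ _).symm

end L2Bounded

section PickMatrix

variable {A : Subalgebra ℂ (HInfty Ω)} {ν : Measure Ω} {ι : Type*} [Fintype ι] {z : ι → Ω}
  {w c : ι → ℂ}

/-- The Pick matrix `[(1 - wᵢ w̄ⱼ) k^ν(zᵢ, zⱼ)]` of the interpolation problem `zᵢ ↦ wᵢ`. -/
def pickMatrix (A : Subalgebra ℂ (HInfty Ω)) (ν : Measure Ω) {ι : Type*} (z : ι → Ω)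
    (w : ι → ℂ) : Matrix ι ι ℂ :=
  Matrix.of fun i j => (1 - w i * conj (w j)) * kernel A ν (z i) (z j)

/-- The vector `∑ c̄ⱼ k_{zⱼ}`, which represents the functional `φ ↦ ∑ cⱼ φ(zⱼ)` when all the
evaluations at the nodes are bounded. -/
def kernelSum (A : Subalgebra ℂ (HInfty Ω)) (ν : Measure Ω) (z : ι → Ω) (c : ι → ℂ) :
    Lp ℂ 2 ν :=
  ∑ j, conj (c j) • kernelAt A ν (z j)

theorem kernelSum_mem_A2 : kernelSum A ν z c ∈ A2 A ν :=
  sum_mem fun j _ => Submodule.smul_mem _ _ (kernelAt_mem_A2 (z j))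

theorem inner_kernelSum (g : Lp ℂ 2 ν) :
    inner ℂ (kernelSum A ν z c) g = ∑ j, c j * inner ℂ (kernelAt A ν (z j)) g := by
  simp only [kernelSum, sum_inner, inner_smul_left, Complex.conj_conj]

theorem posSemidef_pickMatrix_iff :
    (pickMatrix A ν z w).PosSemidef ↔
      ∀ c, ‖kernelSum A ν z (c * w)‖ ≤ ‖kernelSum A ν z c‖ := by
  refine (posSemidef_gram_sub_iff w fun j => kernelAt A ν (z j)).trans ?_
  rw [(star_involutive (R := ι → ℂ)).surjective.forall]
  simp only [kernelSum, Pi.mul_apply, map_mul]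
  rfl

variable [IsFiniteMeasure ν]

omit [Fintype ι] in
theorem posSemidef_pickMatrix_of_norm_le_one [Finite ι] {φ : HInfty Ω} (hφ : φ ∈ A)
    (hφ₁ : ∀ x, ‖(φ : Ω → ℂ) x‖ ≤ 1) :
    (pickMatrix A ν z fun i => (φ : Ω → ℂ) (z i)).PosSemidef := by
  cases nonempty_fintype ι
  refine posSemidef_pickMatrix_iff.2 fun c =>
    norm_le_of_forall_norm_inner_toL2_le kernelSum_mem_A2 (norm_nonneg _) fun ψ hψ => ?_
  calc ‖inner ℂ (kernelSum A ν z (c * fun i => (φ : Ω → ℂ) (z i))) (toL2 ν ψ)‖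
      = ‖inner ℂ (kernelSum A ν z c) (toL2 ν (φ * ψ))‖ := by
        simp only [inner_kernelSum, inner_kernelAt_toL2_mul _ hφ hψ, Pi.mul_apply, mul_assoc]
    _ ≤ ‖kernelSum A ν z c‖ * ‖toL2 ν (φ * ψ)‖ := norm_inner_le_norm _ _
    _ ≤ ‖kernelSum A ν z c‖ * ‖toL2 ν ψ‖ := by
        gcongr
        simpa only [one_mul] using norm_toL2_mul_le ν φ ψ hφ₁

theorem inner_kernelSum_toL2 (h : ∀ i, ∃ k, Reproduces A ν (z i) k) {φ : HInfty Ω} (hφ : φ ∈ A) :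
    inner ℂ (kernelSum A ν z c) (toL2 ν φ) = ∑ i, c i * (φ : Ω → ℂ) (z i) := by
  simp only [inner_kernelSum, inner_kernelAt_toL2 (h _) hφ]

theorem sum_mul_eq_zero_of_posSemidef (h : ∀ i, ∃ k, Reproduces A ν (z i) k)
    (H : (pickMatrix A ν z w).PosSemidef) (hc : ∀ φ ∈ A, ∑ i, c i * (φ : Ω → ℂ) (z i) = 0) :
    ∑ i, c i * w i = 0 := by
  have hzero : kernelSum A ν z c = 0 := eq_zero_of_forall_inner_toL2 kernelSum_mem_A2
    fun φ hφ => (inner_kernelSum_toL2 h hφ).trans (hc φ hφ)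
  have hzero' : kernelSum A ν z (c * w) = 0 :=
    norm_le_zero_iff.1 ((posSemidef_pickMatrix_iff.1 H c).trans_eq (by rw [hzero, norm_zero]))
  calc ∑ i, c i * w i = ∑ i, (c * w) i * ((1 : HInfty Ω) : Ω → ℂ) (z i) :=
        Finset.sum_congr rfl fun i _ => (mul_one _).symm
    _ = inner ℂ (kernelSum A ν z (c * w)) (toL2 ν 1) := (inner_kernelSum_toL2 h A.one_mem).symm
    _ = 0 := by rw [hzero', inner_zero_left]

open Classical in
theorem inner_kernelSum_toL2_eq_sum_filter {φ : HInfty Ω} (hφ : φ ∈ A) :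
    inner ℂ (kernelSum A ν z c) (toL2 ν φ) =
      ∑ i with ∃ k, Reproduces A ν (z i) k, c i * (φ : Ω → ℂ) (z i) := by
  rw [inner_kernelSum, Finset.sum_filter]
  refine Finset.sum_congr rfl fun i _ => ?_
  split_ifs with hi
  · rw [inner_kernelAt_toL2 hi hφ]
  · rw [kernelAt_eq_zero hi, inner_zero_left, mul_zero]

open Classical in
theorem sum_filter_not_reproduces_eq_zero {G : Lp ℂ 2 ν}
    (hG : ∀ φ ∈ A, inner ℂ G (toL2 ν φ) = ∑ i, c i * (φ : Ω → ℂ) (z i)) {φ : HInfty Ω}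
    (hφ : φ ∈ A) : ∑ i with ¬∃ k, Reproduces A ν (z i) k, c i * (φ : Ω → ℂ) (z i) = 0 := by
  refine sum_mul_eq_zero_of_l2Bounded (ν := ν) (fun i hi => (Finset.mem_filter.1 hi).2)
    ((l2Bounded_inner (G - kernelSum A ν z c)).congr fun ψ hψ => ?_) hφ
  rw [inner_sub_left, hG ψ hψ, inner_kernelSum_toL2_eq_sum_filter hψ, sub_eq_iff_eq_add',
    Finset.sum_filter_add_sum_filter_not]

/- The unbounded evaluations cancel out of the functional represented by `G`. The measure `ν₀`, for
which all evaluations are bounded, makes them cancel out of `∑ cᵢ wᵢ` as well. -/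
theorem norm_sum_mul_le_of_posSemidef {ν₀ : Measure Ω} [IsFiniteMeasure ν₀]
    (h₀ : ∀ i, ∃ k, Reproduces A ν₀ (z i) k) (H₀ : (pickMatrix A ν₀ z w).PosSemidef)
    (H : (pickMatrix A ν z w).PosSemidef) {G : Lp ℂ 2 ν}
    (hG : ∀ φ ∈ A, inner ℂ G (toL2 ν φ) = ∑ i, c i * (φ : Ω → ℂ) (z i)) :
    ‖∑ i, c i * w i‖ ≤ ‖G‖ * ‖toL2 ν 1‖ := by
  classical
  have hunbounded : ∑ i with ¬∃ k, Reproduces A ν (z i) k, c i * w i = 0 := by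
    simpa only [ite_mul, zero_mul, ← Finset.sum_filter] using
      sum_mul_eq_zero_of_posSemidef (c := fun i => if ¬∃ k, Reproduces A ν (z i) k then c i else 0)
        h₀ H₀ fun φ hφ => by
          simpa only [ite_mul, zero_mul, ← Finset.sum_filter] using
            sum_filter_not_reproduces_eq_zero hG hφ
  have hnorm : ‖kernelSum A ν z c‖ ≤ ‖G‖ := by
    refine norm_le_of_forall_norm_inner_toL2_le kernelSum_mem_A2 (norm_nonneg G) fun φ hφ => ?_
    rw [inner_kernelSum_toL2_eq_sum_filter hφ, ← add_zero (Finset.sum _ _),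
      ← sum_filter_not_reproduces_eq_zero hG hφ, Finset.sum_filter_add_sum_filter_not, ← hG φ hφ]
    exact norm_inner_le_norm _ _
  have hpair : inner ℂ (kernelSum A ν z (c * w)) (toL2 ν 1) = ∑ i, c i * w i := by
    rw [inner_kernelSum_toL2_eq_sum_filter A.one_mem, ← Finset.sum_filter_add_sum_filter_not
      Finset.univ (fun i => ∃ k, Reproduces A ν (z i) k) fun i => c i * w i, hunbounded, add_zero]
    exact Finset.sum_congr rfl fun i _ => mul_one _
  rw [← hpair]
  refine (norm_inner_le_norm _ _).trans (mul_le_mul_of_nonneg_right ?_ (norm_nonneg _))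
  exact (posSemidef_pickMatrix_iff.1 H c).trans hnorm

end PickMatrix

section SqMeasure

variable {A : Subalgebra ℂ (HInfty Ω)}

theorem sqMeasure_one : sqMeasure (fun _ : Ω => (1 : ℂ)) = leb Ω := by
  simp [sqMeasure]

theorem exists_reproduces_leb (hΩ : IsOpen Ω) (hb : Bornology.IsBounded Ω)
    [IsFiniteMeasure (leb Ω)] (z : Ω) : ∃ k, Reproduces A (leb Ω) z k := by
  obtain ⟨r, hr, -, C, hC, hbound⟩ := exists_norm_le_mul_norm hΩ hb z.2
  refine L2Bounded.exists_reproduces ⟨C, hC, fun φ _ => ?_⟩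
  obtain ⟨F, hF, hFφ⟩ := φ.2.1
  simpa only [hFφ] using hbound _ F hF
    ((coeFn_toL2 _ φ).trans (ae_of_all _ fun x => (hFφ x).symm)) z (mem_ball_self hr)

theorem isFiniteMeasure_sqMeasure {f : Ω → ℂ} (hf : MemLp f 2 (leb Ω)) :
    IsFiniteMeasure (sqMeasure f) := by
  refine isFiniteMeasure_withDensity ?_
  simpa using
    (lintegral_rpow_enorm_lt_top_of_eLpNorm_lt_top two_ne_zero ENNReal.ofNat_ne_top hf.2).ne

theorem norm_sq_mul_norm_div_sq_le (a b : ℂ) : ‖b‖ ^ 2 * ‖a / b‖ ^ 2 ≤ ‖a‖ ^ 2 := by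
  rcases eq_or_ne b 0 with rfl | hb
  · simp
  · rw [norm_div, div_pow, mul_div_cancel₀ _ (pow_ne_zero 2 (norm_ne_zero_iff.2 hb))]

theorem norm_sq_smul_conj_div_mul (a b c : ℂ) :
    (‖b‖ ^ 2 : ℝ) • (conj (a / b) * c) = b * conj a * c := by
  rcases eq_or_ne b 0 with rfl | hb
  · simp
  · have hconj : conj b ≠ 0 := (map_ne_zero _).2 hb
    rw [Complex.real_smul, Complex.ofReal_pow, ← Complex.mul_conj', map_div₀]
    field_simp

variable {F : Ω → ℂ} (hF : Continuous F)
include hF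

theorem integral_sqMeasure {E : Type*} [NormedAddCommGroup E] [NormedSpace ℝ E] (h : Ω → E) :
    ∫ x, h x ∂(sqMeasure F) = ∫ x, ‖F x‖ ^ 2 • h x ∂(leb Ω) := by
  rw [sqMeasure, integral_withDensity_eq_integral_toReal_smul (hF.enorm.measurable.pow_const 2)
    (ae_of_all _ fun x => ENNReal.pow_lt_top enorm_lt_top)]
  simp only [ENNReal.toReal_pow, toReal_enorm]

theorem integrable_sqMeasure_iff {E : Type*} [NormedAddCommGroup E] [NormedSpace ℝ E]
    {h : Ω → E} :
    Integrable h (sqMeasure F) ↔ Integrable (fun x => ‖F x‖ ^ 2 • h x) (leb Ω) := by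
  rw [sqMeasure, integrable_withDensity_iff_integrable_smul' (hF.enorm.measurable.pow_const 2)
    (ae_of_all _ fun x => ENNReal.pow_lt_top enorm_lt_top)]
  simp only [ENNReal.toReal_pow, toReal_enorm]

theorem exists_norm_le_ae_eq_div (g : Lp ℂ 2 (leb Ω)) :
    ∃ G : Lp ℂ 2 (sqMeasure F), ‖G‖ ≤ ‖g‖ ∧ ⇑G =ᵐ[sqMeasure F] fun x => g x / F x := by
  have hac : sqMeasure F ≪ leb Ω := withDensity_absolutelyContinuous _ _
  have hmeas : AEStronglyMeasurable (fun x => g x / F x) (leb Ω) :=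
    ((Lp.aestronglyMeasurable g).aemeasurable.div hF.aemeasurable).aestronglyMeasurable
  have hle (x : Ω) : ‖F x‖ ^ 2 • ‖g x / F x‖ ^ 2 ≤ ‖g x‖ ^ 2 := norm_sq_mul_norm_div_sq_le _ _
  have hint : Integrable (fun x => ‖F x‖ ^ 2 • ‖g x / F x‖ ^ 2) (leb Ω) :=
    (integrable_norm_sq g).mono'
      ((hF.norm.pow 2).aestronglyMeasurable.smul (hmeas.norm.pow 2)) <|
      ae_of_all _ fun x => (Real.norm_of_nonneg (by positivity)).trans_le (hle x)
  have hmem : MemLp (fun x => g x / F x) 2 (sqMeasure F) :=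
    (memLp_two_iff_integrable_sq_norm (hmeas.mono_ac hac)).2 ((integrable_sqMeasure_iff hF).2 hint)
  refine ⟨hmem.toLp _, (sq_le_sq₀ (norm_nonneg _) (norm_nonneg _)).1 ?_, hmem.coeFn_toLp⟩
  calc ‖hmem.toLp _‖ ^ 2 = ∫ x, ‖hmem.toLp _ x‖ ^ 2 ∂(sqMeasure F) := norm_sq_eq_integral _
    _ = ∫ x, ‖g x / F x‖ ^ 2 ∂(sqMeasure F) :=
        integral_congr_ae (hmem.coeFn_toLp.mono fun x hx => by simp only [hx])
    _ = ∫ x, ‖F x‖ ^ 2 • ‖g x / F x‖ ^ 2 ∂(leb Ω) := integral_sqMeasure hF _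
    _ ≤ ∫ x, ‖g x‖ ^ 2 ∂(leb Ω) := integral_mono hint (integrable_norm_sq g) hle
    _ = ‖g‖ ^ 2 := (norm_sq_eq_integral g).symm

variable {f : Lp ℂ 2 (leb Ω)} (hfF : ⇑f =ᵐ[leb Ω] F) [IsFiniteMeasure (sqMeasure F)]
include hfF

theorem exists_inner_toL2_eq_rankOne (hΩ : IsOpen Ω) (g : Lp ℂ 2 (leb Ω)) :
    ∃ G : Lp ℂ 2 (sqMeasure F), ‖G‖ ≤ ‖g‖ ∧ ∀ ψ : UnitBall A,
      inner ℂ G (toL2 (sqMeasure F) ψ.fn) = rankOne (evField A hΩ) f g ψ := by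
  obtain ⟨G, hG, hGg⟩ := exists_norm_le_ae_eq_div hF g
  refine ⟨G, hG, fun ψ => ?_⟩
  rw [rankOne_apply_apply, L2.inner_def]
  calc ∫ x, inner ℂ (G x) (toL2 (sqMeasure F) ψ.fn x) ∂(sqMeasure F)
      = ∫ x, conj (g x / F x) * (ψ.fn : Ω → ℂ) x ∂(sqMeasure F) := by
        refine integral_congr_ae ?_
        filter_upwards [hGg, coeFn_toL2 (sqMeasure F) ψ.fn] with x hGx hψx
        rw [hGx, hψx, RCLike.inner_apply, mul_comm]
    _ = ∫ x, ‖F x‖ ^ 2 • (conj (g x / F x) * (ψ.fn : Ω → ℂ) x) ∂(leb Ω) :=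
        integral_sqMeasure hF _
    _ = ∫ x, (f x * conj (g x)) • evField A hΩ x ψ ∂(leb Ω) := by
        refine integral_congr_ae (hfF.mono fun x hx => ?_)
        simp only [hx, norm_sq_smul_conj_div_mul]
        rfl

theorem norm_toL2_one_sqMeasure : ‖toL2 (sqMeasure F) 1‖ = ‖f‖ := by
  refine (sq_eq_sq₀ (norm_nonneg _) (norm_nonneg _)).1 ?_
  calc ‖toL2 (sqMeasure F) 1‖ ^ 2 = ∫ x, ‖toL2 (sqMeasure F) 1 x‖ ^ 2 ∂(sqMeasure F) :=
        norm_sq_eq_integral _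
    _ = ∫ _, (1 : ℝ) ∂(sqMeasure F) :=
        integral_congr_ae ((coeFn_toL2 (sqMeasure F) 1).mono fun x hx => by simp [hx])
    _ = ∫ x, ‖F x‖ ^ 2 • (1 : ℝ) ∂(leb Ω) := integral_sqMeasure hF _
    _ = ∫ x, ‖f x‖ ^ 2 ∂(leb Ω) := integral_congr_ae (hfF.mono fun x hx => by simp [hx])
    _ = ‖f‖ ^ 2 := (norm_sq_eq_integral f).symm

end SqMeasure

section Interpolation

variable {A : Subalgebra ℂ (HInfty Ω)} {ι : Type*} [Fintype ι] {z : ι → Ω} {w c : ι → ℂ}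

theorem inner_toL2_eq_sum_of_unitBall {ν : Measure Ω} [IsFiniteMeasure ν] {G : Lp ℂ 2 ν}
    (h : ∀ ψ : UnitBall A, inner ℂ G (toL2 ν ψ.fn) = (∑ i, c i • ev A (z i)) ψ)
    {φ : HInfty Ω} (hφ : φ ∈ A) : inner ℂ G (toL2 ν φ) = ∑ i, c i * (φ : Ω → ℂ) (z i) := by
  obtain ⟨s, hs⟩ := φ.2.2
  obtain ⟨ψ, hψ⟩ := exists_unitBall_eq_mul hφ hs
  obtain rfl : φ = (s : ℂ) • ψ.fn := Subtype.ext (funext hψ)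
  rw [map_smul, inner_smul_right, h, BoundedContinuousFunction.sum_apply, Finset.mul_sum]
  exact Finset.sum_congr rfl fun i _ => mul_left_comm _ _ _

variable (hΩ : IsOpen Ω) (hc : IsConnected Ω) (hb : Bornology.IsBounded Ω)
  (hA : IsClosed[weakStar Ω] (A : Set (HInfty Ω)))
  (H : ∀ f : Ω → ℂ, MemBergman Ω f → (pickMatrix A (sqMeasure f) z w).PosSemidef)
include hΩ hc hb hA H

theorem norm_sum_mul_le_sq (hy : ‖∑ i, c i • ev A (z i)‖ ≤ 1) {ε : ℝ} (hε : 0 < ε) :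
    ‖∑ i, c i * w i‖ ≤ (1 + ε) * (1 + ε) := by
  have := isFiniteMeasure_leb hΩ hb
  have Hleb : (pickMatrix A (leb Ω) z w).PosSemidef :=
    sqMeasure_one (Ω := Ω) ▸ H (fun _ => 1) ⟨holo_const 1, memLp_const 1⟩
  have hspan : ∑ i, c i • ev A (z i) ∈ Submodule.span ℂ (Set.range (ev A)) :=
    sum_mem fun i _ => Submodule.smul_mem _ _ (Submodule.subset_span ⟨z i, rfl⟩)
  obtain ⟨f, ⟨F, hF, hfF⟩, g, -, hf, hg, hfg⟩ := exists_berg_rankOne_eq hΩ hc hb hA hspan hy hε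
  have hFB := memBergman_of_ae hF hfF
  have := isFiniteMeasure_sqMeasure hFB.2
  obtain ⟨G, hGg, hG⟩ := exists_inner_toL2_eq_rankOne (A := A) hF.continuous hfF hΩ g
  calc ‖∑ i, c i * w i‖ ≤ ‖G‖ * ‖toL2 (sqMeasure F) 1‖ :=
        norm_sum_mul_le_of_posSemidef (fun i => exists_reproduces_leb hΩ hb (z i)) Hleb
          (H F hFB) fun φ hφ => inner_toL2_eq_sum_of_unitBall (fun ψ => by rw [hG, hfg]) hφ
    _ ≤ (1 + ε) * (1 + ε) := by
        rw [norm_toL2_one_sqMeasure hF.continuous hfF]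
        exact mul_le_mul (hGg.trans hg) hf (norm_nonneg _) (by positivity)

theorem norm_sum_mul_le_one (hy : ‖∑ i, c i • ev A (z i)‖ ≤ 1) : ‖∑ i, c i * w i‖ ≤ 1 := by
  have hlim : Tendsto (fun ε : ℝ => (1 + ε) * (1 + ε)) (𝓝[>] 0) (𝓝 1) := by
    refine tendsto_nhdsWithin_of_tendsto_nhds (Continuous.tendsto' (by fun_prop) _ _ ?_)
    norm_num
  exact ge_of_tendsto hlim <| eventually_mem_nhdsWithin.mono fun ε hε =>
    norm_sum_mul_le_sq hΩ hc hb hA H hy hε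

theorem norm_sum_mul_le_norm_sum_ev (c : ι → ℂ) :
    ‖∑ i, c i * w i‖ ≤ ‖∑ i, c i • ev A (z i)‖ := by
  refine le_of_forall_gt_imp_ge_of_dense fun t ht => ?_
  have ht₀ : 0 < t := (norm_nonneg _).trans_lt ht
  have hinv : ‖((t : ℂ)⁻¹)‖ = t⁻¹ := by
    rw [norm_inv, Complex.norm_real, Real.norm_of_nonneg ht₀.le]
  have hscaled := norm_sum_mul_le_one (c := fun i => (t : ℂ)⁻¹ * c i) hΩ hc hb hA H (by
    simp only [mul_smul]
    rw [← Finset.smul_sum, norm_smul, hinv, inv_mul_le_one₀ ht₀]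
    exact ht.le)
  simp only [mul_assoc] at hscaled
  rwa [← Finset.mul_sum, norm_mul, hinv, inv_mul_le_one₀ ht₀] at hscaled

omit [Fintype ι] in
theorem exists_interpolating_of_posSemidef [Finite ι] :
    ∃ φ ∈ A, (∀ x : Ω, ‖(φ : Ω → ℂ) x‖ ≤ 1) ∧ ∀ i, (φ : Ω → ℂ) (z i) = w i := by
  classical
  cases nonempty_fintype ι
  obtain ⟨Λ, hΛ₁, hΛ⟩ := exists_clm_comp_eq (Fintype.linearCombination ℂ fun i => ev A (z i))
    (Fintype.linearCombination ℂ w) zero_le_one fun c => by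
      simpa only [Fintype.linearCombination_apply, smul_eq_mul, one_mul] using
        norm_sum_mul_le_norm_sum_ev hΩ hc hb hA H c
  obtain ⟨φ, hφ, hφΛ⟩ := exists_mem_forall_eq_clm_ev hΩ hA Λ
  refine ⟨φ, hφ, fun x => ?_, fun i => ?_⟩
  · rw [hφΛ]
    exact (norm_clm_ev_le A Λ x).trans hΛ₁
  · simpa only [Fintype.linearCombination_apply_single, one_smul, hφΛ] using hΛ (Pi.single i 1)

end Interpolation

end BergmanPick

end

theorem theorem1p2 {d n : ℕ} (Ω : Set (Fin d → ℂ)) (hΩ_open : IsOpen Ω)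
    (hΩ_conn : IsConnected Ω) (hΩ_bdd : Bornology.IsBounded Ω)
    (A : Subalgebra ℂ (BergmanPick.HInfty Ω))
    (hA : IsClosed[BergmanPick.weakStar Ω] (A : Set (BergmanPick.HInfty Ω)))
    (z : Fin n → Ω) (w : Fin n → ℂ) :
    (∃ φ ∈ A, (∀ x : Ω, ‖(φ : Ω → ℂ) x‖ ≤ 1) ∧ ∀ i, (φ : Ω → ℂ) (z i) = w i) ↔
      ∀ f : Ω → ℂ, BergmanPick.MemBergman Ω f →
        (Matrix.of fun i j : Fin n =>
          (1 - w i * conj (w j)) *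
            BergmanPick.kernel A (BergmanPick.sqMeasure f) (z i) (z j)).PosSemidef := by
  constructor
  · rintro ⟨φ, hφ, hφ₁, hφw⟩ f hf
    have := BergmanPick.isFiniteMeasure_sqMeasure hf.2
    rw [← funext hφw]
    exact BergmanPick.posSemidef_pickMatrix_of_norm_le_one hφ hφ₁
  · intro H
    exact BergmanPick.exists_interpolating_of_posSemidef hΩ_open hΩ_conn hΩ_bdd hA H
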